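/- Let $U:\mathbb R\to\mathbb R$ be smooth and $U_-,U_+\in\mathbb R$. Assume: (H1) $U'(y)>0$ for all $y$, $\lim_{y\to\pm\infty}U(y)=U_\pm$, and $U''/U$ (extended by continuity to the zero of $U$) is bounded on $\mathbb R$ and negative at every point. (H2) With $m=(-U''/U)^{1/2}$: for every $j\in\mathbb N$ there is $C_j>0$ with $|m^{(j)}|\le C_j m$ on $\mathbb R$; $m(y)\to0$ as $|y|\to\infty$; $m\in L^2(\mathbb R)$; and $U''/(U-U_+)$ and $U''/(U-U_-)$ belong to $L^\infty(\mathbb R)\cap L^2(\mathbb R)$. (H3) The infimum $\lambda_0$ of the spectrum of the self-adjoint operator $\mathcal L=-\partial_y^2-m^2$ on $L^2(\mathbb R)$ with domain $H^2(\mathbb R)$ satisfies $\lambda_0>-1$. For $\alpha\in\mathbb Z^*=\mathbb Z\setminus\{0\}$ let $\Delta_\alpha=\partial_y^2-\alpha^2$, $S=(1+m\Delta_\alpha^{-1}m)^{1/2}$ and $H=SUS$, where $m$ and $U$ act by multiplication on $L^2(\mathbb R)$ and the square root is the nonnegative one; $S$ and $H$ are bounded self-adjoint operators on $L^2(\mathbb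 R)$. Let $A=i\partial_y$, $\langle A\rangle=(1+A^2)^{1/2}$, and let $\|\cdot\|$ be the norm of $L^2(\mathbb R)$. Then for every integer $k\ge1$, every compact set $I_0\subset\,]U_-,U_+[$ and every smooth function $g_{I_0}:\mathbb R\to\mathbb C$ with support in $I_0$, there is a constant $C>0$ such that for every $\alpha\in\mathbb Z^*$, every $\psi_0\in H^k(\mathbb R)$ and every $t\ge0$, the solution $\psi$ of $$i\partial_t\psi=H\psi,\qquad \psi(0)=\psi_0,$$ satisfies $$\|\langle A\rangle^{-k}g_{I_0}(H)\psi(t)\|\le\frac{C}{1+t^k}\,\|\langle A\rangle^k\psi_0\|.$$ Here $g_{I_0}(H)$ is given by the functional calculus of $H$. In particular $C$ does not depend on $t$, $\alpha$ or $\psi_0$. -/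

import Mathlib

open MeasureTheory Filter Topology Set
open scoped ENNReal ContDiff FourierTransform

noncomputable section

namespace ShearFlow

/-- The complex Hilbert space `L²(ℝ)`. -/
abbrev L2 : Type := Lp ℂ 2 (volume : Measure ℝ)

/-! ### Multiplication operators and Fourier multipliers on `L²(ℝ)` -/

open scoped Classical in
/-- Multiplication by an essentially bounded function, as a bounded operator on `L²(ℝ)`
(the zero operator when `a` is not in `L^∞`). -/
def mulOp (a : ℝ → ℂ) : L2 →L[ℂ] L2 :=
  if h : MemLp a ∞ (volume : Measure ℝ) then
    (ContinuousLinearMap.mul ℂ ℂ).holderL volume ∞ 2 2 (h.toLp a)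
  else 0

theorem coeFn_mulOp {a : ℝ → ℂ} (h : MemLp a ∞ (volume : Measure ℝ)) (f : L2) :
    mulOp a f =ᵐ[volume] fun y => a y * f y := by
  have h1 := (ContinuousLinearMap.mul ℂ ℂ).coeFn_holder (r := 2) (h.toLp a) f
  have h2 := h.coeFn_toLp
  simp only [mulOp, dif_pos h, ContinuousLinearMap.holderL_apply_apply]
  filter_upwards [h1, h2] with y hy1 hy2
  rw [hy1, hy2]
  rfl

/-- Multiplication by an arbitrary function, as an unbounded operator on `L²(ℝ)` with its maximal
domain. -/
def mulPMap (a : ℝ → ℂ) : L2 →ₗ.[ℂ] L2 where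
  domain :=
    { carrier := {f | MemLp (fun y => a y * f y) 2 (volume : Measure ℝ)}
      add_mem' := by
        intro f g hf hg
        refine (hf.add hg).ae_eq ?_
        filter_upwards [Lp.coeFn_add f g] with y hy
        simp only [hy, Pi.add_apply, mul_add]
      zero_mem' := by
        refine (MemLp.zero (ε := ℂ)).ae_eq ?_
        filter_upwards [Lp.coeFn_zero ℂ 2 (volume : Measure ℝ)] with y hy
        simp
      smul_mem' := by
        intro c f hf
        refine (hf.const_smul c).ae_eq ?_
        filter_upwards [Lp.coeFn_smul c f] with y hy
        simp [hy, mul_left_comm] }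
  toFun :=
    { toFun := fun f => MemLp.toLp (fun y => a y * (f : L2) y) f.2
      map_add' := by
        intro f g
        rw [← MemLp.toLp_add]
        refine MemLp.toLp_congr _ _ ?_
        filter_upwards [Lp.coeFn_add (f : L2) (g : L2)] with y hy
        rw [Submodule.coe_add, hy, Pi.add_apply, Pi.add_apply, mul_add]
      map_smul' := by
        intro c f
        rw [RingHom.id_apply, ← MemLp.toLp_const_smul]
        refine MemLp.toLp_congr _ _ ?_
        filter_upwards [Lp.coeFn_smul c (f : L2)] with y hy
        simp [hy, mul_left_comm] }

/-- The Fourier transform of `L²(ℝ)`, with the convention `𝓕 f ξ = ∫ exp(-2πi yξ) f(y) dy`. -/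
def fourierL2 : L2 ≃ₗᵢ[ℂ] L2 := Lp.fourierTransformₗᵢ ℝ ℂ

/-- The bounded Fourier multiplier `f ↦ 𝓕⁻¹ (σ · 𝓕 f)`, for `σ` in `L^∞`. -/
def fourierMul (σ : ℝ → ℂ) : L2 →L[ℂ] L2 :=
  (fourierL2.symm : L2 →L[ℂ] L2) ∘L mulOp σ ∘L (fourierL2 : L2 →L[ℂ] L2)

/-- The unbounded Fourier multiplier `f ↦ 𝓕⁻¹ (σ · 𝓕 f)`, with its maximal domain
`{f ∈ L² : σ · 𝓕 f ∈ L²}`. -/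
def fourierPMap (σ : ℝ → ℂ) : L2 →ₗ.[ℂ] L2 where
  domain := (mulPMap σ).domain.comap (fourierL2.toLinearEquiv : L2 →ₗ[ℂ] L2)
  toFun :=
    { toFun := fun f => fourierL2.symm (mulPMap σ ⟨fourierL2 (f : L2), f.2⟩)
      map_add' := by
        intro f g
        rw [← map_add, ← LinearPMap.map_add]
        congr 2
        exact Subtype.ext (map_add fourierL2 (f : L2) (g : L2))
      map_smul' := by
        intro c f
        rw [RingHom.id_apply, ← map_smul, ← LinearPMap.map_smul]
        congr 2
        exact Subtype.ext (map_smul fourierL2 c (f : L2)) }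

/-! ### The operators `⟨A⟩ ^ k`, `⟨A⟩ ^ (-k)` with `A = i ∂_y`, and `Δ_α⁻¹`

In the Fourier variable, `∂_y` is multiplication by `2πiξ`, so `A` is multiplication by `-2πξ`,
`⟨A⟩ = (1 + A²)^(1/2)` is multiplication by `(1 + (2πξ)²)^(1/2)`, and `Δ_α = ∂_y² - α²` is
multiplication by `-((2πξ)² + α²)`. -/

/-- The symbol `(1 + (2πξ)²)^(1/2)` of `⟨A⟩`. -/
def bracketSymbol (ξ : ℝ) : ℝ := Real.sqrt (1 + (-(2 * Real.pi * ξ)) ^ 2)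

/-- The unbounded operator `⟨A⟩ ^ k` on `L²(ℝ)`; its domain is the Sobolev space `H^k(ℝ)`. -/
def bracketPow (k : ℕ) : L2 →ₗ.[ℂ] L2 :=
  fourierPMap fun ξ => ((bracketSymbol ξ ^ k : ℝ) : ℂ)

/-- The Sobolev space `H^k(ℝ)`. -/
def sobolev (k : ℕ) : Submodule ℂ L2 := (bracketPow k).domain

/-- The bounded operator `⟨A⟩ ^ (-k)` on `L²(ℝ)`. -/
def bracketNegPow (k : ℕ) : L2 →L[ℂ] L2 :=
  fourierMul fun ξ => (((bracketSymbol ξ ^ k)⁻¹ : ℝ) : ℂ)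

/-- The bounded operator `Δ_α⁻¹ = (∂_y² - α²)⁻¹` on `L²(ℝ)`, for `α ≠ 0`. -/
def invLaplacian (α : ℤ) : L2 →L[ℂ] L2 :=
  fourierMul fun ξ => ((-((2 * Real.pi * ξ) ^ 2 + (α : ℝ) ^ 2)⁻¹ : ℝ) : ℂ)

/-! ### The shear profile and the assumptions on it -/

/-- The function `U'' / U` on `ℝ`, extended by continuity to the zeros of `U`. -/
def curvatureRatio (U : ℝ → ℝ) : ℝ → ℝ :=
  extendFrom {y | U y ≠ 0} fun y => iteratedDeriv 2 U y / U y

/-- The function `m = (- U'' / U)^(1/2)`. -/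
def weight (U : ℝ → ℝ) (y : ℝ) : ℝ := Real.sqrt (-curvatureRatio U y)

/-- Assumption (H1): `U` is smooth, `U' > 0`, `U` has finite limits `U₋`, `U₊` at `∓∞`, and
`U'' / U` is bounded and negative everywhere. -/
structure AssumptionH1 (U : ℝ → ℝ) (Um Up : ℝ) : Prop where
  smooth : ContDiff ℝ ∞ U
  deriv_pos : ∀ y, 0 < deriv U y
  tendsto_atBot : Tendsto U atBot (𝓝 Um)
  tendsto_atTop : Tendsto U atTop (𝓝 Up)
  ratio_bounded : MemLp (curvatureRatio U) ∞ (volume : Measure ℝ)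
  ratio_neg : ∀ y, curvatureRatio U y < 0

/-- Assumption (H2): `|m^(k)| ≤ C_k m` for all `k`, `m → 0` at infinity, `m ∈ L²`, and
`U'' / (U - U_±) ∈ L^∞ ∩ L²`. -/
structure AssumptionH2 (U : ℝ → ℝ) (Um Up : ℝ) : Prop where
  iteratedDeriv_le : ∀ k : ℕ, ∃ C : ℝ, 0 < C ∧
    ∀ y, |iteratedDeriv k (weight U) y| ≤ C * weight U y
  tendsto_zero : Tendsto (weight U) (cocompact ℝ) (𝓝 0)
  memLp_two : MemLp (weight U) 2 (volume : Measure ℝ)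
  minus_memLp_top : MemLp (fun y => iteratedDeriv 2 U y / (U y - Um)) ∞ (volume : Measure ℝ)
  minus_memLp_two : MemLp (fun y => iteratedDeriv 2 U y / (U y - Um)) 2 (volume : Measure ℝ)
  plus_memLp_top : MemLp (fun y => iteratedDeriv 2 U y / (U y - Up)) ∞ (volume : Measure ℝ)
  plus_memLp_two : MemLp (fun y => iteratedDeriv 2 U y / (U y - Up)) 2 (volume : Measure ℝ)

/-- The resolvent set of an unbounded operator `T` on `L²(ℝ)`: those `z` for which
`T - z : D(T) → L²` has a bounded two-sided inverse. -/
def unboundedResolventSet (T : L2 →ₗ.[ℂ] L2) : Set ℂ :=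
  {z | ∃ R : L2 →L[ℂ] L2,
    (∀ f : L2, ∃ h : R f ∈ T.domain, T ⟨R f, h⟩ - z • R f = f) ∧
    ∀ u : T.domain, R (T u - z • (u : L2)) = u}

/-- The spectrum of an unbounded operator on `L²(ℝ)`. -/
def unboundedSpectrum (T : L2 →ₗ.[ℂ] L2) : Set ℂ := (unboundedResolventSet T)ᶜ

/-- The Schrödinger operator `𝓛 = -∂_y² - m²` with domain `H²(ℝ)` (the maximal domain of the
Fourier multiplier `-∂_y²`). -/
def schrodinger (U : ℝ → ℝ) : L2 →ₗ.[ℂ] L2 :=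
  (-(mulOp fun y => ((weight U y ^ 2 : ℝ) : ℂ)) : L2 →L[ℂ] L2).toLinearMap +ᵥ
    fourierPMap fun ξ => (((2 * Real.pi * ξ) ^ 2 : ℝ) : ℂ)

/-- Assumption (H3): the infimum `λ₀` of the (real) spectrum of `𝓛` satisfies `λ₀ > -1`. -/
def AssumptionH3 (U : ℝ → ℝ) : Prop :=
  ∃ lam0 : ℝ, IsGLB {lam : ℝ | (lam : ℂ) ∈ unboundedSpectrum (schrodinger U)} lam0 ∧ -1 < lam0

/-! ### The symmetrized linearized Euler equation -/

/-- The operator `g(T)` given by the continuous functional calculus, for a complex valued function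
`g` on the line and a self-adjoint `T` (whose spectrum is real). -/
def functionOf (g : ℝ → ℂ) (T : L2 →L[ℂ] L2) : L2 →L[ℂ] L2 :=
  cfc (fun z : ℂ => g z.re) T

/-- `Σ = 1 + m Δ_α⁻¹ m`. -/
def sigmaOp (U : ℝ → ℝ) (α : ℤ) : L2 →L[ℂ] L2 :=
  1 + (mulOp fun y => (weight U y : ℂ)) * invLaplacian α * (mulOp fun y => (weight U y : ℂ))

/-- `S = (1 + m Δ_α⁻¹ m)^(1/2)`, the nonnegative square root. -/
def symmetrizer (U : ℝ → ℝ) (α : ℤ) : L2 →L[ℂ] L2 :=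
  functionOf (fun x : ℝ => (Real.sqrt x : ℂ)) (sigmaOp U α)

/-- `H = S U S`. -/
def hamiltonian (U : ℝ → ℝ) (α : ℤ) : L2 →L[ℂ] L2 :=
  symmetrizer U α * (mulOp fun y => (U y : ℂ)) * symmetrizer U α

/-- `ψ` is the solution of `i ∂_t ψ = H ψ`, for `t ≥ 0`, with initial value `ψ₀` (one-sided
derivative at `t = 0`). -/
def IsSolution (H : L2 →L[ℂ] L2) (ψ₀ : L2) (ψ : ℝ → L2) : Prop :=
  ψ 0 = ψ₀ ∧ ∀ t : ℝ, 0 ≤ t →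
    ∃ ψ' : L2, HasDerivWithinAt ψ ψ' (Ici 0) t ∧ Complex.I • ψ' = H (ψ t)

end ShearFlow

end

open ShearFlow

/-!
# Local decay for the linearized Euler flow near a monotone shear, uniformly in the wave number

The proof is a commutator method in which every constant is independent of the wave number `α`.
The conjugate operator `A = i ∂_y` grows along the flow of `H`, because `-i [A, H]` is close to
multiplication by `U' > 0`: up to compact operators of size `O(α⁻²)`, `H` is multiplication by `U`
and `[A, H]` is multiplication by `i U'` (`exists_hamiltonian_deriv`). For this the symmetrizer `S`
has to be a smooth function of `1 + m Δ_α⁻¹ m`, uniformly in `α`; this is what (H3) provides,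
through the Birman-Schwinger principle, in the form `‖m (1 - ∂_y²)⁻¹ m‖ < 1`
(`norm_birman_one_lt`).

*Strict positivity.* On functions localized in energy near a point of the range of `U`, the operator
`-i [A, H]` is bounded from below by a constant that does not depend on `α` (`exists_mourre`). For
large `α` the error terms are small in norm. For each of the remaining finitely many `α` they are
compact, and disappear in the limit of sharp localization, since `H` has no eigenvalue in the range
of `U`: an eigenvector would give a solution of Rayleigh's equation that vanishes at the critical
point, which Rayleigh's inequality excludes (`eq_zero_of_hamiltonian_eigenvector`).

*Commutators.* Boundedness of the first `N` iterated commutators with `A` is recorded by `Bd`, with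
a bound that is submultiplicative. It is inherited by smooth functions of a self-adjoint operator
(`exists_bd_functionOf`): such a function is a Fourier series in the operators `exp(i n a T)`, and
their commutators grow only polynomially in `n`. Bounded commutators imply that the blocks of an
operator between unit spectral intervals of `A` decay away from the diagonal (`Bd.block_decay`). So
commutators with slowly varying functions of `A` can be estimated by Schur's test, relative to the
weight itself (`exists_norm_commutator_le`, `exists_inner_commutator_le`), and no pseudodifferential
calculus is needed.

*Decay.* If `F` is decreasing and varies slowly enough, then the expectation of `F (A - v t)` in an
energy-localized solution does not increase in time, where `v` is half the constant of the Mourre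
estimate (`exists_energy_antitone`). For the `2k`-th power of the weight `hump ε (x / R)`, with `ε`
comparable to `1 / (1 + t)`, the expectation at time `0` is at most a multiple of
`‖⟨A⟩^k ψ(0)‖²`, while at time `t` it is at least a multiple of `(1 + t)^(2k) ‖⟨A⟩^(-k) ψ(t)‖²`. The
comparison of the two is the decay estimate (`exists_decay`). A partition of unity reduces the
compact set of energies to small intervals.
-/

open scoped InnerProductSpace

noncomputable section

namespace ShearFlow

/-- Bounded measurable functions, the symbols for which multiplication operators are used. -/
structure BddMeas (a : ℝ → ℂ) : Prop where
  meas : Measurable a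
  bdd : ∃ C : ℝ, ∀ x, ‖a x‖ ≤ C

namespace BddMeas

variable {a b : ℝ → ℂ}

theorem memLp (ha : BddMeas a) : MemLp a ∞ (volume : Measure ℝ) := by
  obtain ⟨C, hC⟩ := ha.bdd
  exact memLp_top_of_bound ha.meas.aestronglyMeasurable C (Eventually.of_forall hC)

theorem add (ha : BddMeas a) (hb : BddMeas b) : BddMeas fun x => a x + b x := by
  obtain ⟨C, hC⟩ := ha.bdd
  obtain ⟨D, hD⟩ := hb.bdd
  exact ⟨ha.meas.add hb.meas, C + D, fun x => (norm_add_le _ _).trans (add_le_add (hC x) (hD x))⟩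

theorem mul (ha : BddMeas a) (hb : BddMeas b) : BddMeas fun x => a x * b x := by
  obtain ⟨C, hC⟩ := ha.bdd
  obtain ⟨D, hD⟩ := hb.bdd
  exact ⟨ha.meas.mul hb.meas, C * D, fun x => by
    rw [norm_mul]
    exact mul_le_mul (hC x) (hD x) (norm_nonneg _) ((norm_nonneg _).trans (hC x))⟩

theorem const (c : ℂ) : BddMeas fun _ => c := ⟨measurable_const, ‖c‖, fun _ => le_rfl⟩

theorem neg (ha : BddMeas a) : BddMeas fun x => -a x := by
  obtain ⟨C, hC⟩ := ha.bdd
  exact ⟨ha.meas.neg, C, fun x => by simpa using hC x⟩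

theorem sub (ha : BddMeas a) (hb : BddMeas b) : BddMeas fun x => a x - b x := by
  simpa [sub_eq_add_neg] using ha.add hb.neg

theorem conj (ha : BddMeas a) : BddMeas fun x => starRingEnd ℂ (a x) := by
  obtain ⟨C, hC⟩ := ha.bdd
  exact ⟨Complex.continuous_conj.measurable.comp ha.meas, C, fun x => by simpa using hC x⟩

theorem comp (ha : BddMeas a) {φ : ℝ → ℝ} (hφ : Measurable φ) : BddMeas fun x => a (φ x) := by
  obtain ⟨C, hC⟩ := ha.bdd
  exact ⟨ha.meas.comp hφ, C, fun x => hC _⟩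

end BddMeas

/-! ### The calculus of multiplication operators and Fourier multipliers -/

section MulOp

variable {a b : ℝ → ℂ}

theorem norm_mulOp_le {C : ℝ} (hC : 0 ≤ C) (h : ∀ x, ‖a x‖ ≤ C) : ‖mulOp a‖ ≤ C := by
  by_cases hm : MemLp a ∞ (volume : Measure ℝ)
  · refine ContinuousLinearMap.opNorm_le_bound _ hC fun f => ?_
    refine Lp.norm_le_mul_norm_of_ae_le_mul ?_
    filter_upwards [coeFn_mulOp hm f] with y hy
    rw [hy, norm_mul]
    exact mul_le_mul_of_nonneg_right (h y) (norm_nonneg _)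
  · simp [mulOp, dif_neg hm, hC]

theorem mulOp_mul (ha : BddMeas a) (hb : BddMeas b) :
    mulOp (fun x => a x * b x) = mulOp a * mulOp b := by
  ext1 f
  refine Lp.ext ?_
  filter_upwards [coeFn_mulOp (ha.mul hb).memLp f, coeFn_mulOp hb.memLp f,
    coeFn_mulOp ha.memLp (mulOp b f)] with y h1 h2 h3
  rw [h1, mul_apply_eq_comp, h3, h2, mul_assoc]

theorem mulOp_add (ha : BddMeas a) (hb : BddMeas b) :
    mulOp (fun x => a x + b x) = mulOp a + mulOp b := by
  ext1 f
  refine Lp.ext ?_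
  filter_upwards [coeFn_mulOp (ha.add hb).memLp f, coeFn_mulOp hb.memLp f,
    coeFn_mulOp ha.memLp f, Lp.coeFn_add (mulOp a f) (mulOp b f)] with y h1 h2 h3 h4
  rw [h1, add_apply, h4, Pi.add_apply, h3, h2, add_mul]

theorem mulOp_const (c : ℂ) : mulOp (fun _ => c) = c • (1 : L2 →L[ℂ] L2) := by
  ext1 f
  refine Lp.ext ?_
  filter_upwards [coeFn_mulOp (BddMeas.const c).memLp f, Lp.coeFn_smul c f] with y h1 h2
  rw [h1]
  simp [h2]

theorem mulOp_smul (c : ℂ) (ha : BddMeas a) : mulOp (fun x => c * a x) = c • mulOp a := by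
  rw [mulOp_mul (BddMeas.const c) ha, mulOp_const]
  simp

theorem mulOp_neg (ha : BddMeas a) : mulOp (fun x => -a x) = -mulOp a := by
  have := mulOp_smul (-1) ha
  simpa using this

theorem mulOp_sub (ha : BddMeas a) (hb : BddMeas b) :
    mulOp (fun x => a x - b x) = mulOp a - mulOp b := by
  simp only [sub_eq_add_neg]
  rw [mulOp_add ha hb.neg, mulOp_neg hb]

theorem mulOp_star (ha : BddMeas a) :
    star (mulOp a) = mulOp fun x => starRingEnd ℂ (a x) := by
  rw [ContinuousLinearMap.star_eq_adjoint]
  symm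
  rw [ContinuousLinearMap.eq_adjoint_iff]
  intro f g
  rw [L2.inner_def, L2.inner_def]
  refine integral_congr_ae ?_
  filter_upwards [coeFn_mulOp ha.conj.memLp f, coeFn_mulOp ha.memLp g] with y h1 h2
  rw [h1, h2]
  simp
  ring

theorem isSelfAdjoint_mulOp (ha : BddMeas a) (h : ∀ x, starRingEnd ℂ (a x) = a x) :
    IsSelfAdjoint (mulOp a) := by
  rw [IsSelfAdjoint, mulOp_star ha]
  simp only [h]

theorem fourierMul_apply (σ : ℝ → ℂ) (f : L2) :
    fourierMul σ f = fourierL2.symm (mulOp σ (fourierL2 f)) := rfl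

theorem norm_fourierMul_le {C : ℝ} (hC : 0 ≤ C) (h : ∀ x, ‖a x‖ ≤ C) : ‖fourierMul a‖ ≤ C := by
  refine ContinuousLinearMap.opNorm_le_bound _ hC fun f => ?_
  rw [fourierMul_apply, LinearIsometryEquiv.norm_map]
  refine ((mulOp a).le_opNorm _).trans ?_
  rw [LinearIsometryEquiv.norm_map]
  exact mul_le_mul_of_nonneg_right (norm_mulOp_le hC h) (norm_nonneg _)

theorem fourierMul_mul (ha : BddMeas a) (hb : BddMeas b) :
    fourierMul (fun x => a x * b x) = fourierMul a * fourierMul b := by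
  ext1 f
  simp [fourierMul_apply, mulOp_mul ha hb]

theorem fourierMul_add (ha : BddMeas a) (hb : BddMeas b) :
    fourierMul (fun x => a x + b x) = fourierMul a + fourierMul b := by
  ext1 f
  simp [fourierMul_apply, mulOp_add ha hb]

theorem fourierMul_const (c : ℂ) : fourierMul (fun _ => c) = c • (1 : L2 →L[ℂ] L2) := by
  ext1 f
  simp [fourierMul_apply, mulOp_const]

theorem fourierMul_star (ha : BddMeas a) :
    star (fourierMul a) = fourierMul fun x => starRingEnd ℂ (a x) := by
  rw [ContinuousLinearMap.star_eq_adjoint]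
  symm
  rw [ContinuousLinearMap.eq_adjoint_iff]
  intro f g
  have h := mulOp_star ha
  rw [ContinuousLinearMap.star_eq_adjoint] at h
  have h2 := (ContinuousLinearMap.eq_adjoint_iff _ _).1 h.symm (fourierL2 f) (fourierL2 g)
  rw [fourierMul_apply, fourierMul_apply]
  rw [← LinearIsometryEquiv.inner_map_map fourierL2, LinearIsometryEquiv.apply_symm_apply, h2,
    ← LinearIsometryEquiv.inner_map_map fourierL2 f, LinearIsometryEquiv.apply_symm_apply]

end MulOp

/-! ### Functions of `A` -/

/-- The function `σ(A)` of `A = i ∂_y`, which is multiplication by `-2πξ` in the Fourier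
variable. -/
def fnA (σ : ℝ → ℂ) : L2 →L[ℂ] L2 := fourierMul fun ξ => σ (-(2 * Real.pi * ξ))

section FnA

variable {a b : ℝ → ℂ}

theorem BddMeas.compA (ha : BddMeas a) : BddMeas fun ξ : ℝ => a (-(2 * Real.pi * ξ)) :=
  ha.comp (by fun_prop)

theorem norm_fnA_le {C : ℝ} (hC : 0 ≤ C) (h : ∀ x, ‖a x‖ ≤ C) : ‖fnA a‖ ≤ C :=
  norm_fourierMul_le hC fun _ => h _

theorem fnA_mul (ha : BddMeas a) (hb : BddMeas b) : fnA (fun x => a x * b x) = fnA a * fnA b :=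
  fourierMul_mul ha.compA hb.compA

theorem fnA_add (ha : BddMeas a) (hb : BddMeas b) : fnA (fun x => a x + b x) = fnA a + fnA b :=
  fourierMul_add ha.compA hb.compA

theorem fnA_const (c : ℂ) : fnA (fun _ => c) = c • (1 : L2 →L[ℂ] L2) := fourierMul_const c

theorem fnA_star (ha : BddMeas a) : star (fnA a) = fnA fun x => starRingEnd ℂ (a x) :=
  fourierMul_star ha.compA

theorem fnA_smul (c : ℂ) (ha : BddMeas a) : fnA (fun x => c * a x) = c • fnA a := by
  rw [fnA_mul (BddMeas.const c) ha, fnA_const]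
  simp

theorem fnA_neg (ha : BddMeas a) : fnA (fun x => -a x) = -fnA a := by
  have := fnA_smul (-1) ha
  simpa using this

theorem fnA_sub (ha : BddMeas a) (hb : BddMeas b) :
    fnA (fun x => a x - b x) = fnA a - fnA b := by
  simp only [sub_eq_add_neg]
  rw [fnA_add ha hb.neg, fnA_neg hb]

theorem fnA_comm (ha : BddMeas a) (hb : BddMeas b) : fnA a * fnA b = fnA b * fnA a := by
  rw [← fnA_mul ha hb, ← fnA_mul hb ha]
  simp only [mul_comm]

theorem norm_mulOp_apply_le_of_le (ha : BddMeas a) (hb : BddMeas b) {C : ℝ}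
    (h : ∀ x, ‖a x‖ ≤ C * ‖b x‖) (f : L2) : ‖mulOp a f‖ ≤ C * ‖mulOp b f‖ := by
  refine Lp.norm_le_mul_norm_of_ae_le_mul ?_
  filter_upwards [coeFn_mulOp ha.memLp f, coeFn_mulOp hb.memLp f] with y h1 h2
  rw [h1, h2, norm_mul, norm_mul, ← mul_assoc]
  exact mul_le_mul_of_nonneg_right (h y) (norm_nonneg _)

theorem norm_fnA_apply (a : ℝ → ℂ) (f : L2) :
    ‖fnA a f‖ = ‖mulOp (fun ξ => a (-(2 * Real.pi * ξ))) (fourierL2 f)‖ := by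
  rw [fnA, fourierMul_apply, LinearIsometryEquiv.norm_map]

theorem norm_fnA_apply_le_of_le (ha : BddMeas a) (hb : BddMeas b) {C : ℝ}
    (h : ∀ x, ‖a x‖ ≤ C * ‖b x‖) (f : L2) : ‖fnA a f‖ ≤ C * ‖fnA b f‖ := by
  rw [norm_fnA_apply, norm_fnA_apply]
  exact norm_mulOp_apply_le_of_le ha.compA hb.compA (fun _ => h _) _

end FnA

/-! ### The inverse Fourier integral -/

/-- The inverse Fourier transform of `L²` is given by the Fourier integral on `L¹ ∩ L²`. -/
theorem fourierL2_symm_ae_eq {f : L2} (hf : Integrable f) :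
    fourierL2.symm f =ᵐ[volume] 𝓕⁻ (f : ℝ → ℂ) := by
  have hc : Continuous (𝓕⁻ (f : ℝ → ℂ)) :=
    VectorFourier.fourierIntegral_continuous Real.continuous_fourierChar
      (L := -innerₗ ℝ) (by exact continuous_inner.neg) hf
  have hloc : LocallyIntegrable (fourierL2.symm f : ℝ → ℂ) volume :=
    (Lp.memLp (fourierL2.symm f)).locallyIntegrable (by norm_num)
  refine ae_eq_of_integral_contDiff_smul_eq hloc hc.locallyIntegrable fun g hg hgs => ?_
  -- test functions are Schwartz functions, on which both transforms are known
  have hg' : HasCompactSupport fun x => (g x : ℂ) := hgs.comp_left (g := ((↑) : ℝ → ℂ)) (by simp)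
  have hgc : ContDiff ℝ ∞ fun x => (g x : ℂ) := Complex.ofRealCLM.contDiff.comp hg
  let φ : SchwartzMap ℝ ℂ := hg'.toSchwartzMap hgc
  have hφ : ∀ x, φ x = (g x : ℂ) := fun x => rfl
  have e1 : ∫ x, g x • (fourierL2.symm f : ℝ → ℂ) x = ⟪φ.toLp 2, fourierL2.symm f⟫_ℂ := by
    rw [L2.inner_def]
    refine integral_congr_ae ?_
    filter_upwards [φ.coeFn_toLp 2 volume] with x hx
    rw [hx, hφ]
    simp [mul_comm]
  have e2 : ⟪φ.toLp 2, fourierL2.symm f⟫_ℂ = ⟪(𝓕 φ).toLp 2, f⟫_ℂ := by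
    rw [← LinearIsometryEquiv.inner_map_map fourierL2, LinearIsometryEquiv.apply_symm_apply,
      ← SchwartzMap.toLp_fourier_eq]
    rfl
  have e3 : ⟪(𝓕 φ).toLp 2, f⟫_ℂ = ∫ x, starRingEnd ℂ ((𝓕 φ) x) * f x := by
    rw [L2.inner_def]
    refine integral_congr_ae ?_
    filter_upwards [(𝓕 φ).coeFn_toLp 2 volume] with x hx
    rw [hx]
    simp [mul_comm]
  have e4 : ∀ x, starRingEnd ℂ ((𝓕 φ) x) = 𝓕⁻ (fun y => (g y : ℂ)) x := by
    intro x
    rw [SchwartzMap.fourier_coe, Real.fourierInv_eq', Real.fourier_eq', ← integral_conj]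
    refine integral_congr_ae (Eventually.of_forall fun y => ?_)
    simp only [hφ, smul_eq_mul, map_mul, Complex.conj_ofReal, ← Complex.exp_conj]
    simp
  rw [e1, e2, e3]
  simp only [e4]
  have := VectorFourier.integral_bilin_fourierIntegral_eq_flip
    (M := ContinuousLinearMap.mul ℂ ℂ) (L := -innerₗ ℝ) (μ := volume) (ν := volume)
    (e := Real.fourierChar) Real.continuous_fourierChar continuous_inner.neg
    (f := fun y => (g y : ℂ)) (g := (f : ℝ → ℂ)) (φ.integrable (μ := volume)) hf
  have hfl : (-innerₗ ℝ).flip = -innerₗ ℝ := by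
    ext
    simp
  simp only [hfl, ContinuousLinearMap.mul_apply'] at this
  refine Eq.trans this ?_
  refine integral_congr_ae (Eventually.of_forall fun y => ?_)
  simp only [Complex.real_smul]
  rfl

/-! ### Translations -/

/-- The symbol of the translation `e^{isA}`. -/
def translationSymbol (s : ℝ) (x : ℝ) : ℂ := Complex.exp (Complex.I * (s * x : ℝ))

theorem norm_translationSymbol (s x : ℝ) : ‖translationSymbol s x‖ = 1 := by
  rw [translationSymbol, mul_comm, Complex.norm_exp_ofReal_mul_I]

theorem bddMeas_translationSymbol (s : ℝ) : BddMeas (translationSymbol s) := by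
  refine ⟨?_, 1, fun x => (norm_translationSymbol s x).le⟩
  unfold translationSymbol
  fun_prop

/-- The unitary group `e^{isA}`, which acts as `f ↦ f(· - s)`. -/
def transl (s : ℝ) : L2 →L[ℂ] L2 := fnA (translationSymbol s)

theorem transl_add (s t : ℝ) : transl (s + t) = transl s * transl t := by
  rw [transl, transl, transl, ← fnA_mul (bddMeas_translationSymbol s) (bddMeas_translationSymbol t)]
  congr 1
  funext x
  simp only [translationSymbol, ← Complex.exp_add]
  congr 1
  push_cast
  ring

@[simp]
theorem transl_zero : transl 0 = 1 := by
  have : translationSymbol 0 = fun _ => 1 := by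
    funext x
    simp [translationSymbol]
  rw [transl, this, fnA_const, one_smul]

theorem transl_neg_mul (s : ℝ) : transl (-s) * transl s = 1 := by
  rw [← transl_add, neg_add_cancel, transl_zero]

theorem transl_mul_neg (s : ℝ) : transl s * transl (-s) = 1 := by
  rw [← transl_add, add_neg_cancel, transl_zero]

theorem norm_transl_le (s : ℝ) : ‖transl s‖ ≤ 1 :=
  norm_fnA_le zero_le_one fun x => (norm_translationSymbol s x).le

theorem measurePreserving_sub (s : ℝ) :
    MeasurePreserving (fun y : ℝ => y - s) volume volume :=
  measurePreserving_sub_right volume s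

theorem transl_eq_comp (s : ℝ) (f : L2) :
    transl s f = Lp.compMeasurePreserving (fun y : ℝ => y - s) (measurePreserving_sub s) f := by
  have hd := SchwartzMap.denseRange_toLpCLM (E := ℝ) (F := ℂ) (p := 2) (μ := volume) (by norm_num)
  refine hd.induction_on (p := fun f => transl s f = Lp.compMeasurePreserving
    (fun y : ℝ => y - s) (measurePreserving_sub s) f) f ?_ ?_
  · exact isClosed_eq (transl s).continuous
      (Lp.isometry_compMeasurePreserving (measurePreserving_sub s)).continuous
  intro φ
  change transl s (φ.toLp 2) = Lp.compMeasurePreserving _ _ (φ.toLp 2)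
  have hF : fourierL2 (φ.toLp 2) = (𝓕 φ).toLp 2 := SchwartzMap.toLp_fourier_eq φ
  set σ : ℝ → ℂ := fun ξ => translationSymbol s (-(2 * Real.pi * ξ)) with hσ
  have hσb : BddMeas σ := (bddMeas_translationSymbol s).compA
  have hg : (mulOp σ ((𝓕 φ).toLp 2) : ℝ → ℂ) =ᵐ[volume] fun ξ => σ ξ * (𝓕 φ) ξ := by
    filter_upwards [coeFn_mulOp hσb.memLp ((𝓕 φ).toLp 2), (𝓕 φ).coeFn_toLp 2 volume] with ξ h1 h2
    rw [h1, h2]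
  have hint : Integrable (mulOp σ ((𝓕 φ).toLp 2) : ℝ → ℂ) := by
    refine Integrable.congr ?_ hg.symm
    refine ((𝓕 φ).integrable (μ := volume)).bdd_mul (c := 1) hσb.meas.aestronglyMeasurable ?_
    exact Eventually.of_forall fun ξ => (norm_translationSymbol s _).le
  refine Lp.ext ?_
  rw [transl, fnA, fourierMul_apply, hF]
  have hφs := (measurePreserving_sub s).quasiMeasurePreserving.ae_eq_comp (φ.coeFn_toLp 2 volume)
  filter_upwards [fourierL2_symm_ae_eq hint, Lp.coeFn_compMeasurePreserving (φ.toLp 2)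
    (measurePreserving_sub s), hφs] with y h1 h2 h3
  rw [h1, h2, h3, Real.fourierInv_congr_ae hg]
  have : φ (y - s) = 𝓕⁻ (⇑(𝓕 φ : SchwartzMap ℝ ℂ)) (y - s) := by
    rw [← SchwartzMap.fourierInv_coe, FourierTransform.fourierInv_fourier_eq]
  rw [Function.comp_apply, this, Real.fourierInv_eq', Real.fourierInv_eq']
  refine integral_congr_ae (Eventually.of_forall fun ξ => ?_)
  simp only [hσ, translationSymbol, smul_eq_mul, ← mul_assoc, ← Complex.exp_add]
  congr 2
  simp
  ring

theorem transl_mul_mulOp {u : ℝ → ℂ} (hu : BddMeas u) (s : ℝ) :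
    transl s * mulOp u = (mulOp fun y => u (y - s)) * transl s := by
  ext1 f
  rw [mul_apply_eq_comp, mul_apply_eq_comp, transl_eq_comp, transl_eq_comp]
  refine Lp.ext ?_
  have h1 := (measurePreserving_sub s).quasiMeasurePreserving.ae_eq_comp (coeFn_mulOp hu.memLp f)
  filter_upwards [h1, Lp.coeFn_compMeasurePreserving (mulOp u f) (measurePreserving_sub s),
    coeFn_mulOp (hu.comp (φ := fun y => y - s) (by fun_prop)).memLp
      (Lp.compMeasurePreserving (fun y : ℝ => y - s) (measurePreserving_sub s) f),
    Lp.coeFn_compMeasurePreserving f (measurePreserving_sub s)] with y h1 h2 h3 h4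
  rw [h2, h1, h3, h4]
  rfl

/-! ### Bounded commutators with `A` -/

/-- Taylor's formula for a function with Lipschitz derivative. -/
theorem norm_sub_sub_le_of_lipschitz_deriv {u u' : ℝ → ℂ} {C : ℝ}
    (hd : ∀ x, HasDerivAt u (u' x) x) (hL : ∀ x y, ‖u' x - u' y‖ ≤ C * |x - y|) (y s : ℝ) :
    ‖u (y - s) - u y - (-(s : ℂ)) * u' y‖ ≤ C * |s| ^ 2 := by
  have hC : 0 ≤ C := by simpa using (norm_nonneg _).trans (hL 1 0)
  have := Convex.norm_image_sub_le_of_norm_hasDerivWithin_le (f := fun z => u z - (z : ℂ) * u' y)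
    (f' := fun z => u' z - u' y) (C := C * |s|) (s := segment ℝ y (y - s)) (x := y) (y := y - s)
    (fun z _ => by
      have h1 : HasDerivAt (fun z : ℝ => (z : ℂ) * u' y) (u' y) z := by
        simpa using (Complex.ofRealCLM.hasDerivAt (x := z)).mul_const (u' y)
      exact ((hd z).sub h1).hasDerivWithinAt)
    (fun z hz => by
      refine (hL z y).trans (mul_le_mul_of_nonneg_left ?_ hC)
      have := norm_sub_le_of_mem_segment hz
      simpa [Real.norm_eq_abs] using this)
    (convex_segment _ _) (left_mem_segment _ _ _) (right_mem_segment _ _ _)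
  have e2 : u (y - s) - ((y - s : ℝ) : ℂ) * u' y - (u y - (y : ℂ) * u' y) =
      u (y - s) - u y - (-(s : ℂ)) * u' y := by
    push_cast
    ring
  rw [e2] at this
  refine this.trans (le_of_eq ?_)
  simp only [Real.norm_eq_abs, sub_sub_cancel_left, abs_neg]
  ring

/-- `T'` is the (bounded) commutator `[A, T]`: the derivative at `0` of `e^{isA} T e^{-isA}`, in
operator norm, is `i T'`. -/
def IsAd (T T' : L2 →L[ℂ] L2) : Prop :=
  HasDerivAt (fun s : ℝ => transl s * T * transl (-s)) (Complex.I • T') 0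

namespace IsAd

variable {T S T' S' : L2 →L[ℂ] L2}

theorem unique (h : IsAd T T') (h' : IsAd T S') : T' = S' :=
  (smul_right_injective _ Complex.I_ne_zero) (HasDerivAt.unique h h')

theorem one : IsAd 1 0 := by
  have : (fun s : ℝ => transl s * 1 * transl (-s)) = fun _ => 1 := by
    funext s
    rw [mul_one, transl_mul_neg]
  rw [IsAd, this, smul_zero]
  exact hasDerivAt_const _ _

theorem fnA {σ : ℝ → ℂ} (hσ : BddMeas σ) : IsAd (fnA σ) 0 := by
  have : (fun s : ℝ => transl s * ShearFlow.fnA σ * transl (-s)) = fun _ => ShearFlow.fnA σ := by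
    funext s
    rw [transl, fnA_comm (bddMeas_translationSymbol s) hσ, mul_assoc]
    exact (congrArg (ShearFlow.fnA σ * ·) (transl_mul_neg s)).trans (mul_one _)
  rw [IsAd, this, smul_zero]
  exact hasDerivAt_const _ _

theorem add (hT : IsAd T T') (hS : IsAd S S') : IsAd (T + S) (T' + S') := by
  have := HasDerivAt.add hT hS
  rw [IsAd, smul_add]
  refine this.congr_of_eventuallyEq (Eventually.of_forall fun s => ?_)
  simp [mul_add, add_mul]

theorem smul (c : ℂ) (hT : IsAd T T') : IsAd (c • T) (c • T') := by
  have := HasDerivAt.const_smul c hT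
  rw [IsAd, smul_comm]
  refine this.congr_of_eventuallyEq (Eventually.of_forall fun s => ?_)
  simp

theorem mul (hT : IsAd T T') (hS : IsAd S S') : IsAd (T * S) (T' * S + T * S') := by
  have := HasDerivAt.mul hT hS
  refine (this.congr_of_eventuallyEq (Eventually.of_forall fun s => ?_)).congr_deriv ?_
  · change transl s * (T * S) * transl (-s) =
      transl s * T * transl (-s) * (transl s * S * transl (-s))
    rw [show transl s * T * transl (-s) * (transl s * S * transl (-s)) =
      transl s * T * (transl (-s) * transl s) * S * transl (-s) by simp only [mul_assoc],
      transl_neg_mul, mul_one, mul_assoc (transl s) T S]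
  · simp [smul_add]

theorem neg (hT : IsAd T T') : IsAd (-T) (-T') := by
  simpa using hT.smul (-1)

theorem sub (hT : IsAd T T') (hS : IsAd S S') : IsAd (T - S) (T' - S') := by
  simpa [sub_eq_add_neg] using hT.add hS.neg

theorem hasDerivAt (hT : IsAd T T') (s : ℝ) :
    HasDerivAt (fun s : ℝ => transl s * T * transl (-s))
      (transl s * (Complex.I • T') * transl (-s)) s := by
  have h0 : HasDerivAt (fun r : ℝ => transl r * T * transl (-r)) (Complex.I • T') (s - s) := by
    rw [sub_self]
    exact hT
  have h1 := ((h0.comp_sub_const s s).const_mul (transl s)).mul_const (transl (-s))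
  refine h1.congr_of_eventuallyEq (Eventually.of_forall fun r => ?_)
  change transl r * T * transl (-r) = transl s * (transl (r - s) * T * transl (-(r - s))) * transl (-s)
  have e1 : transl r = transl s * transl (r - s) := by rw [← transl_add, add_sub_cancel]
  have e2 : transl (-r) = transl (-(r - s)) * transl (-s) := by
    rw [← transl_add]
    congr 1
    ring
  rw [e1, e2]
  simp only [mul_assoc]

theorem norm_conj_le (T : L2 →L[ℂ] L2) (s : ℝ) : ‖transl s * T * transl (-s)‖ ≤ ‖T‖ := by
  calc ‖transl s * T * transl (-s)‖ ≤ ‖transl s‖ * ‖T‖ * ‖transl (-s)‖ :=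
        (norm_mul_le _ _).trans (mul_le_mul_of_nonneg_right (norm_mul_le _ _) (norm_nonneg _))
    _ ≤ 1 * ‖T‖ * 1 := by
        gcongr
        · exact norm_transl_le s
        · exact norm_transl_le _
    _ = ‖T‖ := by ring

theorem tsum {ι : Type*} {F F' : ι → L2 →L[ℂ] L2} (h : ∀ i, IsAd (F i) (F' i))
    (hF : Summable fun i => ‖F i‖) (hF' : Summable fun i => ‖F' i‖) :
    IsAd (∑' i, F i) (∑' i, F' i) := by
  have key := hasDerivAt_tsum (u := fun i => ‖F' i‖) hF'
    (g := fun i s => transl s * F i * transl (-s)) (fun i s => (h i).hasDerivAt s)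
    (fun i s => (norm_conj_le _ s).trans (by rw [norm_smul]; simp))
    (y₀ := 0) (by simpa using hF.of_norm) 0
  have e1 : ∀ s, ∑' i, transl s * F i * transl (-s) = transl s * (∑' i, F i) * transl (-s) := by
    intro s
    rw [← Summable.tsum_mul_left _ hF.of_norm, Summable.tsum_mul_right]
    exact hF.of_norm.mul_left _
  simp only [e1] at key
  refine HasDerivAt.congr_deriv key ?_
  simp [Summable.tsum_const_smul _ hF'.of_norm]

theorem mulOp {u u' : ℝ → ℂ} (hu : BddMeas u) (hu' : BddMeas u') {C : ℝ}
    (hd : ∀ x, HasDerivAt u (u' x) x) (hL : ∀ x y, ‖u' x - u' y‖ ≤ C * |x - y|) :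
    IsAd (mulOp u) (ShearFlow.mulOp fun y => Complex.I * u' y) := by
  have hC : 0 ≤ C := by simpa using (norm_nonneg _).trans (hL 1 0)
  have e : ∀ s : ℝ, transl s * ShearFlow.mulOp u * transl (-s) =
      ShearFlow.mulOp fun y => u (y - s) := by
    intro s
    rw [transl_mul_mulOp hu, mul_assoc, transl_mul_neg, mul_one]
  have hcomp : ∀ s : ℝ, BddMeas fun y => u (y - s) := fun s => hu.comp (by fun_prop)
  rw [IsAd]
  simp only [e]
  rw [hasDerivAt_iff_isLittleO]
  refine Asymptotics.IsBigO.trans_isLittleO (g := fun s : ℝ => s ^ 2) ?_ ?_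
  · refine Asymptotics.IsBigO.of_bound C (Eventually.of_forall fun s => ?_)
    have : (ShearFlow.mulOp fun y => u (y - s)) - (ShearFlow.mulOp fun y => u (y - 0)) -
        (s - 0) • Complex.I • (ShearFlow.mulOp fun y => Complex.I * u' y) =
        ShearFlow.mulOp fun y => (u (y - s) - u y) - (-(s : ℂ)) * u' y := by
      rw [mulOp_sub ((hcomp s).sub hu) ((BddMeas.const _).mul hu'), mulOp_sub (hcomp s) hu,
        mulOp_smul _ hu', mulOp_smul _ hu', smul_smul, Complex.I_mul_I]
      simp only [sub_zero]
      congr 1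
      rw [neg_smul, neg_smul, smul_neg, one_smul]
      rfl
    rw [this]
    refine norm_mulOp_le (by positivity) fun y => ?_
    simpa using norm_sub_sub_le_of_lipschitz_deriv hd hL y s
  · simp only [sub_zero]
    exact Asymptotics.isLittleO_pow_id (by norm_num)

end IsAd

/-- `T` has `N` bounded iterated commutators `T_j` with `A`, and
`∑_{j ≤ N} (N choose j) ρ^j ‖T_j‖ ≤ c`; stated recursively, so that submultiplicativity of the
left-hand side is an immediate induction. -/
def Bd (ρ : ℝ) : ℕ → (L2 →L[ℂ] L2) → ℝ → Prop
  | 0, T, c => ‖T‖ ≤ c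
  | N + 1, T, c => ∃ T' c₀ c₁, IsAd T T' ∧ Bd ρ N T c₀ ∧ Bd ρ N T' c₁ ∧ c₀ + ρ * c₁ ≤ c

namespace Bd

variable {ρ c d : ℝ} {N : ℕ} {T S : L2 →L[ℂ] L2}

theorem norm_le (hρ : 0 ≤ ρ) (h : Bd ρ N T c) : ‖T‖ ≤ c := by
  induction N generalizing T c with
  | zero => exact h
  | succ N ih =>
    obtain ⟨T', c₀, c₁, -, h0, h1, hle⟩ := h
    have := (norm_nonneg _).trans (ih h1)
    have := ih h0
    nlinarith

theorem nonneg (hρ : 0 ≤ ρ) (h : Bd ρ N T c) : 0 ≤ c := (norm_nonneg _).trans (h.norm_le hρ)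

theorem mono (h : Bd ρ N T c) (hcd : c ≤ d) : Bd ρ N T d := by
  cases N with
  | zero => exact le_trans h hcd
  | succ N =>
    obtain ⟨T', c₀, c₁, hT, h0, h1, hle⟩ := h
    exact ⟨T', c₀, c₁, hT, h0, h1, hle.trans hcd⟩

theorem add (hT : Bd ρ N T c) (hS : Bd ρ N S d) : Bd ρ N (T + S) (c + d) := by
  induction N generalizing T S c d with
  | zero => exact (norm_add_le _ _).trans (add_le_add hT hS)
  | succ N ih =>
    obtain ⟨T', c₀, c₁, hT, h0, h1, hle⟩ := hT
    obtain ⟨S', d₀, d₁, hS, k0, k1, kle⟩ := hS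
    exact ⟨_, _, _, hT.add hS, ih h0 k0, ih h1 k1, by linarith⟩

theorem smul (a : ℂ) (hT : Bd ρ N T c) : Bd ρ N (a • T) (‖a‖ * c) := by
  induction N generalizing T c with
  | zero =>
    change ‖a • T‖ ≤ _
    rw [norm_smul]
    exact mul_le_mul_of_nonneg_left hT (norm_nonneg _)
  | succ N ih =>
    obtain ⟨T', c₀, c₁, hT, h0, h1, hle⟩ := hT
    refine ⟨_, _, _, hT.smul a, ih h0, ih h1, ?_⟩
    have := mul_le_mul_of_nonneg_left hle (norm_nonneg a)
    linarith

theorem mul (hρ : 0 ≤ ρ) (hT : Bd ρ N T c) (hS : Bd ρ N S d) : Bd ρ N (T * S) (c * d) := by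
  induction N generalizing T S c d with
  | zero =>
    exact (norm_mul_le _ _).trans (mul_le_mul hT hS (norm_nonneg _) ((norm_nonneg _).trans hT))
  | succ N ih =>
    obtain ⟨T', c₀, c₁, hT, h0, h1, hle⟩ := hT
    obtain ⟨S', d₀, d₁, hS, k0, k1, kle⟩ := hS
    refine ⟨_, _, _, hT.mul hS, ih h0 k0, (ih h1 k0).add (ih h0 k1), ?_⟩
    have a0 := h0.nonneg hρ
    have a1 := h1.nonneg hρ
    have b0 := k0.nonneg hρ
    have b1 := k1.nonneg hρ
    calc c₀ * d₀ + ρ * (c₁ * d₀ + c₀ * d₁) ≤ (c₀ + ρ * c₁) * (d₀ + ρ * d₁) := by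
          have : 0 ≤ (ρ * c₁) * (ρ * d₁) := by positivity
          nlinarith
      _ ≤ c * d := mul_le_mul hle kle (by positivity) (le_trans (by positivity) hle)

theorem one : Bd ρ N 1 1 ∧ Bd ρ N 0 0 := by
  induction N with
  | zero =>
    refine ⟨?_, ?_⟩
    · change ‖(1 : L2 →L[ℂ] L2)‖ ≤ 1
      exact ContinuousLinearMap.norm_id_le
    · change ‖(0 : L2 →L[ℂ] L2)‖ ≤ 0
      simp
  | succ N ih =>
    refine ⟨⟨0, 1, 0, IsAd.one, ih.1, ih.2, by simp⟩, ⟨0, 0, 0, ?_, ih.2, ih.2, by simp⟩⟩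
    simpa using IsAd.one.smul 0

theorem pow (hρ : 0 ≤ ρ) (hT : Bd ρ N T c) (n : ℕ) : Bd ρ N (T ^ n) (c ^ n) := by
  induction n with
  | zero => simpa using one.1
  | succ n ih =>
    rw [pow_succ, pow_succ]
    exact ih.mul hρ hT

theorem fnA {σ : ℝ → ℂ} (hσ : BddMeas σ) {C : ℝ} (hC : 0 ≤ C) (h : ∀ x, ‖σ x‖ ≤ C) :
    Bd ρ N (fnA σ) C := by
  induction N with
  | zero => exact norm_fnA_le hC h
  | succ N ih => exact ⟨0, C, 0, IsAd.fnA hσ, ih, one.2, by simp⟩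

/-- The number of commutators can be lowered. -/
theorem pred (hρ : 0 ≤ ρ) (h : Bd ρ (N + 1) T c) : Bd ρ N T c := by
  obtain ⟨T', c₀, c₁, -, h0, h1, hle⟩ := h
  have := h1.nonneg hρ
  exact h0.mono (le_trans (by nlinarith) hle)

theorem mono_radius {r : ℝ} (hr : 0 ≤ r) (hrρ : r ≤ ρ) (h : Bd ρ N T c) : Bd r N T c := by
  induction N generalizing T c with
  | zero => exact h
  | succ N ih =>
    obtain ⟨T', c₀, c₁, hT, h0, h1, hle⟩ := h
    refine ⟨T', c₀, c₁, hT, ih h0, ih h1, le_trans ?_ hle⟩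
    have := h1.nonneg (hr.trans hrρ)
    nlinarith

/-- For a small radius `ρ`, the commutators contribute little beyond the norm of the operator. This is
what keeps the bounds on high powers of a unitary operator under control. -/
theorem shrink (hρ : 0 ≤ ρ) (hρ1 : ρ ≤ 1) (h : Bd 1 N T c) : Bd ρ N T (‖T‖ + ρ * c) := by
  induction N generalizing T c with
  | zero =>
    change ‖T‖ ≤ _
    have := (norm_nonneg _).trans h
    nlinarith
  | succ N ih =>
    obtain ⟨T', c₀, c₁, hT, h0, h1, hle⟩ := h
    refine ⟨T', _, c₁, hT, ih h0, h1.mono_radius hρ hρ1, ?_⟩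
    nlinarith

/-- The return to radius `1`, at the price of a factor `ρ⁻¹` for each commutator. -/
theorem stretch (hρ : 0 < ρ) (hρ1 : ρ ≤ 1) (h : Bd ρ N T c) : Bd 1 N T ((ρ⁻¹) ^ N * c) := by
  induction N generalizing T c with
  | zero =>
    rw [pow_zero, one_mul]
    exact h
  | succ N ih =>
    obtain ⟨T', c₀, c₁, hT, h0, h1, hle⟩ := h
    refine ⟨T', _, _, hT, ih h0, ih h1, ?_⟩
    have a0 := h0.nonneg hρ.le
    have hinv : 1 ≤ ρ⁻¹ := (one_le_inv₀ hρ).2 hρ1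
    calc ρ⁻¹ ^ N * c₀ + 1 * (ρ⁻¹ ^ N * c₁) ≤ ρ⁻¹ ^ N * (ρ⁻¹ * c₀ + c₁) := by
          have : 0 < ρ⁻¹ ^ N := by positivity
          nlinarith [mul_le_mul_of_nonneg_left (mul_le_mul_of_nonneg_right hinv a0) this.le]
      _ = ρ⁻¹ ^ (N + 1) * (c₀ + ρ * c₁) := by
          rw [pow_succ]
          field_simp
      _ ≤ ρ⁻¹ ^ (N + 1) * c := by gcongr

theorem tsum {ι : Type*} {F : ι → L2 →L[ℂ] L2} {u : ι → ℝ} (hρ : 0 < ρ)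
    (h : ∀ i, Bd ρ N (F i) (u i)) (hu : Summable u) : Bd ρ N (∑' i, F i) (∑' i, u i) := by
  induction N generalizing F u with
  | zero => exact tsum_of_norm_bounded hu.hasSum h
  | succ N ih =>
    choose F' u₀ u₁ hF h0 h1 hle using h
    have hn0 : ∀ i, 0 ≤ u₀ i := fun i => (h0 i).nonneg hρ.le
    have hn1 : ∀ i, 0 ≤ u₁ i := fun i => (h1 i).nonneg hρ.le
    have hs0 : Summable u₀ := Summable.of_nonneg_of_le hn0
      (fun i => le_trans (by nlinarith [hn1 i]) (hle i)) hu
    have hs1 : Summable u₁ := by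
      have : Summable fun i => ρ * u₁ i := Summable.of_nonneg_of_le
        (fun i => mul_nonneg hρ.le (hn1 i)) (fun i => le_trans (by linarith [hn0 i]) (hle i)) hu
      exact (summable_mul_left_iff hρ.ne').1 this
    refine ⟨∑' i, F' i, _, _, IsAd.tsum hF ?_ ?_, ih h0 hs0, ih h1 hs1, ?_⟩
    · exact Summable.of_nonneg_of_le (fun _ => norm_nonneg _) (fun i => (h0 i).norm_le hρ.le) hs0
    · exact Summable.of_nonneg_of_le (fun _ => norm_nonneg _) (fun i => (h1 i).norm_le hρ.le) hs1
    · rw [← tsum_mul_left, ← hs0.tsum_add (hs1.mul_left ρ)]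
      exact (hs0.add (hs1.mul_left ρ)).tsum_le_tsum hle hu

end Bd

/-! ### Functions of a bounded self-adjoint operator -/

instance nontrivial_L2 : Nontrivial L2 := by
  refine ⟨⟨indicatorConstLp 2 (measurableSet_Icc (a := (0 : ℝ)) (b := 1)) (by simp) (1 : ℂ), 0,
    fun h => ?_⟩⟩
  have := congrArg norm h
  rw [norm_indicatorConstLp (by norm_num) (by norm_num)] at this
  simp at this

section FunctionOf

variable {T : L2 →L[ℂ] L2} {g h : ℝ → ℂ}

theorem abs_re_le_of_mem_spectrum {z : ℂ} (hz : z ∈ spectrum ℂ T) : |z.re| ≤ ‖T‖ :=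
  (Complex.abs_re_le_norm z).trans (spectrum.norm_le_norm_of_mem hz)

theorem functionOf_congr (hgh : ∀ x : ℝ, |x| ≤ ‖T‖ → g x = h x) :
    functionOf g T = functionOf h T :=
  cfc_congr fun _ hz => hgh _ (abs_re_le_of_mem_spectrum hz)

theorem continuousOn_re_comp (hg : Continuous g) (s : Set ℂ) :
    ContinuousOn (fun z : ℂ => g z.re) s := (hg.comp Complex.continuous_re).continuousOn

theorem functionOf_mul (hg : Continuous g) (hh : Continuous h) (T : L2 →L[ℂ] L2) :
    functionOf (fun x => g x * h x) T = functionOf g T * functionOf h T :=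
  cfc_mul _ _ T (continuousOn_re_comp hg _) (continuousOn_re_comp hh _)

theorem functionOf_add (hg : Continuous g) (hh : Continuous h) (T : L2 →L[ℂ] L2) :
    functionOf (fun x => g x + h x) T = functionOf g T + functionOf h T :=
  cfc_add _ _ _ (continuousOn_re_comp hg _) (continuousOn_re_comp hh _)

theorem functionOf_sum {ι : Type*} (s : Finset ι) {g : ι → ℝ → ℂ} (hg : ∀ i ∈ s, Continuous (g i))
    (T : L2 →L[ℂ] L2) : functionOf (fun x => ∑ i ∈ s, g i x) T = ∑ i ∈ s, functionOf (g i) T := by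
  unfold functionOf
  rw [← cfc_sum _ _ _ fun i hi => continuousOn_re_comp (hg i hi) _]
  congr 1
  funext z
  simp

theorem functionOf_smul (hg : Continuous g) (c : ℂ) (T : L2 →L[ℂ] L2) :
    functionOf (fun x => c * g x) T = c • functionOf g T :=
  cfc_const_mul _ _ _ (continuousOn_re_comp hg _)

theorem functionOf_const (hT : IsSelfAdjoint T) (c : ℂ) :
    functionOf (fun _ => c) T = c • (1 : L2 →L[ℂ] L2) := by
  have := hT.isStarNormal
  exact (cfc_const c T).trans (Algebra.algebraMap_eq_smul_one c)

theorem functionOf_id (hT : IsSelfAdjoint T) : functionOf (fun x => (x : ℂ)) T = T := by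
  have := hT.isStarNormal
  refine Eq.trans (cfc_congr fun z hz => ?_) (cfc_id ℂ T)
  exact (hT.mem_spectrum_eq_re hz).symm

theorem functionOf_star (g : ℝ → ℂ) (T : L2 →L[ℂ] L2) :
    star (functionOf g T) = functionOf (fun x => starRingEnd ℂ (g x)) T :=
  (cfc_star _ _).symm

theorem isSelfAdjoint_functionOf (hg : ∀ x, starRingEnd ℂ (g x) = g x) (T : L2 →L[ℂ] L2) :
    IsSelfAdjoint (functionOf g T) := by
  rw [IsSelfAdjoint, functionOf_star]
  simp only [hg]

theorem norm_functionOf_le {c : ℝ} (hc : 0 ≤ c) (h : ∀ x : ℝ, |x| ≤ ‖T‖ → ‖g x‖ ≤ c) :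
    ‖functionOf g T‖ ≤ c :=
  norm_cfc_le hc fun _ hz => h _ (abs_re_le_of_mem_spectrum hz)

theorem functionOf_pow (hg : Continuous g) (hT : IsSelfAdjoint T) (n : ℕ) :
    functionOf (fun x => g x ^ n) T = functionOf g T ^ n := by
  have := hT.isStarNormal
  exact cfc_pow _ _ _ (continuousOn_re_comp hg _)

theorem functionOf_mul_comm (hg : Continuous g) (hh : Continuous h) (T : L2 →L[ℂ] L2) :
    functionOf g T * functionOf h T = functionOf h T * functionOf g T := by
  rw [← functionOf_mul hg hh, ← functionOf_mul hh hg]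
  simp only [mul_comm]

theorem functionOf_comm_self (hT : IsSelfAdjoint T) (hg : Continuous g) :
    functionOf g T * T = T * functionOf g T := by
  have := functionOf_mul_comm hg Complex.continuous_ofReal T
  rwa [functionOf_id hT] at this

theorem functionOf_tsum {ι : Type*} {G : ι → ℝ → ℂ} (hG : ∀ i, Continuous (G i))
    {u : ι → ℝ} (hu : Summable u) {c : ℝ} (hc : ‖T‖ ≤ c) (hb : ∀ i x, |x| ≤ c → ‖G i x‖ ≤ u i)
    (hsum : ∀ x : ℝ, |x| ≤ c → g x = ∑' i, G i x) :
    functionOf g T = ∑' i, functionOf (G i) T := by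
  have h1 := tendsto_cfc_fun (a := T) (l := (atTop : Filter (Finset ι)))
    (F := fun s z => ∑ i ∈ s, G i z.re) (f := fun z => ∑' i, G i z.re)
    (tendstoUniformlyOn_tsum hu fun i z hz =>
      hb i z.re ((abs_re_le_of_mem_spectrum hz).trans hc))
    (Eventually.of_forall fun s => continuousOn_re_comp
      (g := fun x => ∑ i ∈ s, G i x) (continuous_finsetSum _ fun i _ => hG i) _)
  have h2 : functionOf g T = cfc (fun z : ℂ => ∑' i, G i z.re) T :=
    cfc_congr fun z hz => hsum _ ((abs_re_le_of_mem_spectrum hz).trans hc)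
  have h3 : HasSum (fun i => functionOf (G i) T) (functionOf g T) := by
    rw [h2]
    refine h1.congr fun s => ?_
    exact functionOf_sum s (fun i _ => hG i) T
  exact h3.tsum_eq.symm

end FunctionOf

theorem summable_int_inv_sq : Summable fun n : ℤ => ((1 + |(n : ℝ)|) ^ 2)⁻¹ := by
  have : Summable fun n : ℕ => ((1 + (n : ℝ)) ^ 2)⁻¹ := by
    have h := (summable_nat_add_iff 1).2 (Real.summable_nat_pow_inv.2 one_lt_two)
    refine h.congr fun n => ?_
    push_cast
    rw [add_comm]
  refine Summable.of_nat_of_neg ?_ ?_ <;>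
  · refine this.congr fun n => ?_
    simp

/-! ### Smooth functions of a self-adjoint operator with bounded commutators -/

section SmoothCalculus

variable {T : L2 →L[ℂ] L2} {c : ℝ} {N : ℕ}

/-- The exponential character `x ↦ exp (i a x)`. -/
def character (a : ℝ) (x : ℝ) : ℂ := Complex.exp (Complex.I * a * x)

theorem continuous_character (a : ℝ) : Continuous (character a) := by
  unfold character
  fun_prop

theorem norm_character (a x : ℝ) : ‖character a x‖ = 1 := by
  have : Complex.I * a * x = ((a * x : ℝ) : ℂ) * Complex.I := by
    push_cast
    ring
  rw [character, this, Complex.norm_exp_ofReal_mul_I]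

/-- A bound from the exponential series. It is exponential in `a`, and serves only for a bounded range
of `a`. -/
theorem Bd.character (hT : IsSelfAdjoint T) (h : Bd 1 N T c) (a : ℝ) :
    Bd 1 N (functionOf (character a) T) (Real.exp (|a| * c)) := by
  have hc := h.nonneg zero_le_one
  have hs : Summable fun n : ℕ => (|a| * c) ^ n / n.factorial := Real.summable_pow_div_factorial _
  have e : functionOf (ShearFlow.character a) T =
      ∑' n : ℕ, functionOf (fun x => (Complex.I * a) ^ n / n.factorial * (x : ℂ) ^ n) T := by
    refine functionOf_tsum (fun n => by fun_prop) hs (h.norm_le zero_le_one) ?_ ?_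
    · intro n x hx
      simp only [norm_mul, norm_div, norm_pow, Complex.norm_I, Complex.norm_real,
        Real.norm_eq_abs, Complex.norm_natCast, mul_pow]
      rw [one_pow, one_mul, div_mul_eq_mul_div]
      gcongr
    · intro x _
      rw [ShearFlow.character, Complex.exp_eq_exp_ℂ, NormedSpace.exp_eq_tsum_div]
      refine tsum_congr fun n => ?_
      rw [mul_pow]
      ring
  have e2 : ∀ n : ℕ, functionOf (fun x => (Complex.I * a) ^ n / n.factorial * (x : ℂ) ^ n) T =
      ((Complex.I * a) ^ n / n.factorial) • T ^ n := by
    intro n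
    rw [functionOf_smul (by fun_prop), functionOf_pow Complex.continuous_ofReal hT,
      functionOf_id hT]
  rw [e]
  simp only [e2]
  have e3 : Real.exp (|a| * c) = ∑' n : ℕ, (|a| * c) ^ n / n.factorial := by
    rw [Real.exp_eq_exp_ℝ, NormedSpace.exp_eq_tsum_div]
  rw [e3]
  refine Bd.tsum one_pos (fun n => ?_) hs
  refine ((h.pow zero_le_one n).smul _).mono (le_of_eq ?_)
  simp only [norm_div, norm_pow, norm_mul, Complex.norm_I, Complex.norm_real,
    Real.norm_eq_abs, Complex.norm_natCast, mul_pow, one_pow]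
  ring

/-- Iterated commutators of `exp (i n T)` grow at most polynomially in `n`. -/
theorem Bd.character_nat (hT : IsSelfAdjoint T) (h : Bd 1 N T c) (a : ℝ) (n : ℕ) :
    Bd 1 N (functionOf (ShearFlow.character (n * a)) T)
      ((1 + (n : ℝ)) ^ N * Real.exp (Real.exp (|a| * c))) := by
  have e : functionOf (ShearFlow.character (n * a)) T =
      functionOf (ShearFlow.character a) T ^ n := by
    rw [← functionOf_pow (continuous_character a) hT]
    congr 1
    funext x
    rw [ShearFlow.character, ShearFlow.character, ← Complex.exp_nat_mul]
    congr 1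
    push_cast
    ring
  set E := Real.exp (|a| * c)
  have hE : 0 < E := Real.exp_pos _
  -- rescaling the commutators by `ρ = 1 / (n + 1)` keeps the `n`-th power bounded
  set ρ : ℝ := (1 + (n : ℝ))⁻¹ with hρ
  have hρ0 : 0 < ρ := by positivity
  have hρ1 : ρ ≤ 1 := inv_le_one_of_one_le₀ (by linarith [Nat.cast_nonneg (α := ℝ) n])
  have hV : ‖functionOf (ShearFlow.character a) T‖ ≤ 1 :=
    norm_functionOf_le zero_le_one fun x _ => (norm_character a x).le
  have h1 := ((h.character hT a).shrink hρ0.le hρ1).mono (d := 1 + ρ * E) (by gcongr)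
  have h2 := (h1.pow hρ0.le n).stretch hρ0 hρ1
  rw [e]
  refine h2.mono ?_
  rw [hρ, inv_inv]
  gcongr
  calc (1 + ρ * E) ^ n ≤ (Real.exp (ρ * E)) ^ n := by
        gcongr
        linarith [Real.add_one_le_exp (ρ * E)]
    _ = Real.exp (n * ρ * E) := by
        rw [← Real.exp_nat_mul]
        ring_nf
    _ ≤ Real.exp E := by
        gcongr
        have : (n : ℝ) * ρ ≤ 1 := by
          rw [hρ, ← div_eq_mul_inv, div_le_one (by positivity)]
          linarith
        nlinarith

theorem Bd.character_int (hT : IsSelfAdjoint T) (h : Bd 1 N T c) (a : ℝ) (n : ℤ) :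
    Bd 1 N (functionOf (ShearFlow.character (n * a)) T)
      ((1 + |(n : ℝ)|) ^ N * Real.exp (Real.exp (|a| * c))) := by
  obtain ⟨m, rfl | rfl⟩ := n.eq_nat_or_neg
  · simpa using h.character_nat hT a m
  · simpa using h.character_nat hT (-a) m

/-- The smooth functional calculus preserves boundedness of iterated commutators, with bounds that
depend on the operator only through those of its own commutators. -/
theorem exists_bd_functionOf {G : ℝ → ℂ} (hG : ContDiff ℝ ∞ G) (hGs : HasCompactSupport G)
    (N : ℕ) (c : ℝ) : ∃ C : ℝ, ∀ T : L2 →L[ℂ] L2, IsSelfAdjoint T → Bd 1 N T c →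
      Bd 1 N (functionOf G T) C := by
  obtain ⟨r, hr⟩ := hGs.isCompact.isBounded.subset_closedBall 0
  -- all spectra and the support of `G` lie in one period `[-L/2, L/2]`
  set L : ℝ := 2 * (max r 0 + max c 0 + 1) with hL
  have hr0 : 0 ≤ max r 0 := le_max_right _ _
  have hc0 : 0 ≤ max c 0 := le_max_right _ _
  have hLpos : 0 < L := by positivity
  have hG0 : ∀ x, L / 2 ≤ |x| → G x = 0 := by
    intro x hx
    refine image_eq_zero_of_notMem_tsupport fun hmem => ?_
    have := hr hmem
    rw [mem_closedBall_zero_iff, Real.norm_eq_abs] at this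
    linarith [le_max_left r 0]
  have hφs : HasCompactSupport fun x => G (L * x) :=
    hGs.comp_homeomorph (Homeomorph.mulLeft₀ L hLpos.ne')
  have hφc : ContDiff ℝ ∞ fun x => G (L * x) := hG.comp (contDiff_const.mul contDiff_id)
  set φ : SchwartzMap ℝ ℂ := hφs.toSchwartzMap hφc with hφ
  have hφv : ∀ x, φ x = G (L * x) := fun x => rfl
  set w : ℤ → ℂ := fun n => (𝓕 φ : SchwartzMap ℝ ℂ) n with hw
  obtain ⟨D, hD⟩ : ∃ D : ℝ, ∀ x : ℝ, (1 + |x|) ^ (N + 2) * ‖(𝓕 φ : SchwartzMap ℝ ℂ) x‖ ≤ D := by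
    have hdec := fun x : ℝ => SchwartzMap.one_add_le_sup_seminorm_apply (𝕜 := ℝ) (m := (N + 2, 0))
      (k := N + 2) (n := 0) le_rfl le_rfl (𝓕 φ : SchwartzMap ℝ ℂ) x
    exact ⟨_, fun x => by simpa only [norm_iteratedFDeriv_zero, Real.norm_eq_abs] using hdec x⟩
  have hsum : Summable fun n : ℤ => ‖w n‖ * (1 + |(n : ℝ)|) ^ N := by
    refine Summable.of_nonneg_of_le (fun n => by positivity) (fun n => ?_)
      (summable_int_inv_sq.mul_left D)
    rw [← div_eq_mul_inv, le_div_iff₀ (by positivity)]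
    refine le_trans (le_of_eq ?_) (hD n)
    rw [pow_add]
    ring
  set E := Real.exp (Real.exp (|2 * Real.pi / L| * c))
  refine ⟨∑' n : ℤ, ‖w n‖ * ((1 + |(n : ℝ)|) ^ N * E), fun T hT h => ?_⟩
  have hc := h.nonneg zero_le_one
  have key : functionOf G T =
      ∑' n : ℤ, functionOf (fun x => w n * character (n * (2 * Real.pi / L)) x) T := by
    refine functionOf_tsum (u := fun n => ‖w n‖ * (1 + |(n : ℝ)|) ^ N)
      (fun n => continuous_const.mul (continuous_character _)) hsum
      (h.norm_le zero_le_one) ?_ ?_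
    · intro n x _
      rw [norm_mul, norm_character]
      gcongr
      exact one_le_pow₀ (by linarith [abs_nonneg (n : ℝ)])
    · intro x hx
      have hP := SchwartzMap.tsum_eq_tsum_fourier φ (x / L)
      have hx' : |x / L| ≤ 1 / 2 := by
        rw [abs_div, abs_of_pos hLpos, div_le_iff₀ hLpos]
        linarith [le_max_left c 0]
      rw [tsum_eq_single 0] at hP
      · rw [hφv, Int.cast_zero, add_zero, mul_div_cancel₀ _ hLpos.ne'] at hP
        rw [hP]
        refine tsum_congr fun n => ?_
        rw [fourier_coe_apply, character]
        congr 2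
        push_cast
        have : (L : ℂ) ≠ 0 := by exact_mod_cast hLpos.ne'
        field_simp
      · intro n hn
        rw [hφv]
        refine hG0 _ ?_
        have h1 : (1 : ℝ) ≤ |(n : ℝ)| := by exact_mod_cast Int.one_le_abs hn
        rw [abs_mul, abs_of_pos hLpos]
        have h2 : |(n : ℝ)| - |x / L| ≤ |x / L + n| := by
          have := abs_sub_abs_le_abs_sub (n : ℝ) (-(x / L))
          rw [abs_neg, sub_neg_eq_add, add_comm] at this
          linarith
        nlinarith
  rw [key]
  have hs2 : Summable fun n : ℤ => ‖w n‖ * ((1 + |(n : ℝ)|) ^ N * E) := by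
    simpa [mul_assoc] using hsum.mul_right E
  refine Bd.tsum one_pos (fun n => ?_) hs2
  rw [functionOf_smul (continuous_character _)]
  exact (h.character_int hT (2 * Real.pi / L) n).smul (w n)

end SmoothCalculus

/-! ### Unit spectral blocks of `A` -/

/-- The function `σ` cut off to the interval `[m, m + 1)`. -/
def blockSymbol (m : ℤ) (σ : ℝ → ℂ) : ℝ → ℂ := (Ico (m : ℝ) (m + 1)).indicator σ

/-- The spectral projection of `A` on the interval `[m, m + 1)`. -/
def block (m : ℤ) : L2 →L[ℂ] L2 := fnA (blockSymbol m fun _ => 1)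

section Block

variable {σ τ : ℝ → ℂ} {m n : ℤ}

theorem norm_blockSymbol_le {C : ℝ} (hC : 0 ≤ C)
    (h : ∀ x : ℝ, (m : ℝ) ≤ x → x < m + 1 → ‖σ x‖ ≤ C) (x : ℝ) : ‖blockSymbol m σ x‖ ≤ C := by
  by_cases hx : x ∈ Ico (m : ℝ) (m + 1)
  · rw [blockSymbol, indicator_of_mem hx]
    exact h x hx.1 hx.2
  · rw [blockSymbol, indicator_of_notMem hx, norm_zero]
    exact hC

theorem bddMeas_blockSymbol (hm : Measurable σ) {C : ℝ} (hC : 0 ≤ C)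
    (h : ∀ x : ℝ, (m : ℝ) ≤ x → x < m + 1 → ‖σ x‖ ≤ C) : BddMeas (blockSymbol m σ) :=
  ⟨hm.indicator measurableSet_Ico, C, norm_blockSymbol_le hC h⟩

theorem bddMeas_blockSymbol_of_continuous (hσ : Continuous σ) (m : ℤ) :
    BddMeas (blockSymbol m σ) := by
  obtain ⟨C, hC⟩ := (isCompact_Icc (a := (m : ℝ)) (b := m + 1)).exists_bound_of_continuousOn
    hσ.continuousOn
  refine bddMeas_blockSymbol hσ.measurable (C := max C 0) (le_max_right _ _) fun x h1 h2 => ?_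
  exact (hC x ⟨h1, h2.le⟩).trans (le_max_left _ _)

theorem blockSymbol_mul (m : ℤ) (σ τ : ℝ → ℂ) (x : ℝ) :
    blockSymbol m σ x * blockSymbol m τ x = blockSymbol m (fun x => σ x * τ x) x := by
  simp only [blockSymbol, indicator_apply]
  split_ifs <;> simp

theorem blockSymbol_one_mul (m : ℤ) (σ : ℝ → ℂ) (x : ℝ) :
    blockSymbol m (fun _ => 1) x * σ x = blockSymbol m σ x := by
  simp only [blockSymbol, indicator_apply]
  split_ifs <;> simp

theorem bddMeas_blockSymbol_one (m : ℤ) : BddMeas (blockSymbol m fun _ => 1) :=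
  bddMeas_blockSymbol_of_continuous continuous_const m

theorem BddMeas.blockSymbol (hσ : BddMeas σ) (m : ℤ) : BddMeas (blockSymbol m σ) := by
  have h : ShearFlow.blockSymbol m σ = fun x => ShearFlow.blockSymbol m (fun _ => 1) x * σ x :=
    funext fun x => (blockSymbol_one_mul m σ x).symm
  rw [h]
  exact (bddMeas_blockSymbol_one m).mul hσ

theorem block_mul_fnA (hσ : BddMeas σ) (m : ℤ) : block m * fnA σ = fnA (blockSymbol m σ) := by
  rw [block, ← fnA_mul (bddMeas_blockSymbol_one m) hσ]
  simp only [blockSymbol_one_mul]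

theorem fnA_mul_block (hσ : BddMeas σ) (m : ℤ) : fnA σ * block m = fnA (blockSymbol m σ) := by
  rw [← block_mul_fnA hσ, block, fnA_comm hσ (bddMeas_blockSymbol_one m)]

theorem fnA_blockSymbol_mul_block (hσ : BddMeas (blockSymbol m σ)) :
    fnA (blockSymbol m σ) * block m = fnA (blockSymbol m σ) := by
  rw [block, ← fnA_mul hσ (bddMeas_blockSymbol_one m)]
  simp only [blockSymbol_mul, mul_one]

theorem block_mul_fnA_blockSymbol (hσ : BddMeas (blockSymbol m σ)) :
    block m * fnA (blockSymbol m σ) = fnA (blockSymbol m σ) := by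
  rw [block, ← fnA_mul (bddMeas_blockSymbol_one m) hσ]
  simp only [blockSymbol_mul, one_mul]

theorem block_mul_self (m : ℤ) : block m * block m = block m :=
  fnA_blockSymbol_mul_block (bddMeas_blockSymbol_one m)

theorem block_mul_of_ne (h : m ≠ n) : block m * block n = 0 := by
  rw [block, block, ← fnA_mul (bddMeas_blockSymbol_one m) (bddMeas_blockSymbol_one n)]
  have : ∀ x : ℝ, blockSymbol m (fun _ => (1 : ℂ)) x * blockSymbol n (fun _ => 1) x = 0 := by
    intro x
    simp only [blockSymbol, indicator_apply]
    split_ifs with h1 h2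
    · refine absurd ?_ h
      rw [← Int.floor_eq_iff.2 h1, ← Int.floor_eq_iff.2 h2]
    all_goals simp
  simp only [this]
  rw [fnA_const, zero_smul]

theorem star_block (m : ℤ) : star (block m) = block m := by
  rw [block, fnA_star (bddMeas_blockSymbol_one m)]
  congr 1
  funext x
  simp only [blockSymbol, indicator_apply]
  split_ifs <;> simp

theorem inner_block_left (m : ℤ) (f g : L2) : ⟪block m f, g⟫_ℂ = ⟪f, block m g⟫_ℂ := by
  have := star_block m
  rw [ContinuousLinearMap.star_eq_adjoint] at this
  rw [← ContinuousLinearMap.adjoint_inner_right, this]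

theorem norm_block_le (m : ℤ) : ‖block m‖ ≤ 1 :=
  norm_fnA_le zero_le_one (norm_blockSymbol_le zero_le_one fun _ _ _ => by simp)

theorem inner_block_block_of_ne (h : m ≠ n) (f g : L2) : ⟪block m f, block n g⟫_ℂ = 0 := by
  rw [inner_block_left, ← mul_apply_eq_comp, block_mul_of_ne h]
  simp

theorem norm_sq_eq_integral (f : L2) : ‖f‖ ^ 2 = ∫ y, ‖f y‖ ^ 2 := by
  have h : (‖f‖ ^ 2 : ℂ) = ∫ y, ⟪f y, f y⟫_ℂ := by
    rw [← L2.inner_def, inner_self_eq_norm_sq_to_K]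
    rfl
  have h2 : ∀ y, ⟪f y, f y⟫_ℂ = ((‖f y‖ ^ 2 : ℝ) : ℂ) := fun y => by
    rw [inner_self_eq_norm_sq_to_K]
    simp
  simp only [h2] at h
  rw [integral_complex_ofReal] at h
  exact_mod_cast h

theorem integrable_norm_sq (f : L2) : Integrable fun y => ‖f y‖ ^ 2 :=
  (Lp.memLp f).integrable_norm_pow (by norm_num)

theorem hasSum_norm_block_sq (f : L2) : HasSum (fun m : ℤ => ‖block m f‖ ^ 2) (‖f‖ ^ 2) := by
  set g : L2 := fourierL2 f with hg
  have hnorm : ‖f‖ = ‖g‖ := (LinearIsometryEquiv.norm_map _ _).symm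
  -- in the Fourier variable the blocks are the sets where `-2πξ ∈ [m, m + 1)`
  let s : ℤ → Set ℝ := fun m => (fun ξ : ℝ => -(2 * Real.pi * ξ)) ⁻¹' Ico (m : ℝ) (m + 1)
  have hs : ∀ m, MeasurableSet (s m) := fun m =>
    (by fun_prop : Measurable fun ξ : ℝ => -(2 * Real.pi * ξ)) measurableSet_Ico
  have hU : (⋃ m, s m) = univ := by
    refine eq_univ_of_forall fun ξ => mem_iUnion.2 ⟨⌊-(2 * Real.pi * ξ)⌋, ?_⟩
    exact ⟨Int.floor_le _, Int.lt_floor_add_one _⟩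
  have hd : Pairwise (Function.onFun Disjoint s) := by
    intro m n hmn
    refine Disjoint.preimage _ (disjoint_left.2 fun x h1 h2 => hmn ?_)
    rw [← Int.floor_eq_iff.2 h1, ← Int.floor_eq_iff.2 h2]
  have h := hasSum_integral_iUnion (f := fun y => ‖g y‖ ^ 2) hs hd (integrable_norm_sq g).integrableOn
  rw [hU, Measure.restrict_univ, ← norm_sq_eq_integral, ← hnorm] at h
  refine h.congr_fun fun m => ?_
  rw [block, norm_fnA_apply, norm_sq_eq_integral, ← integral_indicator (hs m)]
  refine integral_congr_ae ?_
  filter_upwards [coeFn_mulOp (bddMeas_blockSymbol_one m).compA.memLp g] with ξ hξ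
  rw [hξ]
  by_cases hx : -(2 * Real.pi * ξ) ∈ Ico (m : ℝ) (m + 1)
  · have hx' : ξ ∈ s m := hx
    rw [indicator_of_mem hx', blockSymbol, indicator_of_mem hx, one_mul]
  · have hx' : ξ ∉ s m := hx
    rw [indicator_of_notMem hx', blockSymbol, indicator_of_notMem hx]
    simp

theorem sum_norm_block_sq_le (s : Finset ℤ) (f : L2) : ∑ m ∈ s, ‖block m f‖ ^ 2 ≤ ‖f‖ ^ 2 :=
  sum_le_hasSum s (fun _ _ => by positivity) (hasSum_norm_block_sq f)

theorem hasSum_block (f : L2) : HasSum (fun m : ℤ => block m f) f := by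
  rw [HasSum, tendsto_iff_norm_sub_tendsto_zero]
  have key : ∀ s : Finset ℤ,
      ‖∑ m ∈ s, block m f - f‖ ^ 2 = ‖f‖ ^ 2 - ∑ m ∈ s, ‖block m f‖ ^ 2 := by
    intro s
    have hself : ∀ m, ⟪block m f, f⟫_ℂ = ((‖block m f‖ ^ 2 : ℝ) : ℂ) := fun m => by
      conv_lhs => rw [← block_mul_self m, mul_apply_eq_comp, inner_block_left,
        inner_self_eq_norm_sq_to_K]
      simp
    have h1 : RCLike.re ⟪∑ m ∈ s, block m f, f⟫_ℂ = ∑ m ∈ s, ‖block m f‖ ^ 2 := by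
      rw [sum_inner]
      simp only [hself]
      rw [← Complex.ofReal_sum]
      rfl
    have h2 : ‖∑ m ∈ s, block m f‖ ^ 2 = ∑ m ∈ s, ‖block m f‖ ^ 2 := by
      rw [← inner_self_eq_norm_sq (𝕜 := ℂ), sum_inner]
      have : ∀ m ∈ s, ⟪block m f, ∑ n ∈ s, block n f⟫_ℂ = ((‖block m f‖ ^ 2 : ℝ) : ℂ) := by
        intro m hm
        rw [inner_sum, Finset.sum_eq_single_of_mem m hm
          fun n _ hn => inner_block_block_of_ne hn.symm f f, inner_self_eq_norm_sq_to_K]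
        simp
      rw [Finset.sum_congr rfl this, ← Complex.ofReal_sum]
      rfl
    rw [norm_sub_sq (𝕜 := ℂ), h1, h2]
    ring
  have h0 : Tendsto (fun s : Finset ℤ => ‖∑ m ∈ s, block m f - f‖ ^ 2) atTop (𝓝 0) := by
    simp only [key]
    have := Tendsto.const_sub (‖f‖ ^ 2) (hasSum_norm_block_sq f)
    rwa [sub_self] at this
  have := h0.sqrt
  simpa using this

/-- The constant `∑_j (1 + |j|)⁻²` of the Schur test below. -/
def schurConst : ℝ := ∑' j : ℤ, ((1 + |(j : ℝ)|) ^ 2)⁻¹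

theorem schurConst_pos : 0 < schurConst :=
  summable_int_inv_sq.tsum_pos (fun _ => by positivity) 0 (by positivity)

/-- **Schur's test** for block matrices. -/
theorem norm_inner_le_of_block_le {Z : L2 →L[ℂ] L2} {a b : ℤ → ℝ} {M : ℝ} (hM : 0 ≤ M)
    (hZ : ∀ m n, ‖block m * Z * block n‖ ≤ M * (a m * b n) * ((1 + |((m - n : ℤ) : ℝ)|) ^ 2)⁻¹)
    {φ ψ : L2} {α β : ℝ} (hα : ∀ s : Finset ℤ, ∑ m ∈ s, (a m * ‖block m φ‖) ^ 2 ≤ α)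
    (hβ : ∀ s : Finset ℤ, ∑ m ∈ s, (b m * ‖block m ψ‖) ^ 2 ≤ β) :
    ‖⟪φ, Z ψ⟫_ℂ‖ ≤ M * (schurConst * (α + β) / 2) := by
  rw [schurConst]
  set κ : ℤ → ℝ := fun j => ((1 + |(j : ℝ)|) ^ 2)⁻¹ with hκ
  have hκ0 : ∀ j, 0 ≤ κ j := fun j => by positivity
  set K := ∑' j, κ j
  have hK : ∀ (s : Finset ℤ) (m : ℤ), ∑ n ∈ s, κ (m - n) ≤ K := by
    intro s m
    have hsm : Summable fun n : ℤ => κ (m - n) := (Equiv.subLeft m).summable_iff.2 summable_int_inv_sq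
    refine (hsm.sum_le_tsum s fun _ _ => hκ0 _).trans (le_of_eq ?_)
    exact (Equiv.subLeft m).tsum_eq κ
  have hsymm : ∀ m n : ℤ, κ (m - n) = κ (n - m) := fun m n => by
    simp only [hκ]
    rw [← neg_sub, Int.cast_neg, abs_neg]
  have h1 : ∀ s : Finset ℤ,
      ‖⟪∑ m ∈ s, block m φ, Z (∑ n ∈ s, block n ψ)⟫_ℂ‖ ≤ M * (K * (α + β) / 2) := by
    intro s
    rw [map_sum, sum_inner]
    simp only [inner_sum]
    calc ‖∑ m ∈ s, ∑ n ∈ s, ⟪block m φ, Z (block n ψ)⟫_ℂ‖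
        ≤ ∑ m ∈ s, ∑ n ∈ s, ‖⟪block m φ, Z (block n ψ)⟫_ℂ‖ :=
          (norm_sum_le _ _).trans (Finset.sum_le_sum fun m _ => norm_sum_le _ _)
      _ ≤ ∑ m ∈ s, ∑ n ∈ s, M * κ (m - n) *
            (((a m * ‖block m φ‖) ^ 2 + (b n * ‖block n ψ‖) ^ 2) / 2) := by
          refine Finset.sum_le_sum fun m _ => Finset.sum_le_sum fun n _ => ?_
          have e : ⟪block m φ, Z (block n ψ)⟫_ℂ =
              ⟪block m φ, (block m * Z * block n) (block n ψ)⟫_ℂ := by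
            have e2 : (block m * Z * block n) (block n ψ) = block m (Z (block n ψ)) := by
              change block m (Z (block n (block n ψ))) = _
              rw [← mul_apply_eq_comp (block n), block_mul_self]
            rw [e2, ← inner_block_left, ← mul_apply_eq_comp (block m), block_mul_self]
          rw [e]
          calc _ ≤ ‖block m φ‖ * (‖block m * Z * block n‖ * ‖block n ψ‖) :=
                (norm_inner_le_norm _ _).trans
                  (mul_le_mul_of_nonneg_left (ContinuousLinearMap.le_opNorm _ _) (norm_nonneg _))
            _ ≤ ‖block m φ‖ * (M * (a m * b n) * κ (m - n) * ‖block n ψ‖) := by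
                gcongr
                exact hZ m n
            _ = M * κ (m - n) * ((a m * ‖block m φ‖) * (b n * ‖block n ψ‖)) := by ring
            _ ≤ _ := by
                refine mul_le_mul_of_nonneg_left ?_ (mul_nonneg hM (hκ0 _))
                nlinarith [sq_nonneg (a m * ‖block m φ‖ - b n * ‖block n ψ‖)]
      _ = M * ((∑ m ∈ s, (∑ n ∈ s, κ (m - n)) * (a m * ‖block m φ‖) ^ 2 +
            ∑ n ∈ s, (∑ m ∈ s, κ (n - m)) * (b n * ‖block n ψ‖) ^ 2) / 2) := by
          have e1 : ∑ n ∈ s, (∑ m ∈ s, κ (n - m)) * (b n * ‖block n ψ‖) ^ 2 =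
              ∑ m ∈ s, ∑ n ∈ s, κ (m - n) * (b n * ‖block n ψ‖) ^ 2 := by
            rw [Finset.sum_comm]
            refine Finset.sum_congr rfl fun n _ => ?_
            rw [Finset.sum_mul]
            exact Finset.sum_congr rfl fun m _ => by rw [hsymm]
          rw [e1, ← Finset.sum_add_distrib, Finset.sum_div, Finset.mul_sum]
          refine Finset.sum_congr rfl fun m _ => ?_
          rw [Finset.sum_mul, ← Finset.sum_add_distrib, Finset.sum_div, Finset.mul_sum]
          exact Finset.sum_congr rfl fun n _ => by ring
      _ ≤ M * ((∑ m ∈ s, K * (a m * ‖block m φ‖) ^ 2 +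
            ∑ n ∈ s, K * (b n * ‖block n ψ‖) ^ 2) / 2) := by
          gcongr
          · exact hK s _
          · exact hK s _
      _ ≤ M * (K * (α + β) / 2) := by
          rw [← Finset.mul_sum, ← Finset.mul_sum, ← mul_add]
          have hK0 : 0 ≤ K := tsum_nonneg hκ0
          gcongr
          · exact hα s
          · exact hβ s
  have hφ := hasSum_block φ
  have hψ := hasSum_block ψ
  exact le_of_tendsto ((Tendsto.inner hφ ((Z.continuous.tendsto _).comp hψ)).norm)
    (Eventually.of_forall h1)

/-- Weights on the blocks that are dominated by `q` can be replaced by `q(A)`. -/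
theorem sum_weighted_block_le {q : ℝ → ℂ} (hq : BddMeas q) {b : ℤ → ℝ} {K : ℝ} (hb : ∀ n, 0 ≤ b n)
    (h : ∀ (n : ℤ) (x : ℝ), (n : ℝ) ≤ x → x < n + 1 → b n ≤ K * ‖q x‖) (ψ : L2) (s : Finset ℤ) :
    ∑ n ∈ s, (b n * ‖block n ψ‖) ^ 2 ≤ K ^ 2 * ‖fnA q ψ‖ ^ 2 := by
  have h1 : ∀ n, b n * ‖block n ψ‖ ≤ K * ‖block n (fnA q ψ)‖ := by
    intro n
    have e : b n * ‖block n ψ‖ = ‖((b n : ℂ) • block n) ψ‖ := by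
      rw [smul_apply, norm_smul, Complex.norm_real, Real.norm_of_nonneg (hb n)]
    rw [e, ← mul_apply_eq_comp, block_mul_fnA hq, block, ← fnA_smul _ (bddMeas_blockSymbol_one n)]
    refine norm_fnA_apply_le_of_le ((BddMeas.const _).mul (bddMeas_blockSymbol_one n))
      (hq.blockSymbol n) ?_ ψ
    intro x
    by_cases hx : x ∈ Ico (n : ℝ) (n + 1)
    · simp only [blockSymbol, indicator_of_mem hx, mul_one, Complex.norm_real,
        Real.norm_of_nonneg (hb n)]
      exact h n x hx.1 hx.2
    · simp [blockSymbol, indicator_of_notMem hx]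
  calc ∑ n ∈ s, (b n * ‖block n ψ‖) ^ 2 ≤ ∑ n ∈ s, (K * ‖block n (fnA q ψ)‖) ^ 2 := by
        refine Finset.sum_le_sum fun n _ => ?_
        have := mul_nonneg (hb n) (norm_nonneg (block n ψ))
        exact pow_le_pow_left₀ this (h1 n) 2
    _ = K ^ 2 * ∑ n ∈ s, ‖block n (fnA q ψ)‖ ^ 2 := by
        rw [Finset.mul_sum]
        exact Finset.sum_congr rfl fun n _ => by ring
    _ ≤ K ^ 2 * ‖fnA q ψ‖ ^ 2 := by
        gcongr
        exact sum_norm_block_sq_le s _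

end Block

/-! ### Off-diagonal decay -/

/-- The operator `A` cut off to a spectral block. -/
def blockA (m : ℤ) : L2 →L[ℂ] L2 := fnA (blockSymbol m fun x => (x : ℂ))

theorem bddMeas_blockSymbol_id (m : ℤ) : BddMeas (blockSymbol m fun x => (x : ℂ)) :=
  bddMeas_blockSymbol_of_continuous Complex.continuous_ofReal m

theorem hasDerivAt_transl_mul_block (m : ℤ) :
    HasDerivAt (fun s : ℝ => transl s * block m) (Complex.I • blockA m) 0 := by
  rw [hasDerivAt_iff_isLittleO]
  set R : ℝ := |(m : ℝ)| + 1 with hR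
  have hR0 : 0 < R := by positivity
  refine Asymptotics.IsBigO.trans_isLittleO (g := fun s : ℝ => s ^ 2) ?_ ?_
  · refine Asymptotics.IsBigO.of_bound (R ^ 2) ?_
    have hev : ∀ᶠ s : ℝ in 𝓝 0, |s| * R < 1 := by
      have : Tendsto (fun s : ℝ => |s| * R) (𝓝 0) (𝓝 (|0| * R)) :=
        (continuous_abs.mul continuous_const).tendsto 0
      rw [abs_zero, zero_mul] at this
      exact this.eventually_lt_const one_pos
    filter_upwards [hev] with s hs
    have e : transl s * block m - transl 0 * block m - (s - 0) • Complex.I • blockA m =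
        fnA fun x => (translationSymbol s x * blockSymbol m (fun _ => 1) x -
          blockSymbol m (fun _ => 1) x) - (s * Complex.I) * blockSymbol m (fun x => (x : ℂ)) x := by
      have h1 := bddMeas_blockSymbol_one m
      have h2 := (bddMeas_translationSymbol s).mul h1
      rw [fnA_sub (h2.sub h1) ((BddMeas.const _).mul (bddMeas_blockSymbol_id m)), fnA_sub h2 h1,
        fnA_mul (bddMeas_translationSymbol s) h1, fnA_smul _ (bddMeas_blockSymbol_id m),
        transl_zero, one_mul, sub_zero, mul_smul]
      rfl
    rw [e]
    refine norm_fnA_le (by positivity) fun x => ?_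
    by_cases hx : x ∈ Ico (m : ℝ) (m + 1)
    · simp only [blockSymbol, indicator_of_mem hx, mul_one]
      have hxR : |x| ≤ R := by
        rw [abs_le]
        constructor
        · linarith [neg_abs_le (m : ℝ), hx.1]
        · linarith [le_abs_self (m : ℝ), hx.2]
      have hn : ‖Complex.I * (s * x : ℝ)‖ = |s| * |x| := by
        rw [norm_mul, Complex.norm_I, one_mul, Complex.norm_real, Real.norm_eq_abs, abs_mul]
      have := Complex.norm_exp_sub_one_sub_id_le (x := Complex.I * (s * x : ℝ))
        (by rw [hn]; nlinarith [abs_nonneg s])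
      rw [translationSymbol]
      refine le_trans (le_of_eq ?_) (this.trans ?_)
      · congr 1
        push_cast
        ring
      · rw [hn, mul_pow, norm_pow, Real.norm_eq_abs, mul_comm]
        gcongr
    · simp only [blockSymbol, indicator_of_notMem hx]
      simp only [mul_zero, sub_zero, norm_zero]
      positivity
  · simp only [sub_zero]
    exact Asymptotics.isLittleO_pow_id (by norm_num)

theorem transl_mul_block_comm (s : ℝ) (m : ℤ) : transl s * block m = block m * transl s :=
  fnA_comm (bddMeas_translationSymbol s) (bddMeas_blockSymbol_one m)

/-- Commutators with `A`, seen in spectral blocks. -/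
theorem IsAd.block {T T' : L2 →L[ℂ] L2} (h : IsAd T T') (m n : ℤ) :
    block m * T' * block n = blockA m * T * block n - block m * T * blockA n := by
  have h1 : HasDerivAt (fun s : ℝ => ShearFlow.block m * (transl s * T * transl (-s)) *
      ShearFlow.block n) (ShearFlow.block m * (Complex.I • T') * ShearFlow.block n) 0 :=
    (HasDerivAt.const_mul _ h).mul_const _
  have h2 : HasDerivAt (fun s : ℝ => transl (-s) * ShearFlow.block n)
      (-(Complex.I • blockA n)) 0 := by
    have h0 : HasDerivAt (fun s : ℝ => transl s * ShearFlow.block n) (Complex.I • blockA n)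
        (-(0 : ℝ)) := by
      rw [neg_zero]
      exact hasDerivAt_transl_mul_block n
    refine HasDerivAt.congr_deriv (h0.scomp (0 : ℝ) (hasDerivAt_neg (0 : ℝ))) ?_
    rw [neg_smul, one_smul]
  have h3 := ((hasDerivAt_transl_mul_block m).mul_const T).mul h2
  have e : (fun s : ℝ => ShearFlow.block m * (transl s * T * transl (-s)) * ShearFlow.block n) =
      fun s : ℝ => transl s * ShearFlow.block m * T * (transl (-s) * ShearFlow.block n) := by
    funext s
    rw [transl_mul_block_comm]
    simp only [mul_assoc]
  rw [e] at h1
  have h4 := h1.unique h3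
  simp only [neg_zero, transl_zero, one_mul, mul_neg, smul_mul_assoc, mul_smul_comm] at h4
  rw [← sub_eq_add_neg, ← smul_sub] at h4
  exact smul_right_injective _ Complex.I_ne_zero h4

theorem norm_blockA_sub_le (m : ℤ) : ‖blockA m - (m : ℂ) • block m‖ ≤ 1 := by
  rw [blockA, block, ← fnA_smul _ (bddMeas_blockSymbol_one m),
    ← fnA_sub (bddMeas_blockSymbol_id m) ((BddMeas.const _).mul (bddMeas_blockSymbol_one m))]
  refine norm_fnA_le zero_le_one fun x => ?_
  by_cases hx : x ∈ Ico (m : ℝ) (m + 1)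
  · simp only [blockSymbol, indicator_of_mem hx, mul_one]
    rw [← Complex.ofReal_intCast, ← Complex.ofReal_sub, Complex.norm_real, Real.norm_eq_abs, abs_le]
    constructor <;> linarith [hx.1, hx.2]
  · simp [blockSymbol, indicator_of_notMem hx]

theorem blockA_mul_block (m : ℤ) : blockA m * block m = blockA m :=
  fnA_blockSymbol_mul_block (bddMeas_blockSymbol_id m)

theorem block_mul_blockA (m : ℤ) : block m * blockA m = blockA m :=
  block_mul_fnA_blockSymbol (bddMeas_blockSymbol_id m)

/-- Bounded iterated commutators with `A` give off-diagonal decay in the spectral representation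
of `A`. -/
theorem Bd.block_decay {N : ℕ} {T : L2 →L[ℂ] L2} {c : ℝ} (h : Bd 1 N T c) (m n : ℤ) :
    (1 + |((m - n : ℤ) : ℝ)|) ^ N * ‖block m * T * block n‖ ≤ 3 ^ N * c := by
  induction N generalizing T c with
  | zero =>
    have hT := h.norm_le zero_le_one
    simp only [pow_zero, one_mul]
    calc ‖ShearFlow.block m * T * ShearFlow.block n‖
        ≤ ‖ShearFlow.block m‖ * ‖T‖ * ‖ShearFlow.block n‖ :=
          (norm_mul_le _ _).trans (mul_le_mul_of_nonneg_right (norm_mul_le _ _) (norm_nonneg _))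
      _ ≤ 1 * ‖T‖ * 1 := by
          gcongr <;> exact norm_block_le _
      _ ≤ c := by linarith
  | succ N ih =>
    obtain ⟨T', c₀, c₁, hT, h0, h1, hle⟩ := h
    set t := ‖ShearFlow.block m * T * ShearFlow.block n‖
    set t' := ‖ShearFlow.block m * T' * ShearFlow.block n‖
    set d := |((m - n : ℤ) : ℝ)| with hd
    have key : d * t ≤ t' + 2 * t := by
      have e : ((m - n : ℤ) : ℂ) • (ShearFlow.block m * T * ShearFlow.block n) =
          ShearFlow.block m * T' * ShearFlow.block n -
          (blockA m - (m : ℂ) • ShearFlow.block m) * (ShearFlow.block m * T * ShearFlow.block n) +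
          (ShearFlow.block m * T * ShearFlow.block n) * (blockA n - (n : ℂ) • ShearFlow.block n) := by
        have e1 : (blockA m - (m : ℂ) • ShearFlow.block m) *
            (ShearFlow.block m * T * ShearFlow.block n) =
            blockA m * T * ShearFlow.block n -
              (m : ℂ) • (ShearFlow.block m * T * ShearFlow.block n) := by
          rw [sub_mul, smul_mul_assoc, ← mul_assoc, ← mul_assoc, ← mul_assoc, ← mul_assoc,
            blockA_mul_block, block_mul_self]
        have e2 : (ShearFlow.block m * T * ShearFlow.block n) *
            (blockA n - (n : ℂ) • ShearFlow.block n) =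
            ShearFlow.block m * T * blockA n -
              (n : ℂ) • (ShearFlow.block m * T * ShearFlow.block n) := by
          rw [mul_sub, mul_smul_comm, mul_assoc _ _ (blockA n), mul_assoc _ _ (ShearFlow.block n),
            block_mul_blockA, block_mul_self]
        rw [e1, e2, hT.block m n]
        push_cast
        rw [sub_smul]
        abel
      have hn : d * t =
          ‖((m - n : ℤ) : ℂ) • (ShearFlow.block m * T * ShearFlow.block n)‖ := by
        rw [norm_smul, ← Complex.ofReal_intCast, Complex.norm_real, Real.norm_eq_abs]
      rw [hn, e]
      have a1 := norm_mul_le_of_le (norm_blockA_sub_le m) (le_refl t)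
      have a2 := norm_mul_le_of_le (le_refl t) (norm_blockA_sub_le n)
      refine (norm_add_le _ _).trans ?_
      have := norm_sub_le (ShearFlow.block m * T' * ShearFlow.block n)
        ((blockA m - (m : ℂ) • ShearFlow.block m) * (ShearFlow.block m * T * ShearFlow.block n))
      linarith
    have hd0 : 0 ≤ d := abs_nonneg _
    have k0 := ih h0
    have k1 := ih h1
    have hc1 := h1.nonneg zero_le_one
    calc (1 + d) ^ (N + 1) * t = (1 + d) ^ N * (t + d * t) := by ring
      _ ≤ (1 + d) ^ N * (t' + 3 * t) := by
          exact mul_le_mul_of_nonneg_left (by linarith) (by positivity)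
      _ = (1 + d) ^ N * t' + 3 * ((1 + d) ^ N * t) := by ring
      _ ≤ 3 ^ N * c₁ + 3 * (3 ^ N * c₀) := by linarith
      _ ≤ 3 ^ (N + 1) * (c₀ + 1 * c₁) := by
          have : (0 : ℝ) ≤ 3 ^ N * c₁ := by positivity
          rw [pow_succ]
          linarith
      _ ≤ 3 ^ (N + 1) * c := by gcongr

/-! ### Slowly varying weights -/

/-- A positive function whose relative variation over a distance `d` is at most
`δ (1 + d)^p`. -/
structure Slow (δ : ℝ) (p : ℕ) (q : ℝ → ℝ) : Prop where
  pos : ∀ x, 0 < q x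
  le : ∀ x y, |q x - q y| ≤ δ * q y * (1 + |x - y|) ^ p

namespace Slow

variable {δ δ' : ℝ} {p p' : ℕ} {q r : ℝ → ℝ}

theorem mono (h : Slow δ p q) (hδ : δ ≤ δ') (hp : p ≤ p') (hδ0 : 0 ≤ δ) : Slow δ' p' q := by
  refine ⟨h.pos, fun x y => (h.le x y).trans ?_⟩
  have := (h.pos y).le
  have hd : 1 ≤ 1 + |x - y| := by linarith [abs_nonneg (x - y)]
  have : 0 ≤ δ' * q y := mul_nonneg (hδ0.trans hδ) this
  gcongr

theorem le_mul (h : Slow δ p q) (hδ : δ ≤ 1) (x y : ℝ) : q x ≤ 2 * q y * (1 + |x - y|) ^ p := by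
  have h1 := (abs_le.1 (h.le x y)).2
  have h2 : (1 : ℝ) ≤ (1 + |x - y|) ^ p := one_le_pow₀ (by linarith [abs_nonneg (x - y)])
  have h3 := h.pos y
  have h4 : δ * q y * (1 + |x - y|) ^ p ≤ 1 * q y * (1 + |x - y|) ^ p := by gcongr
  have h5 : q y * 1 ≤ q y * (1 + |x - y|) ^ p := by gcongr
  linarith

theorem one : Slow 0 0 fun _ => 1 := ⟨fun _ => one_pos, fun x y => by simp⟩

theorem const_mul (h : Slow δ p q) {a : ℝ} (ha : 0 < a) : Slow δ p fun x => a * q x := by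
  refine ⟨fun x => mul_pos ha (h.pos x), fun x y => ?_⟩
  rw [← mul_sub, abs_mul, abs_of_pos ha]
  calc a * |q x - q y| ≤ a * (δ * q y * (1 + |x - y|) ^ p) :=
        mul_le_mul_of_nonneg_left (h.le x y) ha.le
    _ = _ := by ring

theorem mul (hq : Slow δ p q) (hr : Slow δ' p' r) (hδ : 0 ≤ δ) (hδ' : 0 ≤ δ') (hδ1 : δ' ≤ 1) :
    Slow (2 * δ + δ') (p + p') fun x => q x * r x := by
  refine ⟨fun x => mul_pos (hq.pos x) (hr.pos x), fun x y => ?_⟩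
  have e : q x * r x - q y * r y = (q x - q y) * r x + q y * (r x - r y) := by ring
  set D := 1 + |x - y| with hD
  have hD1 : 1 ≤ D := by linarith [abs_nonneg (x - y)]
  have q0 := hq.pos y
  have r0 := hr.pos y
  have rx := hr.pos x
  calc |q x * r x - q y * r y| ≤ |q x - q y| * r x + q y * |r x - r y| := by
        rw [e]
        refine (abs_add_le _ _).trans (le_of_eq ?_)
        rw [abs_mul, abs_mul, abs_of_pos rx, abs_of_pos q0]
    _ ≤ (δ * q y * D ^ p) * (2 * r y * D ^ p') + q y * (δ' * r y * D ^ p') := by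
        gcongr
        · exact hq.le x y
        · exact hr.le_mul hδ1 x y
        · exact hr.le x y
    _ = (2 * δ) * (q y * r y) * D ^ (p + p') + δ' * (q y * r y) * D ^ p' := by
        rw [pow_add]
        ring
    _ ≤ (2 * δ) * (q y * r y) * D ^ (p + p') + δ' * (q y * r y) * D ^ (p + p') := by
        gcongr
        omega
    _ = _ := by ring

theorem pow (hq : Slow δ p q) (hδ : 0 ≤ δ) (hδ1 : δ ≤ 1) (n : ℕ) :
    Slow (3 ^ n * δ) (n * p) fun x => q x ^ n := by
  induction n with
  | zero => simpa using one.mono hδ le_rfl le_rfl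
  | succ n ih =>
    have h := ih.mul hq (by positivity) hδ hδ1
    simp only [pow_succ]
    refine h.mono ?_ (by rw [Nat.succ_mul]) (by positivity)
    have : (1 : ℝ) ≤ 3 ^ n := one_le_pow₀ (by norm_num)
    nlinarith

theorem of_lipschitz {L : ℝ} (h1 : ∀ x, 1 ≤ q x) (hL : ∀ x y, |q x - q y| ≤ L * |x - y|) :
    Slow L 1 q := by
  have hL0 : 0 ≤ L := by simpa using (abs_nonneg _).trans (hL 1 0)
  refine ⟨fun x => one_pos.trans_le (h1 x), fun x y => (hL x y).trans ?_⟩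
  have := h1 y
  have := abs_nonneg (x - y)
  rw [pow_one]
  have : L * |x - y| ≤ L * q y * |x - y| := by
    rw [mul_assoc]
    gcongr
    nlinarith
  have : 0 ≤ L * q y := by positivity
  nlinarith

theorem inv_of_lipschitz {L : ℝ} (h1 : ∀ x, 1 ≤ q x) (hL : ∀ x y, |q x - q y| ≤ L * |x - y|) :
    Slow L 1 fun x => (q x)⁻¹ := by
  have hL0 : 0 ≤ L := by simpa using (abs_nonneg _).trans (hL 1 0)
  have h0 : ∀ x, 0 < q x := fun x => one_pos.trans_le (h1 x)
  refine ⟨fun x => inv_pos.2 (h0 x), fun x y => ?_⟩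
  have hx := h0 x
  have hy := h0 y
  have e : (q x)⁻¹ - (q y)⁻¹ = (q y - q x) * ((q x)⁻¹ * (q y)⁻¹) := by
    field_simp
  rw [e, abs_mul, abs_sub_comm, pow_one, abs_of_pos (by positivity : 0 < (q x)⁻¹ * (q y)⁻¹)]
  calc |q x - q y| * ((q x)⁻¹ * (q y)⁻¹) ≤ (L * (1 + |x - y|)) * (1 * (q y)⁻¹) := by
        gcongr
        · exact (hL x y).trans (by gcongr; linarith)
        · exact inv_le_one_of_one_le₀ (h1 x)
    _ = _ := by ring

/-- The square root of a slowly varying function. -/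
theorem of_sq (h : Slow δ p fun x => q x ^ 2) (hq : ∀ x, 0 < q x) : Slow δ p q := by
  refine ⟨hq, fun x y => ?_⟩
  have hx := hq x
  have hy := hq y
  have h1 := h.le x y
  have e : q x ^ 2 - q y ^ 2 = (q x - q y) * (q x + q y) := by ring
  simp only [e, abs_mul, abs_of_pos (add_pos hx hy)] at h1
  have h2 : |q x - q y| * q y ≤ |q x - q y| * (q x + q y) := by
    gcongr
    linarith
  have h3 : |q x - q y| * q y ≤ (δ * q y * (1 + |x - y|) ^ p) * q y := by
    refine (h2.trans h1).trans (le_of_eq ?_)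
    ring
  exact le_of_mul_le_mul_right h3 hy

end Slow

/-! ### Commutators with slowly varying functions of `A` -/

theorem norm_apply_le_of_block_le {Z : L2 →L[ℂ] L2} {b : ℤ → ℝ} (hb : ∀ n, 0 ≤ b n)
    (hZ : ∀ m n, ‖block m * Z * block n‖ ≤ b n * ((1 + |((m - n : ℤ) : ℝ)|) ^ 2)⁻¹)
    {q : ℝ → ℂ} (hq : BddMeas q) {K : ℝ}
    (h : ∀ (n : ℤ) (x : ℝ), (n : ℝ) ≤ x → x < n + 1 → b n ≤ K * ‖q x‖) (hK : 0 ≤ K) (ψ : L2) :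
    ‖Z ψ‖ ≤ schurConst * K * ‖fnA q ψ‖ := by
  have hS := schurConst_pos
  -- test against the multiple of `Z ψ` that optimizes the two terms of the Schur test
  set φ : L2 := ((schurConst⁻¹ : ℝ) : ℂ) • Z ψ with hφ
  have h1 := norm_inner_le_of_block_le (a := fun _ => 1) (M := 1) (φ := φ) (ψ := ψ) (b := b)
    (Z := Z) zero_le_one (by simpa using hZ)
    (fun s => by simpa using sum_norm_block_sq_le s φ) (fun s => sum_weighted_block_le hq hb h ψ s)
  have h2 : ‖⟪φ, Z ψ⟫_ℂ‖ = schurConst⁻¹ * ‖Z ψ‖ ^ 2 := by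
    rw [hφ, inner_smul_left, norm_mul, inner_self_eq_norm_sq_to_K]
    simp [abs_of_pos hS]
  have h3 : ‖φ‖ = schurConst⁻¹ * ‖Z ψ‖ := by
    rw [hφ, norm_smul, Complex.norm_real, Real.norm_of_nonneg (by positivity)]
  rw [h2, h3, one_mul] at h1
  have h4 : ‖Z ψ‖ ^ 2 ≤ (schurConst * K * ‖fnA q ψ‖) ^ 2 := by
    have := mul_le_mul_of_nonneg_left h1 hS.le
    field_simp at this
    nlinarith
  exact le_of_sq_le_sq h4 (by positivity)

section Commutator

variable {T T' : L2 →L[ℂ] L2} {m n : ℤ}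

theorem fnA_blockSymbol_sub_const {σ : ℝ → ℂ} (hσ : BddMeas σ) (a : ℂ) (m : ℤ) :
    fnA (blockSymbol m fun x => σ x - a) = block m * fnA σ - a • block m := by
  have hb := hσ.blockSymbol m
  rw [block_mul_fnA hσ, block, ← fnA_smul _ (bddMeas_blockSymbol_one m),
    ← fnA_sub hb ((BddMeas.const _).mul (bddMeas_blockSymbol_one m))]
  congr 1
  funext x
  simp only [blockSymbol, indicator_apply]
  split_ifs <;> simp

theorem block_mul_commutator_mul_block {σ : ℝ → ℂ} (hσ : BddMeas σ) (a : ℂ) (m n : ℤ) :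
    block m * (fnA σ * T - T * fnA σ) * block n =
      fnA (blockSymbol m fun x => σ x - a) * (block m * T * block n) -
        (block m * T * block n) * fnA (blockSymbol n fun x => σ x - a) := by
  rw [fnA_blockSymbol_sub_const hσ, fnA_blockSymbol_sub_const hσ, block_mul_fnA hσ]
  have h1 : fnA (blockSymbol m σ) * block m = fnA (blockSymbol m σ) :=
    fnA_blockSymbol_mul_block (hσ.blockSymbol m)
  have h2 : block n * fnA (blockSymbol n σ) = fnA (blockSymbol n σ) :=
    block_mul_fnA_blockSymbol (hσ.blockSymbol n)
  have e1 : (fnA (blockSymbol m σ) - a • block m) * (block m * T * block n) =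
      block m * fnA σ * T * block n - a • (block m * T * block n) := by
    rw [sub_mul, smul_mul_assoc, ← mul_assoc, ← mul_assoc, ← mul_assoc, ← mul_assoc, h1,
      block_mul_self, block_mul_fnA hσ]
  have e2 : (block m * T * block n) * (block n * fnA σ - a • block n) =
      block m * T * (fnA σ * block n) - a • (block m * T * block n) := by
    rw [mul_sub, mul_smul_comm, mul_assoc _ _ (block n * fnA σ), mul_assoc _ _ (block n),
      block_mul_self, block_mul_fnA hσ, h2, ← fnA_mul_block hσ]
  rw [e1, e2]
  simp only [mul_sub, sub_mul, mul_assoc]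
  abel

theorem abs_sub_intCast_le {x : ℝ} (h1 : (m : ℝ) ≤ x) (h2 : x < m + 1) (n : ℤ) :
    1 + |x - n| ≤ 2 * (1 + |((m - n : ℤ) : ℝ)|) := by
  have : |x - n| ≤ |x - m| + |(m : ℝ) - n| := abs_sub_le _ _ _
  have h3 : |x - m| ≤ 1 := by rw [abs_le]; constructor <;> linarith
  push_cast
  linarith [abs_nonneg ((m : ℝ) - n)]

/-- On a block, a function with slow variation is close to its value at an integer. -/
theorem norm_fnA_blockSymbol_le {r : ℝ → ℂ} {D : ℝ} {p : ℕ} (hD : 0 ≤ D) (n : ℤ)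
    (h : ∀ x : ℝ, ‖r x‖ ≤ D * (1 + |x - n|) ^ p) (m : ℤ) :
    ‖fnA (blockSymbol m r)‖ ≤ 2 ^ p * D * (1 + |((m - n : ℤ) : ℝ)|) ^ p := by
  refine norm_fnA_le (by positivity) (norm_blockSymbol_le (by positivity) fun x h1 h2 => ?_)
  refine (h x).trans ?_
  calc D * (1 + |x - n|) ^ p ≤ D * (2 * (1 + |((m - n : ℤ) : ℝ)|)) ^ p := by
        gcongr
        exact abs_sub_intCast_le h1 h2 n
    _ = _ := by rw [mul_pow]; ring

/-- The commutator of `T` with a weight of relative variation `δ` is bounded by `δ` times the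
weight. -/
theorem exists_norm_commutator_le (p : ℕ) (c : ℝ) : ∃ K : ℝ, 0 ≤ K ∧
    ∀ T : L2 →L[ℂ] L2, Bd 1 (p + 2) T c → ∀ (δ : ℝ) (q : ℝ → ℝ), 0 ≤ δ → δ ≤ 1 → Slow δ p q →
      BddMeas (fun x => (q x : ℂ)) → ∀ ψ : L2,
        ‖(fnA (fun x => (q x : ℂ)) * T - T * fnA fun x => (q x : ℂ)) ψ‖ ≤
          K * δ * ‖fnA (fun x => (q x : ℂ)) ψ‖ := by
  set c' := max c 0
  set D : ℝ := 2 * 2 ^ p * 3 ^ (p + 2) * c' with hD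
  refine ⟨schurConst * (D * (2 * 2 ^ p)), by have := schurConst_pos; positivity, ?_⟩
  intro T hT δ q hδ hδ1 hq hqb ψ
  have hcT : Bd 1 (p + 2) T c' := hT.mono (le_max_left _ _)
  have hD0 : 0 ≤ D := by positivity
  have key := norm_apply_le_of_block_le (Z := fnA (fun x => (q x : ℂ)) * T - T * fnA fun x => (q x : ℂ))
    (b := fun n => D * δ * q n) (fun n => by have := hq.pos n; positivity) ?_ hqb
    (K := D * δ * (2 * 2 ^ p)) ?_ (by positivity) ψ
  · refine key.trans (le_of_eq ?_)
    ring
  · intro m n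
    set t := ‖block m * T * block n‖
    set d := |((m - n : ℤ) : ℝ)| with hd
    have ht := hcT.block_decay m n
    have hqn := (hq.pos n).le
    have hr : ∀ k : ℤ, ‖fnA (blockSymbol k fun x => (q x : ℂ) - q n)‖ ≤
        2 ^ p * (δ * q n) * (1 + |((k - n : ℤ) : ℝ)|) ^ p := fun k =>
      norm_fnA_blockSymbol_le (by positivity) n (fun x => by
        rw [← Complex.ofReal_sub, Complex.norm_real]
        exact hq.le x n) k
    have hrn := hr n
    simp only [sub_self, Int.cast_zero, abs_zero, add_zero, one_pow, mul_one] at hrn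
    rw [block_mul_commutator_mul_block hqb (q n : ℂ)]
    have hd1 : 1 ≤ (1 + d) ^ p := one_le_pow₀ (by linarith [abs_nonneg ((m - n : ℤ) : ℝ)])
    have hd0 : 0 ≤ d := abs_nonneg _
    calc _ ≤ ‖fnA (blockSymbol m fun x => (q x : ℂ) - q n)‖ * t +
            t * ‖fnA (blockSymbol n fun x => (q x : ℂ) - q n)‖ :=
          (norm_sub_le _ _).trans (add_le_add (norm_mul_le _ _) (norm_mul_le _ _))
      _ ≤ (2 ^ p * (δ * q n) * (1 + d) ^ p) * t + t * (2 ^ p * (δ * q n) * (1 + d) ^ p) := by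
          gcongr
          · exact hr m
          · exact hrn.trans (le_mul_of_one_le_right (by positivity) hd1)
      _ = 2 * 2 ^ p * δ * q n * ((1 + d) ^ (p + 2) * t) * ((1 + d) ^ 2)⁻¹ := by
          rw [pow_add]
          field_simp
          ring
      _ ≤ 2 * 2 ^ p * δ * q n * (3 ^ (p + 2) * c') * ((1 + d) ^ 2)⁻¹ := by gcongr
      _ = D * δ * q n * ((1 + d) ^ 2)⁻¹ := by
          rw [hD]
          ring
  · intro n x h1 h2
    have hqx := hq.pos x
    have h3 := hq.le_mul hδ1 n x
    have h4 : (1 + |(n : ℝ) - x|) ^ p ≤ 2 ^ p := by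
      gcongr
      have : |(n : ℝ) - x| ≤ 1 := by rw [abs_le]; constructor <;> linarith
      linarith
    rw [Complex.norm_real, Real.norm_of_nonneg hqx.le]
    calc D * δ * q n ≤ D * δ * (2 * q x * 2 ^ p) := by
          gcongr
          exact h3.trans (by gcongr)
      _ = _ := by ring

/-- Second order expansion of a commutator: if `F' = -q²` with `q²` of relative variation `δ`, then
`[F(A), T] = -q(A)² [A, T]` up to an error which is small relative to `q(A)²`. -/
theorem exists_inner_commutator_le (p : ℕ) (c : ℝ) : ∃ K : ℝ, 0 ≤ K ∧
    ∀ T T' : L2 →L[ℂ] L2, IsAd T T' → Bd 1 (2 * p + 3) T c → Bd 1 (2 * p + 2) T' c →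
      ∀ (δ : ℝ) (F q : ℝ → ℝ), 0 ≤ δ → δ ≤ 1 → (∀ x, HasDerivAt F (-(q x ^ 2)) x) →
      (∀ x, 0 < q x) → Slow δ p (fun x => q x ^ 2) → BddMeas (fun x => (F x : ℂ)) →
      BddMeas (fun x => (q x : ℂ)) → ∀ ψ : L2,
        ‖⟪ψ, (fnA (fun x => (F x : ℂ)) * T - T * fnA (fun x => (F x : ℂ)) +
          fnA (fun x => ((q x ^ 2 : ℝ) : ℂ)) * T') ψ⟫_ℂ‖ ≤
          K * δ * ‖fnA (fun x => (q x : ℂ)) ψ‖ ^ 2 := by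
  set c' := max c 0
  set D : ℝ := (2 * 2 ^ (p + 1) * 3 ^ (2 * p + 3) + 2 ^ p * 3 ^ (2 * p + 2)) * c' with hD
  refine ⟨D * 2 * (schurConst * (2 * 2 ^ p) ^ 2), by have := schurConst_pos; positivity, ?_⟩
  intro T T' hTT hT hT' δ F q hδ hδ1 hF hq0 hq2 hFb hqb ψ
  have hcT : Bd 1 (2 * p + 3) T c' := hT.mono (le_max_left _ _)
  have hcT' : Bd 1 (2 * p + 2) T' c' := hT'.mono (le_max_left _ _)
  have hD0 : 0 ≤ D := by positivity
  have hq := hq2.of_sq hq0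
  have hq2b : BddMeas (fun x => ((q x ^ 2 : ℝ) : ℂ)) := by
    have := hqb.mul hqb
    refine (by ext x; push_cast; ring : (fun x => ((q x ^ 2 : ℝ) : ℂ)) = fun x => (q x : ℂ) * q x) ▸ this
  have hw := sum_weighted_block_le hqb (b := fun n => q n) (K := 2 * 2 ^ p)
    (fun n => (hq0 n).le) (fun n x h1 h2 => by
      have hqx := hq0 x
      have h3 := hq.le_mul hδ1 n x
      have h4 : (1 + |(n : ℝ) - x|) ^ p ≤ 2 ^ p := by
        gcongr
        have : |(n : ℝ) - x| ≤ 1 := by rw [abs_le]; constructor <;> linarith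
        linarith
      rw [Complex.norm_real, Real.norm_of_nonneg hqx.le]
      calc q n ≤ 2 * q x * 2 ^ p := h3.trans (by gcongr)
        _ = _ := by ring) ψ
  have key := norm_inner_le_of_block_le
    (Z := fnA (fun x => (F x : ℂ)) * T - T * fnA (fun x => (F x : ℂ)) +
          fnA (fun x => ((q x ^ 2 : ℝ) : ℂ)) * T')
    (a := fun n => q n) (b := fun n => q n) (M := D * 2 * δ) (by positivity) ?_ hw hw
  · refine key.trans (le_of_eq ?_)
    ring
  intro m n
  set t := ‖block m * T * block n‖
  set t' := ‖block m * T' * block n‖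
  set d := |((m - n : ℤ) : ℝ)| with hd
  have hd0 : 0 ≤ d := abs_nonneg _
  have ht := hcT.block_decay m n
  have ht' := hcT'.block_decay m n
  have hqn := hq0 n
  -- the Taylor remainder of `F` at `n`
  set r : ℝ → ℝ := fun x => F x - F n + q n ^ 2 * (x - n) with hr
  have hrb : ∀ x : ℝ, |r x| ≤ δ * q n ^ 2 * (1 + |x - n|) ^ (p + 1) := by
    intro x
    have hder : ∀ z, HasDerivAt r (-(q z ^ 2) + q n ^ 2) z := by
      intro z
      have := ((hF z).sub_const (F n)).add (((hasDerivAt_id z).sub_const (n : ℝ)).const_mul (q n ^ 2))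
      refine HasDerivAt.congr_deriv this ?_
      simp
    have := Convex.norm_image_sub_le_of_norm_hasDerivWithin_le (f := r)
      (C := δ * q n ^ 2 * (1 + |x - n|) ^ p) (s := segment ℝ (n : ℝ) x) (x := (n : ℝ)) (y := x)
      (fun z _ => (hder z).hasDerivWithinAt)
      (fun z hz => by
        have hzx : |z - n| ≤ |x - n| := by
          simpa [Real.norm_eq_abs] using norm_sub_le_of_mem_segment hz
        rw [Real.norm_eq_abs, neg_add_eq_sub, abs_sub_comm]
        refine (hq2.le z n).trans ?_
        gcongr)
      (convex_segment _ _) (left_mem_segment _ _ _) (right_mem_segment _ _ _)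
    have hrn : r n = 0 := by simp [hr]
    rw [hrn, sub_zero, Real.norm_eq_abs, Real.norm_eq_abs] at this
    refine this.trans ?_
    rw [pow_succ (1 + |x - n|), ← mul_assoc]
    exact mul_le_mul_of_nonneg_left (by linarith) (by positivity)
  have hmeas : Measurable fun x => (r x : ℂ) := by
    have hFm : Measurable F := (continuous_iff_continuousAt.2 fun x => (hF x).continuousAt).measurable
    exact Complex.measurable_ofReal.comp ((hFm.sub_const _).add (by fun_prop))
  have hRm : ∀ k : ℤ, ‖fnA (blockSymbol k fun x => (r x : ℂ))‖ ≤
      2 ^ (p + 1) * (δ * q n ^ 2) * (1 + |((k - n : ℤ) : ℝ)|) ^ (p + 1) := fun k =>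
    norm_fnA_blockSymbol_le (by positivity) n (fun x => by
      rw [Complex.norm_real]
      exact hrb x) k
  have hRn := hRm n
  simp only [sub_self, Int.cast_zero, abs_zero, add_zero, one_pow, mul_one] at hRn
  have hGm := norm_fnA_blockSymbol_le (r := fun x => ((q x ^ 2 : ℝ) : ℂ) - ((q n ^ 2 : ℝ) : ℂ))
    (D := δ * q n ^ 2) (p := p) (by positivity) n (fun x => by
      rw [← Complex.ofReal_sub, Complex.norm_real]
      exact hq2.le x n) m
  have hRe : ∀ k : ℤ, fnA (blockSymbol k fun x => (r x : ℂ)) =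
      fnA (blockSymbol k fun x => (F x : ℂ) - F n) +
        ((q n ^ 2 : ℝ) : ℂ) • (blockA k - (n : ℂ) • block k) := by
    intro k
    have h1 := bddMeas_blockSymbol_one k
    have h2 := bddMeas_blockSymbol_id k
    have h3 := (hFb.sub (BddMeas.const (F n))).blockSymbol k
    rw [blockA, block, ← fnA_smul _ h1, ← fnA_sub h2 ((BddMeas.const _).mul h1),
      ← fnA_smul _ (h2.sub ((BddMeas.const _).mul h1)),
      ← fnA_add h3 ((BddMeas.const _).mul (h2.sub ((BddMeas.const _).mul h1)))]
    congr 1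
    funext x
    simp only [blockSymbol, indicator_apply, hr]
    split_ifs
    · push_cast
      ring
    · simp
  have e : block m * (fnA (fun x => (F x : ℂ)) * T - T * fnA (fun x => (F x : ℂ)) +
        fnA (fun x => ((q x ^ 2 : ℝ) : ℂ)) * T') * block n =
      fnA (blockSymbol m fun x => (r x : ℂ)) * (block m * T * block n) -
      (block m * T * block n) * fnA (blockSymbol n fun x => (r x : ℂ)) +
      fnA (blockSymbol m fun x => ((q x ^ 2 : ℝ) : ℂ) - ((q n ^ 2 : ℝ) : ℂ)) *
        (block m * T' * block n) := by
    rw [mul_add, add_mul, block_mul_commutator_mul_block hFb (F n : ℂ), hRe, hRe,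
      fnA_blockSymbol_sub_const hq2b]
    have a1 : blockA m * (block m * T * block n) = blockA m * T * block n := by
      rw [← mul_assoc, ← mul_assoc, blockA_mul_block]
    have a2 : (block m * T * block n) * blockA n = block m * T * blockA n := by
      rw [mul_assoc, block_mul_blockA]
    have a3 : ∀ X : L2 →L[ℂ] L2, block m * (block m * X * block n) = block m * X * block n := by
      intro X
      rw [← mul_assoc, ← mul_assoc, block_mul_self]
    have a4 : ∀ X : L2 →L[ℂ] L2, (block m * X * block n) * block n = block m * X * block n := by
      intro X
      rw [mul_assoc, block_mul_self]
    have a5 : block m * fnA (fun x => ((q x ^ 2 : ℝ) : ℂ)) * (block m * T' * block n) =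
        block m * (fnA (fun x => ((q x ^ 2 : ℝ) : ℂ)) * T') * block n := by
      rw [mul_assoc (block m) _ (block m * T' * block n), ← mul_assoc _ _ (block n),
        ← mul_assoc _ _ T', fnA_mul_block hq2b, ← mul_assoc, ← mul_assoc,
        block_mul_fnA_blockSymbol (hq2b.blockSymbol m), ← block_mul_fnA hq2b]
      simp only [mul_assoc]
    have a6 := hTT.block m n
    simp only [add_mul, mul_add, sub_mul, mul_sub, smul_mul_assoc, mul_smul_comm, a1, a2, a3, a4, a5]
    rw [a6]
    simp only [smul_sub]
    abel
  rw [e]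
  have hdp : 1 ≤ (1 + d) ^ (p + 1) := one_le_pow₀ (by linarith)
  have hqmn : q n ≤ 2 * q m * (1 + d) ^ p := by
    have := hq.le_mul hδ1 n m
    rwa [abs_sub_comm, ← Int.cast_sub] at this
  have hqm := hq0 m
  calc _ ≤ ‖fnA (blockSymbol m fun x => (r x : ℂ))‖ * t +
          t * ‖fnA (blockSymbol n fun x => (r x : ℂ))‖ +
          ‖fnA (blockSymbol m fun x => ((q x ^ 2 : ℝ) : ℂ) - ((q n ^ 2 : ℝ) : ℂ))‖ * t' :=
        (norm_add_le _ _).trans (add_le_add ((norm_sub_le _ _).trans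
          (add_le_add (norm_mul_le _ _) (norm_mul_le _ _))) (norm_mul_le _ _))
    _ ≤ (2 ^ (p + 1) * (δ * q n ^ 2) * (1 + d) ^ (p + 1)) * t +
          t * (2 ^ (p + 1) * (δ * q n ^ 2) * (1 + d) ^ (p + 1)) +
          (2 ^ p * (δ * q n ^ 2) * (1 + d) ^ p) * t' := by
        gcongr
        · exact hRm m
        · exact hRn.trans (le_mul_of_one_le_right (by positivity) hdp)
    _ = (2 * 2 ^ (p + 1) * ((1 + d) ^ (2 * p + 3) * t) +
          2 ^ p * ((1 + d) ^ (2 * p + 2) * t')) * (δ * q n ^ 2) * ((1 + d) ^ (p + 2))⁻¹ := by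
        rw [show 2 * p + 3 = (p + 1) + (p + 2) by ring, pow_add (1 + d) (p + 1) (p + 2),
          show 2 * p + 2 = p + (p + 2) by ring, pow_add (1 + d) p (p + 2)]
        field_simp
        ring
    _ ≤ (2 * 2 ^ (p + 1) * (3 ^ (2 * p + 3) * c') +
          2 ^ p * (3 ^ (2 * p + 2) * c')) * (δ * q n ^ 2) * ((1 + d) ^ (p + 2))⁻¹ := by gcongr
    _ = D * δ * (q n * q n) * ((1 + d) ^ (p + 2))⁻¹ := by
        rw [hD]
        ring
    _ ≤ D * δ * ((2 * q m * (1 + d) ^ p) * q n) * ((1 + d) ^ (p + 2))⁻¹ := by gcongr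
    _ = D * 2 * δ * (q m * q n) * ((1 + d) ^ 2)⁻¹ := by
        rw [pow_add]
        field_simp

end Commutator

/-! ### The energy estimate -/

theorem real_smul_eq (a : ℝ) (T : L2 →L[ℂ] L2) : a • T = (a : ℂ) • T := rfl

/-- Differentiability of a moving weight in operator norm. -/
theorem hasDerivAt_fnA_comp_sub {F f : ℝ → ℝ} {L : ℝ} (hF : ∀ x, HasDerivAt F (f x) x)
    (hFb : BddMeas fun x => (F x : ℂ)) (hfb : BddMeas fun x => (f x : ℂ))
    (hL : ∀ x y, |f x - f y| ≤ L * |x - y|) (v s₀ : ℝ) :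
    HasDerivAt (fun s : ℝ => fnA fun x => (F (x - v * s) : ℂ))
      (-(v : ℂ) • fnA fun x => (f (x - v * s₀) : ℂ)) s₀ := by
  have hL0 : 0 ≤ L := by simpa using (abs_nonneg _).trans (hL 1 0)
  have hc : ∀ s, BddMeas fun x => (F (x - v * s) : ℂ) := fun s =>
    hFb.comp (φ := fun x => x - v * s) (by fun_prop)
  have hf' : BddMeas fun x => (f (x - v * s₀) : ℂ) :=
    hfb.comp (φ := fun x => x - v * s₀) (by fun_prop)
  rw [hasDerivAt_iff_isLittleO]
  have h1 : (fun s : ℝ => (s - s₀) ^ 2) =o[𝓝 s₀] fun s => s - s₀ := by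
    have h := (Asymptotics.isLittleO_pow_id (𝕜 := ℝ) one_lt_two).comp_tendsto
      (tendsto_sub_nhds_zero_iff.2 (tendsto_id (x := 𝓝 s₀)))
    exact h
  refine Asymptotics.IsBigO.trans_isLittleO (g := fun s : ℝ => (s - s₀) ^ 2) ?_ h1
  refine Asymptotics.IsBigO.of_bound (L * v ^ 2) (Eventually.of_forall fun s => ?_)
  have e : (fnA fun x => (F (x - v * s) : ℂ)) - (fnA fun x => (F (x - v * s₀) : ℂ)) -
      (s - s₀) • (-(v : ℂ) • fnA fun x => (f (x - v * s₀) : ℂ)) =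
      fnA fun x => (F (x - v * s) : ℂ) - F (x - v * s₀) -
        (-((v * (s - s₀) : ℝ) : ℂ)) * f (x - v * s₀) := by
    rw [fnA_sub ((hc s).sub (hc s₀)) ((BddMeas.const _).mul hf'), fnA_sub (hc s) (hc s₀),
      fnA_smul _ hf']
    congr 1
    rw [real_smul_eq, smul_smul]
    congr 1
    push_cast
    ring
  rw [e]
  refine norm_fnA_le (by positivity) fun x => ?_
  have := norm_sub_sub_le_of_lipschitz_deriv (u := fun x => (F x : ℂ)) (u' := fun x => (f x : ℂ))
    (C := L) (fun x => (hF x).ofReal_comp) (fun x y => by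
      rw [← Complex.ofReal_sub, Complex.norm_real]
      exact hL x y) (x - v * s₀) (v * (s - s₀))
  rw [show x - v * s₀ - v * (s - s₀) = x - v * s by ring] at this
  refine this.trans (le_of_eq ?_)
  rw [sq_abs, norm_pow, Real.norm_eq_abs, sq_abs]
  ring

theorem Slow.comp_sub {δ : ℝ} {p : ℕ} {q : ℝ → ℝ} (h : Slow δ p q) (b : ℝ) :
    Slow δ p fun x => q (x - b) :=
  ⟨fun x => h.pos _, fun x y => by simpa using h.le (x - b) (y - b)⟩

theorem inner_fnA_left {q : ℝ → ℝ} (hq : BddMeas fun x => (q x : ℂ)) (f g : L2) :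
    ⟪fnA (fun x => (q x : ℂ)) f, g⟫_ℂ = ⟪f, fnA (fun x => (q x : ℂ)) g⟫_ℂ := by
  have h := fnA_star hq
  simp only [Complex.conj_ofReal] at h
  rw [ContinuousLinearMap.star_eq_adjoint] at h
  rw [← ContinuousLinearMap.adjoint_inner_right, h]

theorem re_inner_fnA_sq {q : ℝ → ℝ} (hq : BddMeas fun x => (q x : ℂ)) (f : L2) :
    (⟪f, fnA (fun x => ((q x ^ 2 : ℝ) : ℂ)) f⟫_ℂ).re = ‖fnA (fun x => (q x : ℂ)) f‖ ^ 2 := by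
  have e : fnA (fun x => ((q x ^ 2 : ℝ) : ℂ)) = fnA (fun x => (q x : ℂ)) * fnA fun x => (q x : ℂ) := by
    rw [← fnA_mul hq hq]
    congr 1
    funext x
    push_cast
    ring
  rw [e, mul_apply_eq_comp, ← inner_fnA_left hq]
  exact inner_self_eq_norm_sq (𝕜 := ℂ) _

/-- A lower bound on the range of `X` extends to vectors that are relatively close to it. -/
theorem re_inner_perturb_ge {B X : L2 →L[ℂ] L2} {θ c κ : ℝ} (hB : ‖B‖ ≤ c)
    (hX : ‖X‖ ≤ c) (hM : ∀ η : L2, θ * ‖X η‖ ^ 2 ≤ (⟪X η, B (X η)⟫_ℂ).re) (hθ : 0 ≤ θ)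
    (hκ : 0 ≤ κ) (hκ1 : κ ≤ 1) {η e : L2} (he : ‖e‖ ≤ κ * ‖η‖) (hη : η = X η + e) :
    (θ - κ * (2 * θ + 2 * c ^ 2 + c)) * ‖η‖ ^ 2 ≤ (⟪η, B η⟫_ℂ).re := by
  have hc : 0 ≤ c := (norm_nonneg _).trans hB
  set x := X η with hx
  have h1 : ‖x‖ ≤ c * ‖η‖ := (X.le_opNorm _).trans (by gcongr)
  have h2 : ‖η‖ - κ * ‖η‖ ≤ ‖x‖ := by
    have : ‖η‖ ≤ ‖x‖ + ‖e‖ := by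
      conv_lhs => rw [hη]
      exact norm_add_le _ _
    linarith
  have h3 : (1 - 2 * κ) * ‖η‖ ^ 2 ≤ ‖x‖ ^ 2 := by
    have : ((1 - κ) * ‖η‖) ^ 2 ≤ ‖x‖ ^ 2 :=
      pow_le_pow_left₀ (mul_nonneg (by linarith) (norm_nonneg _)) (by linarith) 2
    nlinarith [sq_nonneg (κ * ‖η‖)]
  have hre : ∀ a b : L2, -(c * ‖a‖ * ‖b‖) ≤ (⟪a, B b⟫_ℂ).re := by
    intro a b
    have : |(⟪a, B b⟫_ℂ).re| ≤ ‖a‖ * (c * ‖b‖) :=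
      (Complex.abs_re_le_norm _).trans ((norm_inner_le_norm _ _).trans
        (mul_le_mul_of_nonneg_left ((B.le_opNorm _).trans (by gcongr)) (norm_nonneg _)))
    have := (abs_le.1 this).1
    linarith
  have e1 : (⟪η, B η⟫_ℂ).re = (⟪x, B x⟫_ℂ).re + (⟪x, B e⟫_ℂ).re + (⟪e, B x⟫_ℂ).re +
      (⟪e, B e⟫_ℂ).re := by
    conv_lhs => rw [hη]
    simp only [map_add, inner_add_left, inner_add_right, Complex.add_re]
    ring
  have h4 := hM η
  have h5 := hre x e
  have h6 := hre e x
  have h7 := hre e e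
  have hn := norm_nonneg η
  have b1 : c * ‖x‖ * ‖e‖ ≤ c * (c * ‖η‖) * (κ * ‖η‖) := by gcongr
  have b2 : c * ‖e‖ * ‖e‖ ≤ c * (κ * ‖η‖) * (1 * ‖η‖) := by
    gcongr
    exact he.trans (by gcongr)
  have b3 := mul_le_mul_of_nonneg_left h3 hθ
  rw [e1]
  nlinarith

/-- **The propagation estimate.** Along the flow of `H`, the expectation of a decreasing weight
which moves with half of the minimal speed `θ` decreases. -/
theorem exists_energy_antitone (p : ℕ) (c θ : ℝ) (hθ : 0 < θ) : ∃ δ₀ : ℝ, 0 < δ₀ ∧ δ₀ ≤ 1 ∧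
    ∀ H H' X : L2 →L[ℂ] L2, IsSelfAdjoint H → IsAd H H' → Bd 1 (2 * p + 3) H c →
      Bd 1 (2 * p + 2) H' c → Bd 1 (2 * p + 2) X c →
      (∀ η : L2, θ * ‖X η‖ ^ 2 ≤ (⟪X η, (-Complex.I • H') (X η)⟫_ℂ).re) →
      ∀ (δ L : ℝ) (F q : ℝ → ℝ), 0 ≤ δ → δ ≤ δ₀ → (∀ x, HasDerivAt F (-(q x ^ 2)) x) →
      (∀ x, 0 < q x) → Slow δ p (fun x => q x ^ 2) → BddMeas (fun x => (F x : ℂ)) →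
      BddMeas (fun x => (q x : ℂ)) → (∀ x y, |q x ^ 2 - q y ^ 2| ≤ L * |x - y|) →
      ∀ (φ₀ : L2) (φ : ℝ → L2), IsSolution H φ₀ φ → (∀ s, X (φ s) = φ s) →
      ∀ t : ℝ, 0 ≤ t → (⟪φ t, fnA (fun x => (F (x - θ / 2 * t) : ℂ)) (φ t)⟫_ℂ).re ≤
        (⟪φ₀, fnA (fun x => (F x : ℂ)) φ₀⟫_ℂ).re := by
  obtain ⟨K₁, hK₁, h1⟩ := exists_inner_commutator_le p c
  obtain ⟨K₂, hK₂, h2⟩ := exists_norm_commutator_le p c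
  set c' := max c 0
  set M := K₁ + K₂ + K₂ * (2 * θ + 2 * c' ^ 2 + c') with hMdef
  have hc' : 0 ≤ c' := le_max_right _ _
  have hM0 : 0 ≤ M := by positivity
  refine ⟨min (min 1 (K₂ + 1)⁻¹) (θ / 2 / (M + 1)), by positivity,
    (min_le_left _ _).trans (min_le_left _ _), ?_⟩
  intro H H' X hH hHH' hHb hH'b hXb hMou δ L F q hδ hδ₀ hF hq0 hq2 hFb hqb hL φ₀ φ hφ hXφ
  have hδ1 : δ ≤ 1 := hδ₀.trans ((min_le_left _ _).trans (min_le_left _ _))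
  have hδK : K₂ * δ ≤ 1 := by
    have : δ ≤ (K₂ + 1)⁻¹ := hδ₀.trans ((min_le_left _ _).trans (min_le_right _ _))
    calc K₂ * δ ≤ (K₂ + 1) * (K₂ + 1)⁻¹ := by gcongr; linarith
      _ = 1 := mul_inv_cancel₀ (by positivity)
  have hδM : M * δ ≤ θ / 2 := by
    have : δ ≤ θ / 2 / (M + 1) := hδ₀.trans (min_le_right _ _)
    calc M * δ ≤ (M + 1) * (θ / 2 / (M + 1)) := by gcongr; linarith
      _ = θ / 2 := by field_simp
  set B := -Complex.I • H' with hBdef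
  have hB : Bd 1 (2 * p + 2) B c := by
    have := hH'b.smul (-Complex.I)
    rwa [norm_neg, Complex.norm_I, one_mul] at this
  have hBn : ‖B‖ ≤ c' := (hB.norm_le zero_le_one).trans (le_max_left _ _)
  have hXn : ‖X‖ ≤ c' := (hXb.norm_le zero_le_one).trans (le_max_left _ _)
  have hpred : ∀ {T : L2 →L[ℂ] L2}, Bd 1 (2 * p + 2) T c → Bd 1 (p + 2) T c := by
    intro T hT
    have : ∀ j : ℕ, Bd 1 (p + 2 + j) T c → Bd 1 (p + 2) T c := by
      intro j
      induction j with
      | zero => exact id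
      | succ j ih => exact fun h => ih (Bd.pred zero_le_one h)
    exact this p (by convert hT using 1; ring)
  have hq2b : BddMeas (fun x => ((-(q x ^ 2) : ℝ) : ℂ)) := by
    have := (hqb.mul hqb).neg
    convert this using 2 with x
    push_cast
    ring
  -- the energy and its derivative
  set W : ℝ → L2 →L[ℂ] L2 := fun s => fnA fun x => (F (x - θ / 2 * s) : ℂ) with hW
  set e : ℝ → ℝ := fun s => (⟪φ s, W s (φ s)⟫_ℂ).re with he
  have hder : ∀ s, 0 ≤ s → ∃ e', HasDerivWithinAt e e' (Ici 0) s ∧ e' ≤ 0 := by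
    intro s hs
    obtain ⟨φ', hφ', hφ'e⟩ := hφ.2 s hs
    have hφ'2 : φ' = -Complex.I • H (φ s) := by
      rw [← hφ'e, smul_smul]
      simp
    set g : L2 →L[ℂ] L2 := fnA fun x => ((q (x - θ / 2 * s) ^ 2 : ℝ) : ℂ) with hg
    have hcomp : Measurable fun x : ℝ => x - θ / 2 * s := by fun_prop
    have hqs : BddMeas fun x => (q (x - θ / 2 * s) : ℂ) := hqb.comp hcomp
    have hFs : BddMeas fun x => (F (x - θ / 2 * s) : ℂ) := hFb.comp hcomp
    have hW' : HasDerivAt W (((θ / 2 : ℝ) : ℂ) • g) s := by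
      have := hasDerivAt_fnA_comp_sub (f := fun x => -(q x ^ 2)) (L := L) hF hFb hq2b
        (fun x y => by
          rw [neg_sub_neg, abs_sub_comm]
          exact hL x y) (θ / 2) s
      refine this.congr_deriv ?_
      have hgb : BddMeas fun x => ((q (x - θ / 2 * s) ^ 2 : ℝ) : ℂ) := by
        have := (hq2b.neg).comp hcomp
        simpa using this
      have e2 : (fun x => ((-(q (x - θ / 2 * s) ^ 2) : ℝ) : ℂ)) =
          fun x => -((q (x - θ / 2 * s) ^ 2 : ℝ) : ℂ) := by
        funext x
        push_cast
        ring
      rw [e2, fnA_neg hgb, smul_neg, neg_smul, neg_neg]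
    have hd1 : HasDerivWithinAt (fun s => W s (φ s)) ((((θ / 2 : ℝ) : ℂ) • g) (φ s) + W s φ')
        (Ici 0) s := by
      have := hW'.hasDerivWithinAt (s := Ici 0)
      exact (ContinuousLinearMap.restrictScalarsL ℂ L2 L2 ℝ ℝ).hasFDerivAt.comp_hasDerivWithinAt
        s this |>.clm_apply hφ'
    have hd2 := hφ'.inner ℂ hd1
    have hd3 := Complex.reCLM.hasFDerivAt.comp_hasDerivWithinAt s hd2
    refine ⟨_, hd3, ?_⟩
    set η : L2 := fnA (fun x => (q (x - θ / 2 * s) : ℂ)) (φ s) with hη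
    set E : ℂ := ⟪φ s, (W s * H - H * W s + g * H') (φ s)⟫_ℂ with hE
    have hEb : ‖E‖ ≤ K₁ * δ * ‖η‖ ^ 2 :=
      h1 H H' hHH' hHb hH'b δ (fun x => F (x - θ / 2 * s)) (fun x => q (x - θ / 2 * s)) hδ hδ1
        (fun x => by simpa using (hF (x - θ / 2 * s)).comp_sub_const x (θ / 2 * s))
        (fun x => hq0 _) (hq2.comp_sub _) hFs hqs (φ s)
    have hqslow : Slow δ p fun x => q (x - θ / 2 * s) := (hq2.of_sq hq0).comp_sub _
    have hBc := h2 B (hpred hB) δ _ hδ hδ1 hqslow hqs (φ s)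
    have hXc := h2 X (hpred hXb) δ _ hδ hδ1 hqslow hqs (φ s)
    set Q : L2 →L[ℂ] L2 := fnA fun x => (q (x - θ / 2 * s) : ℂ) with hQ
    have hgQ : g = Q * Q := by
      rw [hg, hQ, ← fnA_mul hqs hqs]
      congr 1
      funext x
      push_cast
      ring
    have hgre : (⟪φ s, g (φ s)⟫_ℂ).re = ‖η‖ ^ 2 := re_inner_fnA_sq hqs _
    have hηX : η = X η + (Q * X - X * Q) (φ s) := by
      rw [sub_apply, mul_apply_eq_comp, mul_apply_eq_comp, hXφ s]
      abel
    have hlow := re_inner_perturb_ge hBn hXn hMou hθ.le (by positivity) hδK hXc hηX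
    have hgB : (⟪φ s, g (B (φ s))⟫_ℂ).re = (⟪η, B η⟫_ℂ).re + (⟪η, (Q * B - B * Q) (φ s)⟫_ℂ).re := by
      rw [hgQ, mul_apply_eq_comp, ← inner_fnA_left hqs, sub_apply, mul_apply_eq_comp,
        mul_apply_eq_comp, inner_sub_right, Complex.sub_re]
      ring
    have hBc2 : -(K₂ * δ * ‖η‖ ^ 2) ≤ (⟪η, (Q * B - B * Q) (φ s)⟫_ℂ).re := by
      have h := (Complex.abs_re_le_norm _).trans (norm_inner_le_norm (𝕜 := ℂ) η
        ((Q * B - B * Q) (φ s)))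
      have h' := (abs_le.1 (h.trans (mul_le_mul_of_nonneg_left hBc (norm_nonneg _)))).1
      nlinarith
    have hEre : (-Complex.I * E).re ≤ K₁ * δ * ‖η‖ ^ 2 := by
      refine (Complex.re_le_norm _).trans ?_
      rw [norm_mul, norm_neg, Complex.norm_I, one_mul]
      exact hEb
    have hmain : (⟪φ s, (((θ / 2 : ℝ) : ℂ) • g) (φ s) + W s φ'⟫_ℂ + ⟪φ', W s (φ s)⟫_ℂ).re =
        θ / 2 * ‖η‖ ^ 2 + (-Complex.I * E).re - (⟪φ s, g (B (φ s))⟫_ℂ).re := by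
      have hHsym : ⟪H (φ s), W s (φ s)⟫_ℂ = ⟪φ s, H (W s (φ s))⟫_ℂ := by
        have := hH.adjoint_eq
        rw [← ContinuousLinearMap.adjoint_inner_right, this]
      have e3 : ⟪φ s, (((θ / 2 : ℝ) : ℂ) • g) (φ s) + W s φ'⟫_ℂ + ⟪φ', W s (φ s)⟫_ℂ =
          ((θ / 2 : ℝ) : ℂ) * ⟪φ s, g (φ s)⟫_ℂ + (-Complex.I * E) - ⟪φ s, g (B (φ s))⟫_ℂ := by
        rw [hφ'2, hE, hBdef]
        simp only [inner_add_right, smul_apply, inner_smul_right, inner_smul_left, map_smul,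
          add_apply, sub_apply, inner_sub_right, mul_apply_eq_comp, hHsym]
        simp only [map_neg, Complex.conj_I]
        ring
      rw [e3, Complex.sub_re, Complex.add_re, Complex.re_ofReal_mul, hgre]
    change (⟪φ s, (((θ / 2 : ℝ) : ℂ) • g) (φ s) + W s φ'⟫_ℂ + ⟪φ', W s (φ s)⟫_ℂ).re ≤ 0
    rw [hmain, hgB]
    have hfin : M * δ * ‖η‖ ^ 2 ≤ θ / 2 * ‖η‖ ^ 2 := by gcongr
    rw [hMdef] at hfin
    nlinarith
  intro t ht
  have hanti : AntitoneOn e (Ici 0) := by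
    choose! e' he' hle using hder
    refine antitoneOn_of_hasDerivWithinAt_nonpos (f' := e') (convex_Ici 0)
      (fun s hs => (he' s hs).continuousWithinAt) (fun s hs => ?_) (fun s hs => ?_)
    · exact (he' s (interior_subset hs)).mono interior_subset
    · exact hle s (interior_subset hs)
  have := hanti self_mem_Ici (mem_Ici.2 ht) ht
  simpa only [he, hW, mul_zero, sub_zero, hφ.1] using this

/-! ### The moving weight -/

/-- The Japanese bracket `(1 + x²)^(1/2)`. -/
def jap (x : ℝ) : ℝ := Real.sqrt (1 + x ^ 2)

theorem one_le_jap (x : ℝ) : 1 ≤ jap x := Real.one_le_sqrt.2 (by nlinarith [sq_nonneg x])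

theorem jap_pos (x : ℝ) : 0 < jap x := one_pos.trans_le (one_le_jap x)

theorem jap_sq (x : ℝ) : jap x ^ 2 = 1 + x ^ 2 := Real.sq_sqrt (by positivity)

theorem abs_lt_jap (x : ℝ) : |x| < jap x := by
  refine abs_lt_of_sq_lt_sq ?_ (jap_pos x).le
  rw [jap_sq]
  linarith

theorem hasDerivAt_jap (x : ℝ) : HasDerivAt jap (x / jap x) x := by
  have h : HasDerivAt (fun x : ℝ => 1 + x ^ 2) (2 * x) x := by
    simpa using (hasDerivAt_pow 2 x).const_add 1
  have := h.sqrt (by positivity)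
  refine this.congr_deriv ?_
  rw [mul_div_mul_left _ _ two_ne_zero]
  rfl

theorem abs_jap_sub_le (x y : ℝ) : |jap x - jap y| ≤ |x - y| := by
  have h1 : (jap x - jap y) * (jap x + jap y) = (x - y) * (x + y) := by
    nlinarith [jap_sq x, jap_sq y]
  have h2 : 0 < jap x + jap y := add_pos (jap_pos x) (jap_pos y)
  have h3 : |x + y| ≤ jap x + jap y :=
    (abs_add_le _ _).trans (add_le_add (abs_lt_jap x).le (abs_lt_jap y).le)
  have h4 := congrArg abs h1
  rw [abs_mul, abs_mul, abs_of_pos h2] at h4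
  refine le_of_mul_le_mul_right ?_ h2
  rw [h4]
  exact mul_le_mul_of_nonneg_left h3 (abs_nonneg _)

/-- The function `(1 + x²)^(1/2) - x`, which is `~ 2|x|` at `-∞` and `~ 1/(2x)` at `+∞`. -/
def ramp (x : ℝ) : ℝ := jap x - x

theorem ramp_pos (x : ℝ) : 0 < ramp x := sub_pos.2 ((le_abs_self x).trans_lt (abs_lt_jap x))

theorem neg_lt_ramp (x : ℝ) : -x < ramp x := by
  have := jap_pos x
  unfold ramp
  linarith

theorem ramp_mul_ramp_neg (x : ℝ) : ramp x * ramp (-x) = 1 := by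
  have : jap (-x) = jap x := by simp [jap]
  rw [ramp, ramp, this]
  nlinarith [jap_sq x]

theorem ramp_le (x : ℝ) : ramp x ≤ 2 * jap x := by
  unfold ramp
  linarith [neg_abs_le x, abs_lt_jap x]

theorem abs_ramp_sub_le (x y : ℝ) : |ramp x - ramp y| ≤ 2 * |x - y| := by
  have : ramp x - ramp y = (jap x - jap y) - (x - y) := by
    unfold ramp
    ring
  rw [this]
  refine (abs_sub _ _).trans ?_
  linarith [abs_jap_sub_le x y]

theorem hasDerivAt_ramp (x : ℝ) : HasDerivAt ramp (-(ramp x / jap x)) x := by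
  refine ((hasDerivAt_jap x).sub (hasDerivAt_id x)).congr_deriv ?_
  have := (jap_pos x).ne'
  unfold ramp
  field_simp
  ring

/-- The weight `(1 + u) / (1 + ε u)`, `u = (1 + x²)^(1/2) - x`: a decreasing function, between `1`
and `1 / ε`, which grows linearly towards `-∞` until the truncation at height `1 / ε`. -/
def hump (ε x : ℝ) : ℝ := (1 + ramp x) / (1 + ε * ramp x)

/-- Minus the derivative of `x ↦ hump ε (x / R) ^ (2 k)`. -/
def humpFlux (k : ℕ) (ε R x : ℝ) : ℝ :=
  2 * k * (1 - ε) / R * ((1 + ramp (x / R)) ^ (2 * k) *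
    ((1 + ε * ramp (x / R))⁻¹) ^ (2 * k + 1) * (jap (x / R))⁻¹ * (1 + ramp (-(x / R)))⁻¹)

section Hump

variable {ε R : ℝ}

theorem continuous_jap : Continuous jap := by
  unfold jap
  fun_prop

theorem continuous_ramp : Continuous ramp := continuous_jap.sub continuous_id

theorem one_add_pos (hε : 0 < ε) (x : ℝ) : 0 < 1 + ε * ramp x := by
  have := ramp_pos x
  positivity

theorem hump_pos (hε : 0 < ε) (x : ℝ) : 0 < hump ε x := by
  have := ramp_pos x
  have := one_add_pos hε x
  unfold hump
  positivity

theorem one_le_hump (hε : 0 < ε) (hε1 : ε < 1) (x : ℝ) : 1 ≤ hump ε x := by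
  have := ramp_pos x
  rw [hump, one_le_div (one_add_pos hε x)]
  nlinarith

theorem hump_le_inv (hε : 0 < ε) (hε1 : ε < 1) (x : ℝ) : hump ε x ≤ ε⁻¹ := by
  have := ramp_pos x
  rw [hump, div_le_iff₀ (one_add_pos hε x)]
  have : ε⁻¹ * (1 + ε * ramp x) = ε⁻¹ + ramp x := by field_simp
  rw [this]
  have := (one_lt_inv₀ hε).2 hε1
  linarith

theorem hump_le_jap (hε : 0 < ε) (x : ℝ) : hump ε x ≤ 3 * jap x := by
  have h0 := ramp_pos x
  calc hump ε x ≤ (1 + ramp x) / 1 := by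
        unfold hump
        gcongr
        nlinarith
    _ ≤ 3 * jap x := by linarith [ramp_le x, one_le_jap x]

theorem continuous_hump (hε : 0 < ε) : Continuous (hump ε) := by
  unfold hump
  exact (continuous_const.add continuous_ramp).div
    (continuous_const.add (continuous_const.mul continuous_ramp)) fun x => (one_add_pos hε x).ne'

theorem hasDerivAt_hump (hε : 0 < ε) (x : ℝ) :
    HasDerivAt (hump ε) (-((1 - ε) * ramp x / (jap x * (1 + ε * ramp x) ^ 2))) x := by
  have h1 := (hasDerivAt_ramp x).const_add 1
  have h2 := ((hasDerivAt_ramp x).const_mul ε).const_add 1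
  refine (h1.div h2 (one_add_pos hε x).ne').congr_deriv ?_
  have := (jap_pos x).ne'
  have := (one_add_pos hε x).ne'
  field_simp
  ring

theorem hasDerivAt_hump_pow {k : ℕ} (hk : 1 ≤ k) (hε : 0 < ε) (hR : 0 < R) (x : ℝ) :
    HasDerivAt (fun x => hump ε (x / R) ^ (2 * k)) (-humpFlux k ε R x) x := by
  have h1 : HasDerivAt (fun x => hump ε (x / R))
      (-((1 - ε) * ramp (x / R) / (jap (x / R) * (1 + ε * ramp (x / R)) ^ 2)) * (1 / R)) x := by
    have h0 : HasDerivAt (fun x : ℝ => x / R) (1 / R) x := (hasDerivAt_id x).div_const R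
    exact HasDerivAt.comp x (hasDerivAt_hump hε (x / R)) h0
  refine (h1.pow (2 * k)).congr_deriv ?_
  unfold humpFlux
  generalize x / R = X
  have hu := ramp_pos X
  have hv := ramp_pos (-X)
  have huv := ramp_mul_ramp_neg X
  have hj := jap_pos X
  have he := one_add_pos hε X
  have h2 : ramp X = (1 + ramp X) * (1 + ramp (-X))⁻¹ := by
    field_simp
    linarith
  obtain ⟨n, hn⟩ : ∃ n, 2 * k = n + 1 := ⟨2 * k - 1, by omega⟩
  rw [hump, hn, Nat.add_sub_cancel]
  have hk' : (2 : ℝ) * k = n + 1 := by exact_mod_cast hn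
  rw [hk']
  have e1 : (1 - ε) * ramp X = (1 - ε) * ((1 + ramp X) * (1 + ramp (-X))⁻¹) := by rw [← h2]
  have he' := he.ne'
  rw [e1, div_pow, inv_pow]
  push_cast
  field_simp
  ring

theorem humpFlux_pos {k : ℕ} (hk : 1 ≤ k) (hε : 0 < ε) (hε1 : ε < 1) (hR : 0 < R) (x : ℝ) :
    0 < humpFlux k ε R x := by
  have h1 := ramp_pos (x / R)
  have h2 := ramp_pos (-(x / R))
  have h3 := jap_pos (x / R)
  have h4 : (0 : ℝ) < k := by exact_mod_cast hk
  have h5 : 0 < 1 - ε := by linarith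
  unfold humpFlux
  positivity

theorem abs_comp_div_sub_le {f : ℝ → ℝ} {L : ℝ} (hf : ∀ x y, |f x - f y| ≤ L * |x - y|)
    (hR : 0 < R) (x y : ℝ) : |f (x / R) - f (y / R)| ≤ L / R * |x - y| := by
  refine (hf _ _).trans (le_of_eq ?_)
  rw [← sub_div, abs_div, abs_of_pos hR]
  ring

theorem abs_one_add_mul_ramp_sub_le (hε : 0 ≤ ε) (hε1 : ε ≤ 1) (x y : ℝ) :
    |(1 + ε * ramp x) - (1 + ε * ramp y)| ≤ 2 * |x - y| := by
  rw [add_sub_add_left_eq_sub, ← mul_sub, abs_mul, abs_of_nonneg hε]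
  calc ε * |ramp x - ramp y| ≤ 1 * (2 * |x - y|) := by
        gcongr
        exact abs_ramp_sub_le x y
    _ = _ := one_mul _

theorem abs_one_add_ramp_neg_sub_le (x y : ℝ) :
    |(1 + ramp (-x)) - (1 + ramp (-y))| ≤ 2 * |x - y| := by
  rw [add_sub_add_left_eq_sub]
  refine (abs_ramp_sub_le _ _).trans (le_of_eq ?_)
  rw [neg_sub_neg, abs_sub_comm]

/-- The size of the relative variation of the weights below at length scale `R`. -/
def humpRate (k : ℕ) (R : ℝ) : ℝ := 3 ^ (2 * k + 1) * (2 / R)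

theorem slow_factors (k n : ℕ) (hn : n ≤ 2 * k + 1) (hε : 0 < ε) (hε1 : ε < 1) (hR : 0 < R)
    (hR1 : humpRate k R ≤ 1) :
    Slow (humpRate k R) (2 * k + 1) (fun x => (1 + ramp (x / R)) ^ n) ∧
      Slow (humpRate k R) (2 * k + 1) (fun x => ((1 + ε * ramp (x / R))⁻¹) ^ n) := by
  have hL0 : 0 ≤ 2 / R := by positivity
  have h3 : (3 : ℝ) ^ n ≤ 3 ^ (2 * k + 1) := pow_le_pow_right₀ (by norm_num) hn
  have hL1 : 2 / R ≤ 1 := by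
    refine le_trans ?_ hR1
    have : (1 : ℝ) ≤ 3 ^ (2 * k + 1) := one_le_pow₀ (by norm_num)
    unfold humpRate
    nlinarith
  have a1 : Slow (2 / R) 1 fun x => 1 + ramp (x / R) :=
    Slow.of_lipschitz (fun x => by linarith [ramp_pos (x / R)]) fun x y => by
      simpa using abs_comp_div_sub_le (fun x y => abs_one_add_mul_ramp_sub_le zero_le_one le_rfl x y)
        hR x y
  have a2 : Slow (2 / R) 1 fun x => (1 + ε * ramp (x / R))⁻¹ :=
    Slow.inv_of_lipschitz (q := fun x => 1 + ε * ramp (x / R))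
      (fun x => by nlinarith [ramp_pos (x / R)]) fun x y =>
      abs_comp_div_sub_le (f := fun x => 1 + ε * ramp x)
        (fun x y => abs_one_add_mul_ramp_sub_le hε.le hε1.le x y) hR x y
  unfold humpRate
  exact ⟨(a1.pow hL0 hL1 n).mono (by gcongr) (by omega) (by positivity),
    (a2.pow hL0 hL1 n).mono (by gcongr) (by omega) (by positivity)⟩

theorem slow_humpFlux {k : ℕ} (hk : 1 ≤ k) (hε : 0 < ε) (hε1 : ε < 1) (hR : 0 < R)
    (hR1 : humpRate k R ≤ 1) :
    Slow (15 * humpRate k R) (4 * (2 * k + 1)) (humpFlux k ε R) := by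
  have hd0 : 0 ≤ humpRate k R := by unfold humpRate; positivity
  have hL : 2 / R ≤ humpRate k R := by
    have : (1 : ℝ) ≤ 3 ^ (2 * k + 1) := one_le_pow₀ (by norm_num)
    have : 0 < 2 / R := by positivity
    unfold humpRate
    nlinarith
  have hk0 : (0 : ℝ) < k := by exact_mod_cast hk
  have b1 := (slow_factors k (2 * k) (by omega) hε hε1 hR hR1).1
  have b2 := (slow_factors k (2 * k + 1) le_rfl hε hε1 hR hR1).2
  have b3 : Slow (humpRate k R) (2 * k + 1) fun x => (jap (x / R))⁻¹ := by
    refine (Slow.inv_of_lipschitz (L := 2 / R) (q := fun x => jap (x / R))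
      (fun x => one_le_jap _) fun x y => ?_).mono hL (by omega) (by positivity)
    exact abs_comp_div_sub_le (L := 2) (fun x y => (abs_jap_sub_le x y).trans
      (by linarith [abs_nonneg (x - y)])) hR x y
  have b4 : Slow (humpRate k R) (2 * k + 1) fun x => (1 + ramp (-(x / R)))⁻¹ := by
    refine (Slow.inv_of_lipschitz (L := 2 / R) (q := fun x => 1 + ramp (-(x / R)))
      (fun x => by linarith [ramp_pos (-(x / R))]) fun x y => ?_).mono hL (by omega) (by positivity)
    exact abs_comp_div_sub_le (f := fun x => 1 + ramp (-x)) (L := 2)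
      (fun x y => abs_one_add_ramp_neg_sub_le x y) hR x y
  have m1 := b1.mul b2 hd0 hd0 hR1
  have m2 := m1.mul b3 (by positivity) hd0 hR1
  have m3 := m2.mul b4 (by positivity) hd0 hR1
  have h1ε : 0 < 1 - ε := by linarith
  refine (m3.const_mul (a := 2 * k * (1 - ε) / R) (by positivity)).mono ?_ ?_ (by positivity)
  · linarith
  · omega

theorem slow_hump_pow (k : ℕ) (hε : 0 < ε) (hε1 : ε < 1) (hR : 0 < R) (hR1 : humpRate k R ≤ 1) :
    Slow (15 * humpRate k R) (4 * (2 * k + 1)) (fun x => hump ε (x / R) ^ k) := by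
  have hd0 : 0 ≤ humpRate k R := by unfold humpRate; positivity
  obtain ⟨b1, b2⟩ := slow_factors k k (by omega) hε hε1 hR hR1
  have := b1.mul b2 hd0 hd0 hR1
  simp only [← mul_pow, ← div_eq_mul_inv] at this
  exact this.mono (by linarith) (by omega) (by positivity)

/-- A function which is bounded and Lipschitz. -/
def BddLip (f : ℝ → ℝ) : Prop := ∃ L : ℝ, (∀ x, |f x| ≤ L) ∧ ∀ x y, |f x - f y| ≤ L * |x - y|

theorem BddLip.mul {f g : ℝ → ℝ} (hf : BddLip f) (hg : BddLip g) : BddLip fun x => f x * g x := by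
  obtain ⟨A, hA, hA'⟩ := hf
  obtain ⟨B, hB, hB'⟩ := hg
  have hA0 : 0 ≤ A := (abs_nonneg _).trans (hA 0)
  have hB0 : 0 ≤ B := (abs_nonneg _).trans (hB 0)
  refine ⟨2 * (A * B), fun x => ?_, fun x y => ?_⟩
  · rw [abs_mul]
    nlinarith [mul_le_mul (hA x) (hB x) (abs_nonneg _) hA0, mul_nonneg hA0 hB0]
  · have e : f x * g x - f y * g y = (f x - f y) * g x + f y * (g x - g y) := by ring
    rw [e]
    refine (abs_add_le _ _).trans ?_
    rw [abs_mul, abs_mul]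
    have h1 := mul_le_mul (hA' x y) (hB x) (abs_nonneg _) (by positivity)
    have h2 := mul_le_mul (hA y) (hB' x y) (abs_nonneg _) hA0
    linarith

theorem BddLip.const (c : ℝ) : BddLip fun _ => c :=
  ⟨|c|, fun _ => le_rfl, fun x y => by simp; positivity⟩

theorem BddLip.pow {f : ℝ → ℝ} (hf : BddLip f) (n : ℕ) : BddLip fun x => f x ^ n := by
  induction n with
  | zero => simpa using BddLip.const 1
  | succ n ih => simpa only [pow_succ] using ih.mul hf

theorem BddLip.inv {f : ℝ → ℝ} {L : ℝ} (h1 : ∀ x, 1 ≤ f x) (hL : ∀ x y, |f x - f y| ≤ L * |x - y|) :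
    BddLip fun x => (f x)⁻¹ := by
  have hL0 : 0 ≤ L := by simpa using (abs_nonneg _).trans (hL 1 0)
  have h0 : ∀ x, 0 < f x := fun x => one_pos.trans_le (h1 x)
  have h2 : ∀ x, (f x)⁻¹ ≤ 1 := fun x => inv_le_one_of_one_le₀ (h1 x)
  refine ⟨L + 1, fun x => ?_, fun x y => ?_⟩
  · rw [abs_of_pos (inv_pos.2 (h0 x))]
    linarith [h2 x]
  · have hx := h0 x
    have hy := h0 y
    have e : (f x)⁻¹ - (f y)⁻¹ = (f y - f x) * ((f x)⁻¹ * (f y)⁻¹) := by field_simp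
    rw [e, abs_mul, abs_sub_comm, abs_of_pos (by positivity : 0 < (f x)⁻¹ * (f y)⁻¹)]
    calc |f x - f y| * ((f x)⁻¹ * (f y)⁻¹) ≤ (L * |x - y|) * (1 * 1) := by
          gcongr
          · exact hL x y
          · exact h2 x
          · exact h2 y
      _ ≤ (L + 1) * |x - y| := by nlinarith [abs_nonneg (x - y)]

theorem bddLip_humpFlux (k : ℕ) (hε : 0 < ε) (hε1 : ε < 1) (hR : 0 < R) :
    BddLip (humpFlux k ε R) := by
  have b2 : BddLip fun x => (1 + ε * ramp (x / R))⁻¹ :=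
    BddLip.inv (f := fun x => 1 + ε * ramp (x / R)) (fun x => by nlinarith [ramp_pos (x / R)])
      fun x y => abs_comp_div_sub_le (f := fun x => 1 + ε * ramp x)
        (fun x y => abs_one_add_mul_ramp_sub_le hε.le hε1.le x y) hR x y
  have b1 : BddLip fun x => (1 + ramp (x / R)) * (1 + ε * ramp (x / R))⁻¹ := by
    obtain ⟨L, h1, h2⟩ := b2
    have hL0 : 0 ≤ L := (abs_nonneg _).trans (h1 0)
    have h1ε : 0 ≤ ε⁻¹ - 1 := by linarith [(one_lt_inv₀ hε).2 hε1]
    refine ⟨(ε⁻¹ - 1) * L + ε⁻¹, fun x => ?_, fun x y => ?_⟩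
    · have := hump_le_inv hε hε1 (x / R)
      simp only
      have h0 := hump_pos hε (x / R)
      rw [← div_eq_mul_inv]
      change |hump ε (x / R)| ≤ _
      rw [abs_of_pos h0]
      have : 0 ≤ (ε⁻¹ - 1) * L := by positivity
      linarith
    · have e : ∀ x, (1 + ramp (x / R)) * (1 + ε * ramp (x / R))⁻¹ =
          ε⁻¹ - (ε⁻¹ - 1) * (1 + ε * ramp (x / R))⁻¹ := by
        intro x
        have := (one_add_pos hε (x / R)).ne'
        have h3 : 1 + ramp (x / R) = ε⁻¹ * (1 + ε * ramp (x / R)) - (ε⁻¹ - 1) := by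
          rw [mul_add, inv_mul_cancel_left₀ hε.ne']
          ring
        rw [h3, sub_mul, mul_assoc, mul_inv_cancel₀ this, mul_one]
      simp only at h2 ⊢
      rw [e, e, sub_sub_sub_cancel_left, ← mul_sub, abs_mul, abs_of_nonneg h1ε, abs_sub_comm]
      have := mul_le_mul_of_nonneg_left (h2 x y) h1ε
      have : 0 ≤ ε⁻¹ * |x - y| := by positivity
      linarith
  have b3 : BddLip fun x => (jap (x / R))⁻¹ :=
    BddLip.inv (f := fun x => jap (x / R)) (fun x => one_le_jap _) fun x y =>
      abs_comp_div_sub_le (L := 1) (fun x y => by simpa using abs_jap_sub_le x y) hR x y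
  have b4 : BddLip fun x => (1 + ramp (-(x / R)))⁻¹ :=
    BddLip.inv (f := fun x => 1 + ramp (-(x / R))) (fun x => by linarith [ramp_pos (-(x / R))])
      fun x y => abs_comp_div_sub_le (f := fun x => 1 + ramp (-x)) (L := 2)
        (fun x y => abs_one_add_ramp_neg_sub_le x y) hR x y
  have := (BddLip.const (2 * k * (1 - ε) / R)).mul ((((b1.pow (2 * k)).mul b2).mul b3).mul b4)
  convert this using 1
  funext x
  rw [humpFlux, pow_succ, mul_pow]
  ring

/-- At time `t` the weight that moved to the right at speed `v` bounds `(1 + t) / ⟨x⟩` from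
above, up to a constant. -/
theorem one_add_le_jap_mul_hump {v t : ℝ} (hv : 0 < v) (hR : 1 ≤ R) (ht : 0 ≤ t) (x : ℝ) :
    1 + t ≤ (1 + 2 * R / v) * (jap x * hump (2 + t)⁻¹ ((x - v * t) / R)) := by
  set ε := (2 + t)⁻¹
  have hε : 0 < ε := by positivity
  have hε1 : ε < 1 := inv_lt_one_of_one_lt₀ (by linarith)
  have hR0 : 0 < R := by linarith
  set X := (x - v * t) / R with hX
  have hj := one_le_jap x
  have hh := one_le_hump hε hε1 X
  rcases le_total (v * t / 2) x with h | h
  · have h1 : v * t / 2 ≤ jap x := h.trans ((le_abs_self x).trans (abs_lt_jap x).le)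
    have h2 : t ≤ 2 * R / v * jap x := by
      have : t ≤ 2 / v * jap x := by
        rw [div_mul_eq_mul_div, le_div_iff₀ hv]
        linarith
      refine this.trans ?_
      gcongr
      linarith
    calc 1 + t ≤ (1 + 2 * R / v) * (jap x * 1) := by nlinarith
      _ ≤ _ := by gcongr
  · have h1 : v * t / (2 * R) ≤ ramp X := by
      refine le_trans ?_ (neg_lt_ramp X).le
      rw [hX, ← neg_div, div_le_div_iff₀ (by positivity) hR0]
      nlinarith
    have hu := ramp_pos X
    have h2 : t ≤ 2 * R / v * ramp X := by
      have := mul_le_mul_of_nonneg_left h1 (by positivity : 0 ≤ 2 * R / v)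
      refine le_trans (le_of_eq ?_) this
      field_simp
    have h3 : 1 + t ≤ (1 + 2 * R / v) * hump ε X := by
      rw [hump, ← mul_div_assoc, le_div_iff₀ (one_add_pos hε X)]
      have h4 : (1 + t) * ε ≤ 1 := by
        rw [← div_eq_mul_inv, div_le_one (by linarith)]
        linarith
      have h5 : 0 < 2 * R / v := by positivity
      nlinarith
    refine h3.trans ?_
    gcongr
    nlinarith [hump_pos hε X]

end Hump

/-! ### Decay from a strict Mourre estimate -/

theorem bddMeas_hump_pow {ε R : ℝ} (hε : 0 < ε) (hε1 : ε < 1) (k : ℕ) (b : ℝ) :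
    BddMeas fun x => ((hump ε ((x - b) / R) ^ k : ℝ) : ℂ) := by
  refine ⟨?_, ε⁻¹ ^ k, fun x => ?_⟩
  · exact (Complex.continuous_ofReal.comp (((continuous_hump hε).comp
      ((continuous_id.sub continuous_const).div_const R)).pow k)).measurable
  · rw [Complex.norm_real, norm_pow, Real.norm_of_nonneg (hump_pos hε _).le]
    exact pow_le_pow_left₀ (hump_pos hε _).le (hump_le_inv hε hε1 _) k

theorem norm_fnA_le_norm_bracketPow {σ : ℝ → ℂ} (hσ : BddMeas σ) {k : ℕ} {D : ℝ}
    (h : ∀ x, ‖σ x‖ ≤ D * jap x ^ k) (f : L2) (hf : f ∈ sobolev k) :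
    ‖fnA σ f‖ ≤ D * ‖bracketPow k ⟨f, hf⟩‖ := by
  rw [norm_fnA_apply]
  have e : ‖bracketPow k ⟨f, hf⟩‖ =
      ‖mulPMap (fun ξ => ((bracketSymbol ξ ^ k : ℝ) : ℂ)) ⟨fourierL2 f, hf⟩‖ :=
    LinearIsometryEquiv.norm_map fourierL2.symm
      (mulPMap (fun ξ => ((bracketSymbol ξ ^ k : ℝ) : ℂ)) ⟨fourierL2 f, hf⟩)
  rw [e]
  refine Lp.norm_le_mul_norm_of_ae_le_mul ?_
  have hm : MemLp (fun ξ => ((bracketSymbol ξ ^ k : ℝ) : ℂ) * fourierL2 f ξ) 2 volume := hf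
  filter_upwards [coeFn_mulOp hσ.compA.memLp (fourierL2 f), hm.coeFn_toLp] with ξ h1 h2
  rw [h1]
  change _ ≤ D * ‖(hm.toLp _ : ℝ → ℂ) ξ‖
  rw [h2, norm_mul, norm_mul, Complex.norm_real, Real.norm_of_nonneg
    (show 0 ≤ bracketSymbol ξ ^ k from pow_nonneg (Real.sqrt_nonneg _) k), ← mul_assoc]
  exact mul_le_mul_of_nonneg_right (h _) (norm_nonneg _)

/-- **Decay from a Mourre estimate**, with a constant that depends only on the bounds on
commutators and on the constant in the Mourre estimate. -/
theorem exists_decay {k : ℕ} (hk : 1 ≤ k) : ∃ N : ℕ, ∀ c θ : ℝ, 0 < θ → ∃ C : ℝ, 0 < C ∧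
    ∀ H H' X G : L2 →L[ℂ] L2, IsSelfAdjoint H → IsAd H H' → Bd 1 (N + 1) H c →
      Bd 1 N H' c → Bd 1 N X c → Bd 1 N G c → X * G = G → G * H = H * G →
      (∀ η : L2, θ * ‖X η‖ ^ 2 ≤ (⟪X η, (-Complex.I • H') (X η)⟫_ℂ).re) →
      ∀ (ψ₀ : L2) (hψ₀ : ψ₀ ∈ sobolev k) (ψ : ℝ → L2), IsSolution H ψ₀ ψ → ∀ t : ℝ, 0 ≤ t →
        ‖bracketNegPow k (G (ψ t))‖ ≤ C / (1 + t) ^ k * ‖bracketPow k ⟨ψ₀, hψ₀⟩‖ := by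
  set p := 4 * (2 * k + 1) with hp
  refine ⟨2 * p + 2, fun c θ hθ => ?_⟩
  obtain ⟨δ₀, hδ₀, hδ₁, hE⟩ := exists_energy_antitone p c θ hθ
  obtain ⟨K, hK, hcomm⟩ := exists_norm_commutator_le p c
  set c' := max c 0
  have hc' : 0 ≤ c' := le_max_right _ _
  -- a length scale on which the weights vary slowly enough
  set R : ℝ := max 1 (15 * 3 ^ (2 * k + 1) * 2 / δ₀) with hRdef
  have hR1 : 1 ≤ R := le_max_left _ _
  have hR0 : 0 < R := by linarith
  have hrate0 : 0 ≤ humpRate k R := by unfold humpRate; positivity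
  have hrate : 15 * humpRate k R ≤ δ₀ := by
    have h : 15 * 3 ^ (2 * k + 1) * 2 / δ₀ ≤ R := le_max_right _ _
    rw [div_le_iff₀ hδ₀] at h
    unfold humpRate
    rw [← mul_div_assoc, ← mul_div_assoc, div_le_iff₀ hR0]
    linarith
  have hrate1 : humpRate k R ≤ 1 := by linarith
  set v := θ / 2 with hv
  have hv0 : 0 < v := by positivity
  set C₁ : ℝ := 1 + 2 * R / v with hC₁
  have hC₁0 : 0 < C₁ := by positivity
  refine ⟨C₁ ^ k * ((c' + K) * 3 ^ k + 1), by positivity, ?_⟩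
  intro H H' X G hH hHH' hHb hH'b hXb hGb hXG hGH hMou ψ₀ hψ₀ ψ hψ t ht
  set ε := (2 + t)⁻¹ with hεdef
  have hε : 0 < ε := by positivity
  have hε1 : ε < 1 := inv_lt_one_of_one_lt₀ (by linarith)
  -- the localized solution
  set φ : ℝ → L2 := fun s => G (ψ s) with hφdef
  have hφ : IsSolution H (G ψ₀) φ := by
    refine ⟨congrArg G hψ.1, fun s hs => ?_⟩
    obtain ⟨ψ', h1, h2⟩ := hψ.2 s hs
    refine ⟨G ψ', ?_, ?_⟩
    · exact (ContinuousLinearMap.restrictScalars ℝ G).hasFDerivAt.comp_hasDerivWithinAt s h1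
    · rw [← map_smul, h2, ← mul_apply_eq_comp, hGH, mul_apply_eq_comp]
  have hXφ : ∀ s, X (φ s) = φ s := fun s => by
    change X (G (ψ s)) = G (ψ s)
    rw [← mul_apply_eq_comp, hXG]
  set F : ℝ → ℝ := fun x => hump ε (x / R) ^ (2 * k) with hF
  set q : ℝ → ℝ := fun x => Real.sqrt (humpFlux k ε R x) with hq
  have hflux := fun x => humpFlux_pos hk hε hε1 hR0 x
  have hqsq : ∀ x, q x ^ 2 = humpFlux k ε R x := fun x => Real.sq_sqrt (hflux x).le
  obtain ⟨L, hL1, hL2⟩ := bddLip_humpFlux k hε hε1 hR0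
  have hflc : Continuous (humpFlux k ε R) := by
    have : LipschitzWith (Real.toNNReal L) (humpFlux k ε R) := by
      refine LipschitzWith.of_dist_le_mul fun x y => ?_
      rw [Real.dist_eq, Real.dist_eq, Real.coe_toNNReal _ ((abs_nonneg _).trans (hL1 0))]
      exact hL2 x y
    exact this.continuous
  have hqb : BddMeas fun x => (q x : ℂ) := by
    refine ⟨(Complex.continuous_ofReal.comp hflc.sqrt).measurable, Real.sqrt L, fun x => ?_⟩
    rw [Complex.norm_real, Real.norm_of_nonneg (Real.sqrt_nonneg _)]
    exact Real.sqrt_le_sqrt ((le_abs_self _).trans (hL1 x))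
  have hFb : ∀ b, BddMeas fun x => (F (x - b) : ℂ) := fun b => bddMeas_hump_pow hε hε1 (2 * k) b
  have hFb0 : BddMeas fun x => (F x : ℂ) := by simpa using hFb 0
  have hmono := hE H H' X hH hHH' hHb hH'b hXb hMou (15 * humpRate k R) L F q (by positivity) hrate
    (fun x => by
      rw [hqsq]
      exact hasDerivAt_hump_pow hk hε hR0 x)
    (fun x => Real.sqrt_pos.2 (hflux x))
    (by simpa only [hqsq] using slow_humpFlux hk hε hε1 hR0 hrate1) hFb0 hqb
    (fun x y => by
      rw [hqsq, hqsq]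
      exact hL2 x y) (G ψ₀) φ hφ hXφ t ht
  -- both sides of the energy inequality are squared norms
  have hnorm : ∀ (b : ℝ) (f : L2), (⟪f, fnA (fun x => (F (x - b) : ℂ)) f⟫_ℂ).re =
      ‖fnA (fun x => ((hump ε ((x - b) / R) ^ k : ℝ) : ℂ)) f‖ ^ 2 := by
    intro b f
    rw [← re_inner_fnA_sq (q := fun x => hump ε ((x - b) / R) ^ k) (bddMeas_hump_pow hε hε1 k b)]
    simp only [hF, ← pow_mul, mul_comm k 2]
  have h0 := hnorm 0 (G ψ₀)
  simp only [sub_zero] at h0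
  rw [hnorm, h0] at hmono
  have hle := le_of_sq_le_sq hmono (norm_nonneg _)
  set w : ℝ → ℝ := fun x => hump ε (x / R) ^ k with hw
  have hwb : BddMeas fun x => (w x : ℂ) := by
    simpa only [sub_zero] using bddMeas_hump_pow (R := R) hε hε1 k 0
  -- the weight at time `0` is dominated by the Sobolev norm
  have hGb' : Bd 1 (p + 2) G c := by
    have : ∀ j : ℕ, Bd 1 (p + 2 + j) G c → Bd 1 (p + 2) G c := by
      intro j
      induction j with
      | zero => exact id
      | succ j ih => exact fun h => ih (Bd.pred zero_le_one h)
    exact this p (by convert hGb using 1; ring)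
  have hini : ‖fnA (fun x => (w x : ℂ)) (G ψ₀)‖ ≤ (c' + K) * ‖fnA (fun x => (w x : ℂ)) ψ₀‖ := by
    have h1 := hcomm G hGb' (15 * humpRate k R) w (by positivity) (hrate.trans hδ₁)
      (slow_hump_pow k hε hε1 hR0 hrate1) hwb ψ₀
    rw [sub_apply, mul_apply_eq_comp, mul_apply_eq_comp] at h1
    have h2 : ‖G (fnA (fun x => (w x : ℂ)) ψ₀)‖ ≤ c' * ‖fnA (fun x => (w x : ℂ)) ψ₀‖ :=
      (G.le_opNorm _).trans (mul_le_mul_of_nonneg_right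
        ((hGb.norm_le zero_le_one).trans (le_max_left _ _)) (norm_nonneg _))
    have h3 := norm_le_norm_add_norm_sub' (fnA (fun x => (w x : ℂ)) (G ψ₀))
      (G (fnA (fun x => (w x : ℂ)) ψ₀))
    have h4 : K * (15 * humpRate k R) * ‖fnA (fun x => (w x : ℂ)) ψ₀‖ ≤
        K * 1 * ‖fnA (fun x => (w x : ℂ)) ψ₀‖ := by
      gcongr
      linarith
    linarith
  have hsob : ‖fnA (fun x => (w x : ℂ)) ψ₀‖ ≤ 3 ^ k * ‖bracketPow k ⟨ψ₀, hψ₀⟩‖ := by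
    refine norm_fnA_le_norm_bracketPow hwb (fun x => ?_) ψ₀ hψ₀
    rw [Complex.norm_real, Real.norm_of_nonneg (pow_nonneg (hump_pos hε _).le k), ← mul_pow]
    refine pow_le_pow_left₀ (hump_pos hε _).le ((hump_le_jap hε _).trans ?_) k
    have : jap (x / R) ≤ jap x := by
      refine Real.sqrt_le_sqrt ?_
      rw [div_pow]
      have : x ^ 2 / R ^ 2 ≤ x ^ 2 := div_le_self (sq_nonneg _) (one_le_pow₀ hR1)
      linarith
    linarith
  -- the weight at time `t` dominates `(1 + t)^k ⟨A⟩^(-k)`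
  have hfin : ‖bracketNegPow k (φ t)‖ ≤ (C₁ / (1 + t)) ^ k *
      ‖fnA (fun x => ((hump ε ((x - v * t) / R) ^ k : ℝ) : ℂ)) (φ t)‖ := by
    have e : bracketNegPow k = fnA fun x => (((jap x ^ k)⁻¹ : ℝ) : ℂ) := rfl
    rw [e]
    refine norm_fnA_apply_le_of_le ⟨?_, 1, fun x => ?_⟩ (bddMeas_hump_pow hε hε1 k (v * t)) ?_ _
    · exact (Complex.continuous_ofReal.comp ((continuous_jap.pow k).inv₀
        fun x => (pow_pos (jap_pos x) k).ne')).measurable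
    · rw [Complex.norm_real, Real.norm_of_nonneg (inv_nonneg.2 (pow_nonneg (jap_pos x).le k))]
      exact inv_le_one_of_one_le₀ (one_le_pow₀ (one_le_jap x))
    · intro x
      rw [Complex.norm_real, Real.norm_of_nonneg (inv_nonneg.2 (pow_nonneg (jap_pos x).le k)),
        Complex.norm_real, Real.norm_of_nonneg (pow_nonneg (hump_pos hε _).le k), ← mul_pow,
        ← inv_pow]
      refine pow_le_pow_left₀ (inv_nonneg.2 (jap_pos x).le) ?_ k
      have := one_add_le_jap_mul_hump hv0 hR1 ht x
      have hj := jap_pos x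
      rw [div_mul_eq_mul_div, le_div_iff₀ (by linarith), inv_mul_le_iff₀ hj]
      refine this.trans (le_of_eq ?_)
      ring
  calc ‖bracketNegPow k (G (ψ t))‖ ≤ (C₁ / (1 + t)) ^ k *
        ((c' + K) * (3 ^ k * ‖bracketPow k ⟨ψ₀, hψ₀⟩‖)) := by
        refine hfin.trans ?_
        gcongr
        exact hle.trans (hini.trans (by gcongr))
    _ = C₁ ^ k * ((c' + K) * 3 ^ k) / (1 + t) ^ k * ‖bracketPow k ⟨ψ₀, hψ₀⟩‖ := by
        rw [div_pow]
        ring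
    _ ≤ _ := by
        gcongr
        linarith

/-! ### Division of a smooth function by a vanishing factor -/

theorem hasDerivAt_hadamard {F : ℝ → ℝ} (hF : ContDiff ℝ 1 F) (k : ℕ) (z y : ℝ) :
    HasDerivAt (fun y => ∫ s in (0 : ℝ)..1, s ^ k * F (z + s * (y - z)))
      (∫ s in (0 : ℝ)..1, s ^ (k + 1) * deriv F (z + s * (y - z))) y := by
  have hF' : Continuous (deriv F) := hF.continuous_deriv le_rfl
  have hFc := hF.continuous
  obtain ⟨C, hC⟩ := (isCompact_closedBall z (|y - z| + 1)).exists_bound_of_continuousOn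
    hF'.continuousOn
  have hcont : ∀ x, Continuous fun s : ℝ => s ^ k * F (z + s * (x - z)) := fun x => by fun_prop
  have hcont' : ∀ x, Continuous fun s : ℝ => s ^ (k + 1) * deriv F (z + s * (x - z)) :=
    fun x => by fun_prop
  refine (intervalIntegral.hasDerivAt_integral_of_dominated_loc_of_deriv_le
    (F := fun (x s : ℝ) => s ^ k * F (z + s * (x - z))) (bound := fun _ => C)
    (F' := fun (x s : ℝ) => s ^ (k + 1) * deriv F (z + s * (x - z))) (Metric.ball_mem_nhds y one_pos)
    (Eventually.of_forall fun x => (hcont x).aestronglyMeasurable)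
    ((hcont y).intervalIntegrable 0 1) (hcont' y).aestronglyMeasurable
    ?_ intervalIntegrable_const ?_).2
  · refine ae_of_all _ fun s hs x hx => ?_
    rw [uIoc_of_le zero_le_one] at hs
    have hs0 : 0 ≤ s := hs.1.le
    have hx' : |x - y| < 1 := by simpa [Real.dist_eq] using hx
    have h1 : z + s * (x - z) ∈ Metric.closedBall z (|y - z| + 1) := by
      rw [Metric.mem_closedBall, Real.dist_eq, add_sub_cancel_left, abs_mul, abs_of_nonneg hs0]
      have h2 : |x - z| ≤ |y - z| + 1 := by
        have := abs_add_le (x - y) (y - z)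
        rw [sub_add_sub_cancel] at this
        linarith
      nlinarith [hs.2, abs_nonneg (x - z)]
    rw [norm_mul, norm_pow, Real.norm_of_nonneg hs0]
    have h3 := hC _ h1
    have h4 : s ^ (k + 1) ≤ 1 := pow_le_one₀ hs0 hs.2
    nlinarith [norm_nonneg (deriv F (z + s * (x - z))), pow_nonneg hs0 (k + 1)]
  · refine ae_of_all _ fun s _ x _ => ?_
    have h1 : HasDerivAt (fun x => z + s * (x - z)) s x := by
      simpa using (((hasDerivAt_id x).sub_const z).const_mul s).const_add z
    have h2 := (hF.differentiable one_ne_zero (z + s * (x - z))).hasDerivAt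
    have h3 := (HasDerivAt.comp x h2 h1).const_mul (s ^ k)
    refine h3.congr_deriv ?_
    ring

theorem contDiff_hadamard {F : ℝ → ℝ} (hF : ContDiff ℝ ∞ F) (k : ℕ) (z : ℝ) :
    ContDiff ℝ ∞ fun y => ∫ s in (0 : ℝ)..1, s ^ k * F (z + s * (y - z)) := by
  rw [contDiff_infty]
  intro n
  induction n generalizing F k with
  | zero =>
    exact contDiff_zero.2 (continuous_iff_continuousAt.2 fun y =>
      (hasDerivAt_hadamard (hF.of_le (by exact_mod_cast le_top)) k z y).continuousAt)
  | succ n ih =>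
    have hd := hasDerivAt_hadamard (hF.of_le (by exact_mod_cast le_top)) k z
    have : ((n + 1 : ℕ) : ℕ∞ω) = (n : ℕ∞ω) + 1 := by norm_cast
    rw [this, contDiff_succ_iff_deriv]
    refine ⟨fun y => (hd y).differentiableAt, by simp, ?_⟩
    rw [show deriv _ = _ from funext fun y => (hd y).deriv]
    exact ih (contDiff_infty_iff_deriv.1 hF).2 (k + 1)

/-- **Hadamard's lemma**: a smooth function that vanishes at `z` is `y - z` times a smooth
function. -/
theorem exists_contDiff_eq_sub_mul {f : ℝ → ℝ} (hf : ContDiff ℝ ∞ f) {z : ℝ} (hz : f z = 0) :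
    ∃ a : ℝ → ℝ, ContDiff ℝ ∞ a ∧ a z = deriv f z ∧ ∀ y, f y = (y - z) * a y := by
  have hf' := (contDiff_infty_iff_deriv.1 hf).2
  refine ⟨_, contDiff_hadamard hf' 0 z, by simp, fun y => ?_⟩
  have h1 : ∀ s ∈ uIcc (0 : ℝ) 1, HasDerivAt (fun s => f (z + s * (y - z)))
      (deriv f (z + s * (y - z)) * (y - z)) s := by
    intro s _
    have h2 : HasDerivAt (fun s => z + s * (y - z)) (y - z) s := by
      simpa using ((hasDerivAt_id s).mul_const (y - z)).const_add z
    exact HasDerivAt.comp s (hf.differentiable (by simp) _).hasDerivAt h2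
  have h3 := intervalIntegral.integral_eq_sub_of_hasDerivAt h1
    (Continuous.intervalIntegrable (by have := hf'.continuous; fun_prop) _ _)
  rw [intervalIntegral.integral_mul_const] at h3
  simp only [one_mul, add_sub_cancel, zero_mul, add_zero, hz, sub_zero, pow_zero] at h3 ⊢
  rw [← h3, mul_comm]

/-! ### Functions with bounded derivatives -/

/-- `f` has bounded derivatives up to order `N` (and the last one is continuous). -/
def BddDeriv : ℕ → (ℝ → ℝ) → Prop
  | 0, f => Continuous f ∧ ∃ C : ℝ, ∀ y, |f y| ≤ C
  | N + 1, f => (∃ C : ℝ, ∀ y, |f y| ≤ C) ∧ ∃ f' : ℝ → ℝ, (∀ y, HasDerivAt f (f' y) y) ∧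
      BddDeriv N f'

namespace BddDeriv

variable {N : ℕ} {f g : ℝ → ℝ}

theorem bdd (h : BddDeriv N f) : ∃ C : ℝ, ∀ y, |f y| ≤ C := by
  cases N with
  | zero => exact h.2
  | succ N => exact h.1

theorem continuous (h : BddDeriv N f) : Continuous f := by
  cases N with
  | zero => exact h.1
  | succ N =>
    obtain ⟨-, f', hf', -⟩ := h
    exact continuous_iff_continuousAt.2 fun y => (hf' y).continuousAt

theorem bddMeas (h : BddDeriv N f) : BddMeas fun y => (f y : ℂ) := by
  obtain ⟨C, hC⟩ := h.bdd
  refine ⟨(Complex.continuous_ofReal.comp h.continuous).measurable, C, fun y => ?_⟩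
  rw [Complex.norm_real]
  exact hC y

theorem pred (h : BddDeriv (N + 1) f) : BddDeriv N f := by
  induction N generalizing f with
  | zero => exact ⟨h.continuous, h.bdd⟩
  | succ N ih =>
    obtain ⟨hb, f', hf', h'⟩ := h
    exact ⟨hb, f', hf', ih h'⟩

theorem add (hf : BddDeriv N f) (hg : BddDeriv N g) : BddDeriv N fun y => f y + g y := by
  have hb : ∃ C : ℝ, ∀ y, |f y + g y| ≤ C := by
    obtain ⟨C, hC⟩ := hf.bdd
    obtain ⟨D, hD⟩ := hg.bdd
    exact ⟨C + D, fun y => (abs_add_le _ _).trans (add_le_add (hC y) (hD y))⟩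
  induction N generalizing f g with
  | zero => exact ⟨hf.1.add hg.1, hb⟩
  | succ N ih =>
    obtain ⟨-, f', hf', hf⟩ := hf
    obtain ⟨-, g', hg', hg⟩ := hg
    refine ⟨hb, _, fun y => (hf' y).add (hg' y), ih hf hg ?_⟩
    obtain ⟨C, hC⟩ := hf.bdd
    obtain ⟨D, hD⟩ := hg.bdd
    exact ⟨C + D, fun y => (abs_add_le _ _).trans (add_le_add (hC y) (hD y))⟩

theorem mul (hf : BddDeriv N f) (hg : BddDeriv N g) : BddDeriv N fun y => f y * g y := by
  have hb : ∀ {M : ℕ} {f g : ℝ → ℝ}, BddDeriv M f → BddDeriv M g →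
      ∃ C : ℝ, ∀ y, |f y * g y| ≤ C := by
    intro M f g hf hg
    obtain ⟨C, hC⟩ := hf.bdd
    obtain ⟨D, hD⟩ := hg.bdd
    refine ⟨C * D, fun y => ?_⟩
    rw [abs_mul]
    exact mul_le_mul (hC y) (hD y) (abs_nonneg _) ((abs_nonneg _).trans (hC y))
  induction N generalizing f g with
  | zero => exact ⟨hf.1.mul hg.1, hb hf hg⟩
  | succ N ih =>
    refine ⟨hb hf hg, ?_⟩
    have hf1 := hf.pred
    have hg1 := hg.pred
    obtain ⟨-, f', hf', hf⟩ := hf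
    obtain ⟨-, g', hg', hg⟩ := hg
    exact ⟨_, fun y => (hf' y).mul (hg' y), (ih hf hg1).add (ih hf1 hg)⟩

theorem neg (hf : BddDeriv N f) : BddDeriv N fun y => -f y := by
  induction N generalizing f with
  | zero =>
    obtain ⟨hc, C, hC⟩ := hf
    exact ⟨hc.neg, C, fun y => by rw [abs_neg]; exact hC y⟩
  | succ N ih =>
    obtain ⟨⟨C, hC⟩, f', hf', hf⟩ := hf
    exact ⟨⟨C, fun y => by rw [abs_neg]; exact hC y⟩, _, fun y => (hf' y).neg, ih hf⟩

theorem of_iteratedDeriv (hf : ContDiff ℝ ∞ f)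
    (h : ∀ n : ℕ, ∃ C : ℝ, ∀ y, |iteratedDeriv n f y| ≤ C) (N : ℕ) : BddDeriv N f := by
  have hb : ∀ {f : ℝ → ℝ}, (∀ n : ℕ, ∃ C : ℝ, ∀ y, |iteratedDeriv n f y| ≤ C) →
      ∃ C : ℝ, ∀ y, |f y| ≤ C := fun h => by simpa only [iteratedDeriv_zero] using h 0
  induction N generalizing f with
  | zero => exact ⟨hf.continuous, hb h⟩
  | succ N ih =>
    refine ⟨hb h, deriv f, fun y => (hf.differentiable (by simp) y).hasDerivAt,
      ih (contDiff_infty_iff_deriv.1 hf).2 fun n => ?_⟩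
    simpa only [iteratedDeriv_succ'] using h (n + 1)

theorem lipschitz (h : BddDeriv (N + 1) f) : ∃ C : ℝ, ∀ x y, |f x - f y| ≤ C * |x - y| := by
  obtain ⟨-, f', hf', h⟩ := h
  obtain ⟨C, hC⟩ := h.bdd
  exact ⟨C, fun x y => convex_univ.norm_image_sub_le_of_norm_hasDerivWithin_le
    (fun z _ => (hf' z).hasDerivWithinAt) (fun z _ => hC z) (mem_univ y) (mem_univ x)⟩

theorem isAd {f' : ℝ → ℝ} (h : BddDeriv 2 f) (hf' : ∀ y, HasDerivAt f (f' y) y) :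
    IsAd (mulOp fun y => (f y : ℂ)) (Complex.I • mulOp fun y => (f' y : ℂ)) := by
  have hf := h.bddMeas
  obtain ⟨-, g, hg, h⟩ := h
  obtain rfl : f' = g := funext fun y => (hf' y).unique (hg y)
  obtain ⟨C, hC⟩ := h.lipschitz
  have := IsAd.mulOp hf h.bddMeas (C := C) (fun y => (hf' y).ofReal_comp) fun x y => by
    rw [← Complex.ofReal_sub, Complex.norm_real]
    exact hC x y
  convert this using 1
  exact (mulOp_smul Complex.I h.bddMeas).symm

theorem bd (h : BddDeriv (N + 1) f) : ∃ c, Bd 1 N (mulOp fun y => (f y : ℂ)) c := by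
  induction N generalizing f with
  | zero => exact ⟨_, le_rfl⟩
  | succ N ih =>
    have h2 : BddDeriv 2 f := by
      have : ∀ M, BddDeriv (M + 2) f → BddDeriv 2 f := by
        intro M
        induction M with
        | zero => exact id
        | succ M ihM => exact fun h => ihM h.pred
      exact this N h
    obtain ⟨c₀, h0⟩ := ih h.pred
    obtain ⟨-, f', hf', h'⟩ := h
    obtain ⟨c₁, h1⟩ := ih h'
    exact ⟨_, _, _, _, h2.isAd hf', h0, h1.smul Complex.I, le_rfl⟩

end BddDeriv

/-! ### Regularity of the profile and of the weight -/

namespace AssumptionH1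

variable {U : ℝ → ℝ} {Um Up : ℝ}

theorem strictMono (h : AssumptionH1 U Um Up) : StrictMono U := strictMono_of_deriv_pos h.deriv_pos

theorem mem_Ioo (h : AssumptionH1 U Um Up) (y : ℝ) : U y ∈ Ioo Um Up :=
  ⟨(h.strictMono.monotone.le_of_tendsto h.tendsto_atBot (y - 1)).trans_lt
      (h.strictMono (by linarith)),
    (h.strictMono (by linarith)).trans_le
      (h.strictMono.monotone.ge_of_tendsto h.tendsto_atTop (y + 1))⟩

theorem exists_eq (h : AssumptionH1 U Um Up) {l : ℝ} (hl : l ∈ Ioo Um Up) : ∃ y, U y = l := by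
  obtain ⟨a, ha⟩ := (h.tendsto_atBot.eventually_lt_const hl.1).exists
  obtain ⟨b, hb⟩ := (h.tendsto_atTop.eventually_const_lt hl.2).exists
  obtain ⟨y, -, hy⟩ := intermediate_value_uIcc h.smooth.continuous.continuousOn
    (Icc_subset_uIcc ⟨ha.le, hb.le⟩)
  exact ⟨y, hy⟩

theorem hasDerivAt (h : AssumptionH1 U Um Up) (y : ℝ) : HasDerivAt U (deriv U y) y :=
  (h.smooth.differentiable (by simp) y).hasDerivAt

theorem contDiff_deriv (h : AssumptionH1 U Um Up) : ContDiff ℝ ∞ (deriv U) :=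
  (contDiff_infty_iff_deriv.1 h.smooth).2

theorem contDiff_deriv2 (h : AssumptionH1 U Um Up) : ContDiff ℝ ∞ (deriv (deriv U)) :=
  (contDiff_infty_iff_deriv.1 h.contDiff_deriv).2

theorem dense_ne_zero (h : AssumptionH1 U Um Up) : Dense {y | U y ≠ 0} := by
  have : {y | U y ≠ 0}ᶜ.Subsingleton := fun x hx y hy => h.strictMono.injective
    ((not_not.1 hx : U x = 0).trans (not_not.1 hy : U y = 0).symm)
  have := this.finite.countable.dense_compl ℝ
  rwa [compl_compl] at this

/-- `U''` is a multiple of `U`, with a smooth quotient: the boundedness of `U'' / U` makes `U''`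
vanish at the zero of `U`, which is simple. -/
theorem exists_ratio (h : AssumptionH1 U Um Up) :
    ∃ r : ℝ → ℝ, ContDiff ℝ ∞ r ∧ ∀ y, deriv (deriv U) y = r y * U y := by
  by_cases hz : ∃ z, U z = 0
  · obtain ⟨z, hz⟩ := hz
    have hz2 : deriv (deriv U) z = 0 := by
      have hcont : ContinuousOn (fun y => iteratedDeriv 2 U y / U y) {y | U y ≠ 0} := by
        refine ContinuousOn.div ?_ h.smooth.continuous.continuousOn fun y hy => hy
        rw [iteratedDeriv_succ, iteratedDeriv_one]
        exact h.contDiff_deriv2.continuous.continuousOn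
      obtain ⟨C, hC⟩ : ∃ C : ℝ, ∀ᵐ y, |curvatureRatio U y| ≤ C := by
        refine ⟨(eLpNorm (curvatureRatio U) (⊤ : ℝ≥0∞) volume).toReal, ?_⟩
        have h1 := ae_le_eLpNormEssSup (f := curvatureRatio U) (μ := volume)
        filter_upwards [h1] with y hy
        have h2 : eLpNorm (curvatureRatio U) (⊤ : ℝ≥0∞) volume ≠ (⊤ : ℝ≥0∞) := h.ratio_bounded.2.ne
        rw [← eLpNorm_exponent_top] at hy
        have := ENNReal.toReal_mono h2 hy
        simpa using this
      have hne : ∀ᵐ y, U y ≠ 0 := by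
        have : {y | U y ≠ 0}ᶜ.Subsingleton := fun x hx y hy => h.strictMono.injective
          ((not_not.1 hx : U x = 0).trans (not_not.1 hy : U y = 0).symm)
        exact this.measure_zero volume
      have hle : ∀ᵐ y, |deriv (deriv U) y| ≤ C * |U y| := by
        filter_upwards [hC, hne] with y h1 h2
        have h3 : curvatureRatio U y = iteratedDeriv 2 U y / U y := extendFrom_extends hcont y h2
        rw [h3, abs_div, div_le_iff₀ (abs_pos.2 h2), iteratedDeriv_succ, iteratedDeriv_one] at h1
        exact h1
      have hd := MeasureTheory.Measure.dense_of_ae hle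
      have hcl : IsClosed {y | |deriv (deriv U) y| ≤ C * |U y|} :=
        isClosed_le h.contDiff_deriv2.continuous.abs
          (continuous_const.mul h.smooth.continuous.abs)
      have hzm : z ∈ {y | |deriv (deriv U) y| ≤ C * |U y|} := by
        rw [← hcl.closure_eq, hd.closure_eq]
        trivial
      simpa [hz] using hzm
    obtain ⟨a, ha, haz, hUa⟩ := exists_contDiff_eq_sub_mul h.smooth hz
    obtain ⟨b, hb, -, hUb⟩ := exists_contDiff_eq_sub_mul h.contDiff_deriv2 hz2
    have hane : ∀ y, a y ≠ 0 := by
      intro y hy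
      rcases eq_or_ne y z with rfl | hyz
      · exact (h.deriv_pos y).ne' (haz ▸ hy)
      · refine hyz (h.strictMono.injective ?_)
        rw [hz, hUa y, hy, mul_zero]
    refine ⟨fun y => b y / a y, hb.div ha hane, fun y => ?_⟩
    rw [hUb y, hUa y]
    have := hane y
    field_simp
  · push Not at hz
    refine ⟨fun y => deriv (deriv U) y / U y, h.contDiff_deriv2.div h.smooth hz, fun y => ?_⟩
    rw [div_mul_cancel₀ _ (hz y)]

theorem curvatureRatio_eq (h : AssumptionH1 U Um Up) {r : ℝ → ℝ} (hr : ContDiff ℝ ∞ r)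
    (hU : ∀ y, deriv (deriv U) y = r y * U y) : curvatureRatio U = r := by
  funext x
  refine extendFrom_eq (h.dense_ne_zero x) ?_
  refine (hr.continuous.continuousAt.tendsto.mono_left nhdsWithin_le_nhds).congr' ?_
  filter_upwards [self_mem_nhdsWithin] with y hy
  rw [iteratedDeriv_succ, iteratedDeriv_one, hU y, mul_div_cancel_right₀ _ hy]

theorem contDiff_curvatureRatio (h : AssumptionH1 U Um Up) : ContDiff ℝ ∞ (curvatureRatio U) := by
  obtain ⟨r, hr, hU⟩ := h.exists_ratio
  rwa [h.curvatureRatio_eq hr hU]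

theorem weight_sq (h : AssumptionH1 U Um Up) (y : ℝ) : weight U y ^ 2 = -curvatureRatio U y :=
  Real.sq_sqrt (neg_nonneg.2 (h.ratio_neg y).le)

theorem weight_pos (h : AssumptionH1 U Um Up) (y : ℝ) : 0 < weight U y :=
  Real.sqrt_pos.2 (neg_pos.2 (h.ratio_neg y))

theorem deriv2_eq (h : AssumptionH1 U Um Up) (y : ℝ) :
    deriv (deriv U) y = -(weight U y ^ 2) * U y := by
  obtain ⟨r, hr, hU⟩ := h.exists_ratio
  rw [h.weight_sq, neg_neg, h.curvatureRatio_eq hr hU, hU]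

theorem contDiff_weight (h : AssumptionH1 U Um Up) : ContDiff ℝ ∞ (weight U) :=
  h.contDiff_curvatureRatio.neg.sqrt fun y => (neg_pos.2 (h.ratio_neg y)).ne'

theorem bddDeriv_weight (h : AssumptionH1 U Um Up) (h2 : AssumptionH2 U Um Up) (N : ℕ) :
    BddDeriv N (weight U) := by
  obtain ⟨C, hC⟩ : ∃ C : ℝ, ∀ y, weight U y ≤ C := by
    obtain ⟨t, ht, hts⟩ := mem_cocompact.1 (h2.tendsto_zero.eventually_lt_const one_pos)
    obtain ⟨D, hD⟩ := ht.exists_bound_of_continuousOn h.contDiff_weight.continuous.continuousOn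
    refine ⟨max D 1, fun y => ?_⟩
    by_cases hy : y ∈ t
    · exact ((le_abs_self _).trans (hD y hy)).trans (le_max_left _ _)
    · exact (hts hy : weight U y < 1).le.trans (le_max_right _ _)
  refine BddDeriv.of_iteratedDeriv h.contDiff_weight (fun n => ?_) N
  obtain ⟨D, hD, hD'⟩ := h2.iteratedDeriv_le n
  exact ⟨D * C, fun y => (hD' y).trans (mul_le_mul_of_nonneg_left (hC y) hD.le)⟩

theorem bddDeriv_profile (h : AssumptionH1 U Um Up) (h2 : AssumptionH2 U Um Up) (N : ℕ) :
    BddDeriv N U ∧ BddDeriv N (deriv U) := by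
  have hUb : ∃ C : ℝ, ∀ y, |U y| ≤ C :=
    ⟨max |Um| |Up|, fun y => abs_le_max_abs_abs (h.mem_Ioo y).1.le (h.mem_Ioo y).2.le⟩
  have hw := h.bddDeriv_weight h2
  have hd2 : ∀ M, BddDeriv M U → BddDeriv M (deriv (deriv U)) := by
    intro M hM
    have e : deriv (deriv U) = fun y => -(weight U y * weight U y) * U y := by
      funext y
      rw [h.deriv2_eq, sq]
    rw [e]
    exact (((hw M).mul (hw M)).neg).mul hM
  have h' : ∀ y, HasDerivAt (deriv U) (deriv (deriv U) y) y := fun y =>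
    (h.contDiff_deriv.differentiable (by simp) y).hasDerivAt
  have h0 : BddDeriv 0 U := ⟨h.smooth.continuous, hUb⟩
  have hU'b : ∃ C : ℝ, ∀ y, |deriv U y| ≤ C := by
    obtain ⟨C, hC⟩ := hUb
    obtain ⟨D, hD⟩ := (hd2 0 h0).bdd
    refine ⟨2 * C + D, fun y => ?_⟩
    obtain ⟨x, hx, hx'⟩ := exists_deriv_eq_slope U (lt_add_one y) h.smooth.continuous.continuousOn
      (fun z _ => (h.hasDerivAt z).differentiableAt.differentiableWithinAt)
    rw [add_sub_cancel_left, div_one] at hx'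
    have h3 : |deriv U y - deriv U x| ≤ D * |y - x| :=
      convex_univ.norm_image_sub_le_of_norm_hasDerivWithin_le
        (fun z _ => (h' z).hasDerivWithinAt) (fun z _ => hD z) (mem_univ x) (mem_univ y)
    have h4 : |y - x| ≤ 1 := abs_le.2 ⟨by linarith [hx.2], by linarith [hx.1]⟩
    have hD0 : 0 ≤ D := (abs_nonneg _).trans (hD 0)
    have h5 := abs_sub (U (y + 1)) (U y)
    rw [← hx'] at h5
    have h6 := abs_sub_abs_le_abs_sub (deriv U y) (deriv U x)
    nlinarith [hC y, hC (y + 1)]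
  induction N with
  | zero => exact ⟨h0, h.contDiff_deriv.continuous, hU'b⟩
  | succ N ih => exact ⟨⟨hUb, _, h.hasDerivAt, ih.2⟩, hU'b, _, h', hd2 N ih.1⟩

end AssumptionH1

/-! ### The Birman-Schwinger operators `m (E - ∂_y²)⁻¹ m` -/

/-- The resolvent `(E - ∂_y²)⁻¹ = (E + A²)⁻¹`, for `E > 0`. -/
def freeRes (E : ℝ) : L2 →L[ℂ] L2 := fnA fun x => (((x ^ 2 + E)⁻¹ : ℝ) : ℂ)

/-- The operator `(E - ∂_y²)^(-1/2)`, for `E > 0`. -/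
def sqrtFreeRes (E : ℝ) : L2 →L[ℂ] L2 := fnA fun x => (Real.sqrt (x ^ 2 + E)⁻¹ : ℂ)

theorem bddMeas_freeRes {E : ℝ} (hE : 0 < E) : BddMeas fun x => (((x ^ 2 + E)⁻¹ : ℝ) : ℂ) := by
  refine ⟨?_, E⁻¹, fun x => ?_⟩
  · exact Complex.measurable_ofReal.comp ((by fun_prop : Measurable fun x : ℝ => x ^ 2 + E).inv)
  · rw [Complex.norm_real, Real.norm_of_nonneg (by positivity)]
    exact inv_anti₀ hE (by nlinarith [sq_nonneg x])

theorem bddMeas_sqrtFreeRes {E : ℝ} (hE : 0 < E) :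
    BddMeas fun x => (Real.sqrt (x ^ 2 + E)⁻¹ : ℂ) := by
  refine ⟨?_, Real.sqrt E⁻¹, fun x => ?_⟩
  · exact Complex.measurable_ofReal.comp
      ((by fun_prop : Measurable fun x : ℝ => x ^ 2 + E).inv.sqrt)
  · rw [Complex.norm_real, Real.norm_of_nonneg (Real.sqrt_nonneg _)]
    exact Real.sqrt_le_sqrt (inv_anti₀ hE (by nlinarith [sq_nonneg x]))

theorem sqrtFreeRes_mul_self {E : ℝ} (hE : 0 < E) :
    sqrtFreeRes E * sqrtFreeRes E = freeRes E := by
  rw [sqrtFreeRes, ← fnA_mul (bddMeas_sqrtFreeRes hE) (bddMeas_sqrtFreeRes hE), freeRes]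
  congr 1
  funext x
  rw [← Complex.ofReal_mul, Real.mul_self_sqrt (by positivity)]

theorem isSelfAdjoint_sqrtFreeRes {E : ℝ} (hE : 0 < E) : IsSelfAdjoint (sqrtFreeRes E) := by
  rw [IsSelfAdjoint, sqrtFreeRes, fnA_star (bddMeas_sqrtFreeRes hE)]
  simp only [Complex.conj_ofReal]

theorem norm_freeRes_le {E : ℝ} (hE : 0 < E) : ‖freeRes E‖ ≤ E⁻¹ := by
  refine norm_fnA_le (by positivity) fun x => ?_
  rw [Complex.norm_real, Real.norm_of_nonneg (by positivity)]
  exact inv_anti₀ hE (by nlinarith [sq_nonneg x])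

theorem norm_freeRes_sub_le {E F : ℝ} (hE : 1 ≤ E) (hF : 1 ≤ F) :
    ‖freeRes E - freeRes F‖ ≤ |E - F| := by
  have hE0 : 0 < E := by linarith
  have hF0 : 0 < F := by linarith
  rw [freeRes, freeRes, ← fnA_sub (bddMeas_freeRes hE0) (bddMeas_freeRes hF0)]
  refine norm_fnA_le (abs_nonneg _) fun x => ?_
  have h1 : 1 ≤ x ^ 2 + E := by nlinarith [sq_nonneg x]
  have h2 : 1 ≤ x ^ 2 + F := by nlinarith [sq_nonneg x]
  have h3 : 0 < x ^ 2 + E := by linarith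
  have h4 : 0 < x ^ 2 + F := by linarith
  have e : (x ^ 2 + E)⁻¹ - (x ^ 2 + F)⁻¹ = (F - E) * ((x ^ 2 + E)⁻¹ * (x ^ 2 + F)⁻¹) := by
    field_simp
    ring
  rw [← Complex.ofReal_sub, Complex.norm_real, e, norm_mul, Real.norm_eq_abs, abs_sub_comm,
    Real.norm_of_nonneg (by positivity)]
  refine mul_le_of_le_one_right (abs_nonneg _) ?_
  exact mul_le_one₀ (inv_le_one_of_one_le₀ h1) (by positivity) (inv_le_one_of_one_le₀ h2)

theorem mem_domain_fourierPMap {σ : ℝ → ℂ} {f g : L2}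
    (h : (fun ξ => σ ξ * fourierL2 f ξ) =ᵐ[volume] g) : f ∈ (fourierPMap σ).domain :=
  (Lp.memLp g).ae_eq h.symm

theorem coeFn_fourierPMap (σ : ℝ → ℂ) (u : (fourierPMap σ).domain) :
    fourierL2 (fourierPMap σ u) =ᵐ[volume] fun ξ => σ ξ * fourierL2 (u : L2) ξ := by
  have h : fourierL2 (fourierPMap σ u) = mulPMap σ ⟨fourierL2 (u : L2), u.2⟩ :=
    LinearIsometryEquiv.apply_symm_apply _ _
  rw [h]
  exact MemLp.coeFn_toLp (f := fun ξ => σ ξ * fourierL2 (u : L2) ξ) u.2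

theorem coeFn_freeRes {E : ℝ} (hE : 0 < E) (f : L2) : fourierL2 (freeRes E f) =ᵐ[volume]
    fun ξ => (((((2 * Real.pi * ξ) ^ 2 + E)⁻¹ : ℝ) : ℂ)) * fourierL2 f ξ := by
  rw [freeRes, fnA, fourierMul_apply, LinearIsometryEquiv.apply_symm_apply]
  simpa only [neg_sq] using coeFn_mulOp (bddMeas_freeRes hE).compA.memLp (fourierL2 f)

/-- The symbol of `-∂_y²`. -/
def laplaceSymbol (ξ : ℝ) : ℂ := (((2 * Real.pi * ξ) ^ 2 : ℝ) : ℂ)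

theorem freeRes_mem_domain {E : ℝ} (hE : 0 < E) (f : L2) :
    ∃ h : freeRes E f ∈ (fourierPMap laplaceSymbol).domain,
      fourierPMap laplaceSymbol ⟨freeRes E f, h⟩ = f - (E : ℂ) • freeRes E f := by
  have e2 : (fun ξ => laplaceSymbol ξ * fourierL2 (freeRes E f) ξ) =ᵐ[volume]
      (fourierL2 (f - (E : ℂ) • freeRes E f) : L2) := by
    rw [map_sub, map_smul]
    filter_upwards [Lp.coeFn_sub (fourierL2 f) ((E : ℂ) • fourierL2 (freeRes E f)),
      Lp.coeFn_smul (E : ℂ) (fourierL2 (freeRes E f)), coeFn_freeRes hE f] with ξ h1 h2 h3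
    rw [h1, Pi.sub_apply, h2, Pi.smul_apply, h3, smul_eq_mul, ← mul_assoc, ← mul_assoc,
      eq_sub_iff_add_eq, ← add_mul, ← add_mul, laplaceSymbol, ← Complex.ofReal_add,
      ← Complex.ofReal_mul, mul_inv_cancel₀ (by positivity), Complex.ofReal_one, one_mul]
  refine ⟨mem_domain_fourierPMap e2, fourierL2.injective (Lp.ext ?_)⟩
  exact (coeFn_fourierPMap _ _).trans e2

theorem freeRes_apply_add {E : ℝ} (hE : 0 < E) (u : (fourierPMap laplaceSymbol).domain) :
    freeRes E (fourierPMap laplaceSymbol u + (E : ℂ) • (u : L2)) = u := by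
  refine fourierL2.injective (Lp.ext ?_)
  refine (coeFn_freeRes hE _).trans ?_
  rw [map_add, map_smul]
  filter_upwards [coeFn_fourierPMap _ u,
    Lp.coeFn_add (fourierL2 (fourierPMap laplaceSymbol u)) ((E : ℂ) • fourierL2 (u : L2)),
    Lp.coeFn_smul (E : ℂ) (fourierL2 (u : L2))] with ξ h2 h3 h4
  rw [h3, Pi.add_apply, h2, h4, Pi.smul_apply, smul_eq_mul, ← add_mul, ← mul_assoc, laplaceSymbol,
    ← Complex.ofReal_add, ← Complex.ofReal_mul, inv_mul_cancel₀ (by positivity),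
    Complex.ofReal_one, one_mul]

/-- Multiplication by `m`. -/
def weightOp (U : ℝ → ℝ) : L2 →L[ℂ] L2 := mulOp fun y => (weight U y : ℂ)

/-- The Birman-Schwinger operator `m (E - ∂_y²)⁻¹ m`. -/
def birman (U : ℝ → ℝ) (E : ℝ) : L2 →L[ℂ] L2 := weightOp U * freeRes E * weightOp U

variable {U : ℝ → ℝ} {Um Up : ℝ}

theorem AssumptionH1.bddMeas_weight (h1 : AssumptionH1 U Um Up) (h2 : AssumptionH2 U Um Up) :
    BddMeas fun y => (weight U y : ℂ) := (h1.bddDeriv_weight h2 0).bddMeas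

theorem isSelfAdjoint_weightOp (h1 : AssumptionH1 U Um Up) (h2 : AssumptionH2 U Um Up) :
    IsSelfAdjoint (weightOp U) :=
  isSelfAdjoint_mulOp (h1.bddMeas_weight h2) fun _ => Complex.conj_ofReal _

theorem birman_eq (h1 : AssumptionH1 U Um Up) (h2 : AssumptionH2 U Um Up) {E : ℝ} (hE : 0 < E) :
    birman U E = star (sqrtFreeRes E * weightOp U) * (sqrtFreeRes E * weightOp U) := by
  rw [star_mul, (isSelfAdjoint_weightOp h1 h2).star_eq, (isSelfAdjoint_sqrtFreeRes hE).star_eq,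
    birman, ← sqrtFreeRes_mul_self hE]
  simp only [mul_assoc]

theorem birman_nonneg (h1 : AssumptionH1 U Um Up) (h2 : AssumptionH2 U Um Up) {E : ℝ}
    (hE : 0 < E) : 0 ≤ birman U E := by
  rw [birman_eq h1 h2 hE]
  exact star_mul_self_nonneg _

theorem norm_birman_eq (h1 : AssumptionH1 U Um Up) (h2 : AssumptionH2 U Um Up) {E : ℝ}
    (hE : 0 < E) : ‖birman U E‖ = ‖sqrtFreeRes E * weightOp U‖ * ‖sqrtFreeRes E * weightOp U‖ := by
  rw [birman_eq h1 h2 hE]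
  exact ContinuousLinearMap.norm_adjoint_comp_self _

theorem norm_birman_le_of_le (h1 : AssumptionH1 U Um Up) (h2 : AssumptionH2 U Um Up) {E F : ℝ}
    (hE : 0 < E) (hEF : E ≤ F) : ‖birman U F‖ ≤ ‖birman U E‖ := by
  have hF : 0 < F := hE.trans_le hEF
  rw [norm_birman_eq h1 h2 hE, norm_birman_eq h1 h2 hF]
  have : ‖sqrtFreeRes F * weightOp U‖ ≤ ‖sqrtFreeRes E * weightOp U‖ := by
    refine ContinuousLinearMap.opNorm_le_bound _ (norm_nonneg _) fun f => ?_
    refine le_trans ?_ ((sqrtFreeRes E * weightOp U).le_opNorm f)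
    rw [mul_apply_eq_comp, mul_apply_eq_comp]
    refine (norm_fnA_apply_le_of_le (C := 1) (bddMeas_sqrtFreeRes hF) (bddMeas_sqrtFreeRes hE)
      (fun x => ?_) (weightOp U f)).trans (one_mul _).le
    rw [one_mul, Complex.norm_real, Complex.norm_real, Real.norm_of_nonneg (Real.sqrt_nonneg _),
      Real.norm_of_nonneg (Real.sqrt_nonneg _)]
    refine Real.sqrt_le_sqrt (inv_anti₀ (by positivity) (by linarith))
  exact mul_le_mul this this (norm_nonneg _) (norm_nonneg _)

theorem norm_birman_sub_le (U : ℝ → ℝ) {E F : ℝ} (hE : 1 ≤ E) (hF : 1 ≤ F) :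
    ‖birman U E - birman U F‖ ≤ ‖weightOp U‖ ^ 2 * |E - F| := by
  have e : birman U E - birman U F = weightOp U * (freeRes E - freeRes F) * weightOp U := by
    unfold birman
    noncomm_ring
  rw [e]
  calc _ ≤ ‖weightOp U‖ * ‖freeRes E - freeRes F‖ * ‖weightOp U‖ :=
        (norm_mul_le _ _).trans (mul_le_mul_of_nonneg_right (norm_mul_le _ _) (norm_nonneg _))
    _ ≤ ‖weightOp U‖ * |E - F| * ‖weightOp U‖ := by
        gcongr
        exact norm_freeRes_sub_le hE hF
    _ = _ := by ring

theorem norm_birman_le (U : ℝ → ℝ) {E : ℝ} (hE : 0 < E) :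
    ‖birman U E‖ ≤ ‖weightOp U‖ ^ 2 * E⁻¹ := by
  calc _ ≤ ‖weightOp U‖ * ‖freeRes E‖ * ‖weightOp U‖ :=
        (norm_mul_le _ _).trans (mul_le_mul_of_nonneg_right (norm_mul_le _ _) (norm_nonneg _))
    _ ≤ ‖weightOp U‖ * E⁻¹ * ‖weightOp U‖ := by
        gcongr
        exact norm_freeRes_le hE
    _ = _ := by ring

/-- The Birman-Schwinger principle: if `-E` is in the resolvent set of `-∂_y² - m²`, then
`1 - m (E - ∂_y²)⁻¹ m` is invertible. -/
theorem isUnit_one_sub_birman (h1 : AssumptionH1 U Um Up) (h2 : AssumptionH2 U Um Up) {E : ℝ}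
    (hE : 0 < E) (h : ((-E : ℝ) : ℂ) ∈ unboundedResolventSet (schrodinger U)) :
    IsUnit (1 - birman U E) := by
  obtain ⟨R, hR1, hR2⟩ := h
  have hW := h1.bddMeas_weight h2
  set W := weightOp U with hWdef
  set G := freeRes E with hG
  have hWW : (mulOp fun y => ((weight U y ^ 2 : ℝ) : ℂ)) = W * W := by
    rw [hWdef, weightOp, ← mulOp_mul hW hW]
    congr 1
    funext y
    push_cast
    ring
  have happly : ∀ u : (schrodinger U).domain, schrodinger U u =
      -(W (W (u : L2))) + fourierPMap laplaceSymbol u := by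
    intro u
    rw [← mul_apply_eq_comp, ← hWW]
    rfl
  -- the two resolvent identities
  have e1 : R = G + G * (W * W) * R := by
    ext1 f
    obtain ⟨hd, hf⟩ : ∃ hd : R f ∈ (fourierPMap laplaceSymbol).domain, -(W (W (R f))) +
        fourierPMap laplaceSymbol ⟨R f, hd⟩ - ((-E : ℝ) : ℂ) • R f = f := by
      obtain ⟨hd, hf⟩ := hR1 f
      rw [happly] at hf
      exact ⟨hd, hf⟩
    have h3 := freeRes_apply_add hE ⟨R f, hd⟩
    generalize fourierPMap laplaceSymbol ⟨R f, hd⟩ = v at hf h3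
    have h4 : v + (E : ℂ) • (R f) = f + W (W (R f)) := by
      rw [← sub_eq_zero] at hf ⊢
      rw [← hf]
      push_cast
      module
    change G (v + (E : ℂ) • (R f)) = R f at h3
    rw [h4, map_add] at h3
    exact h3.symm
  have e2 : R = G + R * (W * W) * G := by
    ext1 f
    obtain ⟨hd, hf⟩ := freeRes_mem_domain hE f
    have h3 := hR2 ⟨G f, hd⟩
    rw [happly] at h3
    change R (-(W (W (G f))) + fourierPMap laplaceSymbol ⟨freeRes E f, hd⟩ -
      ((-E : ℝ) : ℂ) • G f) = G f at h3
    rw [hf] at h3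
    have h4 : -(W (W (G f))) + (f - (E : ℂ) • G f) - ((-E : ℝ) : ℂ) • G f = f - W (W (G f)) := by
      push_cast
      module
    have h5 : R (f - W (W (G f))) = G f := (congrArg R h4).symm.trans h3
    rw [map_sub, sub_eq_iff_eq_add] at h5
    exact h5
  have h3 : (1 - birman U E) * (1 + W * R * W) = 1 := by
    have : (1 - birman U E) * (1 + W * R * W) =
        1 + W * (R - (G + G * (W * W) * R)) * W := by
      unfold birman
      rw [← hWdef, ← hG]
      noncomm_ring
    rw [this, ← e1]
    simp
  have h4 : (1 + W * R * W) * (1 - birman U E) = 1 := by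
    have : (1 + W * R * W) * (1 - birman U E) =
        1 + W * (R - (G + R * (W * W) * G)) * W := by
      unfold birman
      rw [← hWdef, ← hG]
      noncomm_ring
    rw [this, ← e2]
    simp
  exact ⟨⟨_, _, h3, h4⟩, rfl⟩

/-- Assumption (H3) means that `m (1 - ∂_y²)⁻¹ m` has norm less than one: the norm of
`m (E - ∂_y²)⁻¹ m`, which belongs to its spectrum, tends to `0` as `E → ∞`, and it cannot take the
value `1` for any `E ≥ 1`. -/
theorem norm_birman_one_lt (h1 : AssumptionH1 U Um Up) (h2 : AssumptionH2 U Um Up)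
    (h3 : AssumptionH3 U) : ‖birman U 1‖ < 1 := by
  by_contra! hge
  have hcont : ContinuousOn (fun E => ‖birman U E‖) (Ici 1) := by
    refine ContinuousOn.norm ?_
    have : LipschitzOnWith (Real.toNNReal (‖weightOp U‖ ^ 2)) (birman U) (Ici 1) := by
      refine LipschitzOnWith.of_dist_le_mul fun E hE F hF => ?_
      rw [dist_eq_norm, Real.dist_eq, Real.coe_toNNReal _ (sq_nonneg _)]
      exact norm_birman_sub_le U hE hF
    exact this.continuousOn
  set E₁ := ‖weightOp U‖ ^ 2 + 1
  have hE₁ : 1 ≤ E₁ := by nlinarith [sq_nonneg ‖weightOp U‖]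
  have hle : ‖birman U E₁‖ ≤ 1 := by
    refine (norm_birman_le U (by linarith)).trans ?_
    rw [← div_eq_mul_inv, div_le_one (by linarith)]
    linarith
  obtain ⟨E, hE, hE1⟩ : ∃ E ∈ Icc 1 E₁, ‖birman U E‖ = 1 :=
    intermediate_value_Icc' hE₁ (hcont.mono Icc_subset_Ici_self) ⟨hle, hge⟩
  have hE0 : 0 < E := by linarith [hE.1]
  have hspec := CStarAlgebra.norm_mem_spectrum_of_nonneg (birman_nonneg h1 h2 hE0)
  rw [hE1, spectrum.mem_iff, map_one] at hspec
  refine hspec (isUnit_one_sub_birman h1 h2 hE0 ?_)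
  obtain ⟨lam0, hlam, hlt⟩ := h3
  by_contra hmem
  have := hlam.1 (show -E ∈ {lam : ℝ | (lam : ℂ) ∈ unboundedSpectrum (schrodinger U)} from hmem)
  linarith [hE.1]

theorem one_le_sq_cast {α : ℤ} (hα : α ≠ 0) : 1 ≤ (α : ℝ) ^ 2 := by
  have : 0 < α ^ 2 := by positivity
  exact_mod_cast this

theorem invLaplacian_eq {α : ℤ} (hα : α ≠ 0) : invLaplacian α = -freeRes ((α : ℝ) ^ 2) := by
  have h := one_le_sq_cast hα
  rw [freeRes, ← fnA_neg (bddMeas_freeRes (by linarith)), fnA, invLaplacian]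
  congr 1
  funext ξ
  push_cast
  rw [neg_sq]

theorem sigmaOp_eq {α : ℤ} (hα : α ≠ 0) : sigmaOp U α = 1 - birman U ((α : ℝ) ^ 2) := by
  rw [sigmaOp, invLaplacian_eq hα, birman, weightOp]
  noncomm_ring

/-! ### Compact perturbations -/

/-- Weak convergence to zero of a bounded sequence. -/
def WeakNull (f : ℕ → L2) : Prop :=
  (∃ C : ℝ, ∀ n, ‖f n‖ ≤ C) ∧ ∀ g : L2, Tendsto (fun n => ⟪g, f n⟫_ℂ) atTop (𝓝 0)

/-- `T` maps bounded sequences that converge weakly to zero to sequences that converge to zero in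
norm. On a Hilbert space, this is compactness. -/
def CompletelyCont (T : L2 →L[ℂ] L2) : Prop :=
  ∀ f : ℕ → L2, WeakNull f → Tendsto (fun n => T (f n)) atTop (𝓝 0)

theorem WeakNull.map {f : ℕ → L2} (hf : WeakNull f) (T : L2 →L[ℂ] L2) :
    WeakNull fun n => T (f n) := by
  obtain ⟨⟨C, hC⟩, h⟩ := hf
  refine ⟨⟨‖T‖ * C, fun n => (T.le_opNorm _).trans
    (mul_le_mul_of_nonneg_left (hC n) (norm_nonneg _))⟩, fun g => ?_⟩
  simpa only [ContinuousLinearMap.adjoint_inner_left] using h (ContinuousLinearMap.adjoint T g)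

namespace CompletelyCont

variable {T S : L2 →L[ℂ] L2}

theorem add (hT : CompletelyCont T) (hS : CompletelyCont S) : CompletelyCont (T + S) :=
  fun f hf => by simpa using (hT f hf).add (hS f hf)

theorem mul_left (hT : CompletelyCont T) (B : L2 →L[ℂ] L2) : CompletelyCont (B * T) :=
  fun f hf => by simpa [Function.comp_def] using (B.continuous.tendsto 0).comp (hT f hf)

theorem mul_right (hT : CompletelyCont T) (B : L2 →L[ℂ] L2) : CompletelyCont (T * B) :=
  fun _ hf => hT _ (hf.map B)

theorem smul (hT : CompletelyCont T) (c : ℂ) : CompletelyCont (c • T) :=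
  fun f hf => by simpa using (hT f hf).const_smul c

end CompletelyCont

/-- A family of operators indexed by the wave number is negligible if its members are compact,
and of size `O(α⁻²)`. -/
def Negligible (T : ℤ → L2 →L[ℂ] L2) : Prop :=
  ∃ C : ℝ, ∀ α : ℤ, α ≠ 0 → CompletelyCont (T α) ∧ ‖T α‖ ≤ C / (α : ℝ) ^ 2

namespace Negligible

variable {T S B : ℤ → L2 →L[ℂ] L2}

theorem add (hT : Negligible T) (hS : Negligible S) : Negligible fun α => T α + S α := by
  obtain ⟨C, hC⟩ := hT
  obtain ⟨D, hD⟩ := hS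
  refine ⟨C + D, fun α hα => ⟨(hC α hα).1.add (hD α hα).1, ?_⟩⟩
  rw [add_div]
  exact (norm_add_le _ _).trans (add_le_add (hC α hα).2 (hD α hα).2)

theorem mul_left (hT : Negligible T) {b : ℝ} (hB : ∀ α : ℤ, α ≠ 0 → ‖B α‖ ≤ b) :
    Negligible fun α => B α * T α := by
  obtain ⟨C, hC⟩ := hT
  refine ⟨b * C, fun α hα => ⟨(hC α hα).1.mul_left _, ?_⟩⟩
  rw [mul_div_assoc]
  exact (norm_mul_le _ _).trans (mul_le_mul (hB α hα) (hC α hα).2 (norm_nonneg _)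
    ((norm_nonneg _).trans (hB α hα)))

theorem mul_right (hT : Negligible T) {b : ℝ} (hB : ∀ α : ℤ, α ≠ 0 → ‖B α‖ ≤ b) :
    Negligible fun α => T α * B α := by
  obtain ⟨C, hC⟩ := hT
  refine ⟨C * b, fun α hα => ⟨(hC α hα).1.mul_right _, ?_⟩⟩
  rw [mul_div_right_comm]
  exact (norm_mul_le _ _).trans (mul_le_mul (hC α hα).2 (hB α hα) (norm_nonneg _)
    ((norm_nonneg _).trans (hC α hα).2))

theorem smul (hT : Negligible T) (c : ℂ) : Negligible fun α => c • T α := by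
  obtain ⟨C, hC⟩ := hT
  refine ⟨‖c‖ * C, fun α hα => ⟨(hC α hα).1.smul c, ?_⟩⟩
  rw [norm_smul, mul_div_assoc]
  exact mul_le_mul_of_nonneg_left (hC α hα).2 (norm_nonneg _)

theorem congr (hT : Negligible T) (h : ∀ α : ℤ, α ≠ 0 → S α = T α) : Negligible S := by
  obtain ⟨C, hC⟩ := hT
  exact ⟨C, fun α hα => by rw [h α hα]; exact hC α hα⟩

end Negligible

theorem memLp_resolventSymbol {E : ℝ} (hE : 1 ≤ E) :
    MemLp (fun ξ : ℝ => (((((2 * Real.pi * ξ) ^ 2 + E)⁻¹ : ℝ) : ℂ))) 2 volume := by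
  have hm : Measurable fun ξ : ℝ => (((((2 * Real.pi * ξ) ^ 2 + E)⁻¹ : ℝ) : ℂ)) :=
    Complex.measurable_ofReal.comp
      ((by fun_prop : Measurable fun ξ : ℝ => (2 * Real.pi * ξ) ^ 2 + E).inv)
  rw [memLp_two_iff_integrable_sq_norm hm.aestronglyMeasurable]
  refine integrable_inv_one_add_sq.mono' (hm.norm.pow_const 2).aestronglyMeasurable
    (ae_of_all _ fun ξ => ?_)
  have hpi := Real.pi_gt_three
  have h1 : 1 + ξ ^ 2 ≤ (2 * Real.pi * ξ) ^ 2 + E := by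
    have : 1 ≤ (2 * Real.pi) ^ 2 := by nlinarith
    rw [mul_pow]
    nlinarith [sq_nonneg ξ]
  rw [Complex.norm_real, Real.norm_of_nonneg (sq_nonneg _), Real.norm_of_nonneg (by positivity)]
  calc (((2 * Real.pi * ξ) ^ 2 + E)⁻¹) ^ 2 ≤ ((1 + ξ ^ 2)⁻¹) ^ 2 := by gcongr
    _ ≤ (1 + ξ ^ 2)⁻¹ := by
      rw [sq]
      exact mul_le_of_le_one_left (by positivity)
        (inv_le_one_of_one_le₀ (by nlinarith [sq_nonneg ξ]))

/-- The resolvent `(E - ∂_y²)⁻¹` maps `L²` to continuous functions, boundedly. -/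
theorem exists_resolvent_kernel {E : ℝ} (hE : 1 ≤ E) : ∃ (κ : ℝ → L2) (C : ℝ), (∀ y, ‖κ y‖ ≤ C) ∧
    ∀ f : L2, freeRes E f =ᵐ[volume] fun y => ⟪κ y, f⟫_ℂ := by
  have hs := memLp_resolventSymbol hE
  set s : ℝ → ℂ := fun ξ : ℝ => (((((2 * Real.pi * ξ) ^ 2 + E)⁻¹ : ℝ) : ℂ)) with hsdef
  have hsb : BddMeas s := by
    have := (bddMeas_freeRes (by linarith : 0 < E)).compA
    simpa only [neg_sq] using this
  have hcb : ∀ y : ℝ, BddMeas fun ξ : ℝ => Complex.exp (((-(2 * Real.pi * ξ * y) : ℝ) : ℂ) *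
      Complex.I) := fun y =>
    ⟨by fun_prop, 1, fun ξ => (Complex.norm_exp_ofReal_mul_I _).le⟩
  refine ⟨fun y => fourierL2.symm (mulOp (fun ξ : ℝ => Complex.exp (((-(2 * Real.pi * ξ * y) : ℝ) :
    ℂ) * Complex.I)) hs.toLp), ‖hs.toLp‖, fun y => ?_, fun f => ?_⟩
  · rw [LinearIsometryEquiv.norm_map]
    refine ((mulOp _).le_opNorm _).trans (mul_le_of_le_one_left (norm_nonneg _) ?_)
    exact norm_mulOp_le zero_le_one fun ξ => (Complex.norm_exp_ofReal_mul_I _).le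
  · have e1 : freeRes E f = fourierL2.symm (mulOp s (fourierL2 f)) := by
      rw [freeRes, fnA, fourierMul_apply]
      simp only [neg_sq, hsdef]
    have hae := coeFn_mulOp hsb.memLp (fourierL2 f)
    have hint : Integrable (mulOp s (fourierL2 f)) := by
      refine Integrable.congr ?_ hae.symm
      exact MemLp.integrable_mul hs (Lp.memLp (fourierL2 f))
    rw [e1]
    refine (fourierL2_symm_ae_eq hint).trans (Eventually.of_forall fun y => ?_)
    have e2 : ⟪fourierL2.symm (mulOp (fun ξ : ℝ => Complex.exp (((-(2 * Real.pi * ξ * y) : ℝ) :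
        ℂ) * Complex.I)) hs.toLp), f⟫_ℂ = ⟪mulOp (fun ξ : ℝ => Complex.exp
        (((-(2 * Real.pi * ξ * y) : ℝ) : ℂ) * Complex.I)) hs.toLp, fourierL2 f⟫_ℂ := by
      rw [← LinearIsometryEquiv.inner_map_map fourierL2, LinearIsometryEquiv.apply_symm_apply]
    simp only
    rw [e2, L2.inner_def, Real.fourierInv_eq']
    refine integral_congr_ae ?_
    filter_upwards [hae, coeFn_mulOp (hcb y).memLp hs.toLp, hs.coeFn_toLp] with ξ h1 h2 h3
    rw [h1, h2, h3, RCLike.inner_apply (𝕜 := ℂ), map_mul, ← Complex.exp_conj, map_mul, Complex.conj_I,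
      Complex.conj_ofReal, hsdef, Complex.conj_ofReal, smul_eq_mul]
    have : (((2 * Real.pi * inner ℝ ξ y : ℝ) : ℂ)) * Complex.I =
        ((-(2 * Real.pi * ξ * y) : ℝ) : ℂ) * -Complex.I := by
      rw [show inner ℝ ξ y = ξ * y by simp [mul_comm]]
      push_cast
      ring
    rw [this]
    ring

/-- If `a` is square integrable, then `a (E - ∂_y²)⁻¹` is a Hilbert-Schmidt operator; complete
continuity follows by dominated convergence in its kernel. -/
theorem completelyCont_mulOp_mul_freeRes {a : ℝ → ℂ} (ha : BddMeas a) (ha2 : MemLp a 2 volume)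
    {E : ℝ} (hE : 1 ≤ E) : CompletelyCont (mulOp a * freeRes E) := by
  intro f hf
  obtain ⟨κ, C, hκ, hR⟩ := exists_resolvent_kernel hE
  obtain ⟨⟨M, hM⟩, hw⟩ := hf
  have hC : 0 ≤ C := (norm_nonneg _).trans (hκ 0)
  have hM0 : 0 ≤ M := (norm_nonneg _).trans (hM 0)
  have hae : ∀ n, (mulOp a * freeRes E) (f n) =ᵐ[volume] fun y => a y * ⟪κ y, f n⟫_ℂ := by
    intro n
    rw [mul_apply_eq_comp]
    filter_upwards [coeFn_mulOp ha.memLp (freeRes E (f n)), hR (f n)] with y h1 h2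
    rw [h1, h2]
  have h2 : Tendsto (fun n => ‖(mulOp a * freeRes E) (f n)‖ ^ 2) atTop (𝓝 (0 ^ 2)) := by
    simp only [norm_sq_eq_integral]
    have h0 : ((0 : ℝ) ^ 2) = ∫ _ : ℝ, (0 : ℝ) := by simp
    rw [h0]
    refine tendsto_integral_of_dominated_convergence (fun y => ‖a y‖ ^ 2 * (C * M) ^ 2)
      (fun n => (integrable_norm_sq _).aestronglyMeasurable)
      ((ha2.integrable_norm_pow (by norm_num)).mul_const _) (fun n => ?_) ?_
    · filter_upwards [hae n] with y hy
      rw [hy, Real.norm_of_nonneg (sq_nonneg _), norm_mul, mul_pow]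
      gcongr
      exact (norm_inner_le_norm _ _).trans (mul_le_mul (hκ y) (hM n) (norm_nonneg _) hC)
    · filter_upwards [ae_all_iff.2 hae] with y hy
      simp only [hy]
      have := ((hw (κ y)).const_mul (a y)).norm.pow 2
      simpa using this
  have h3 := h2.sqrt
  simp only [Real.sqrt_sq (norm_nonneg _)] at h3
  exact tendsto_zero_iff_norm_tendsto_zero.2 (by simpa using h3)

/-! ### The symmetrizer -/

variable {U : ℝ → ℝ} {Um Up : ℝ}

theorem isSelfAdjoint_birman (h1 : AssumptionH1 U Um Up) (h2 : AssumptionH2 U Um Up) {E : ℝ}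
    (hE : 0 < E) : IsSelfAdjoint (birman U E) :=
  IsSelfAdjoint.of_nonneg (birman_nonneg h1 h2 hE)

theorem norm_birman_le_one (h1 : AssumptionH1 U Um Up) (h2 : AssumptionH2 U Um Up) {α : ℤ}
    (hα : α ≠ 0) : ‖birman U ((α : ℝ) ^ 2)‖ ≤ ‖birman U 1‖ :=
  norm_birman_le_of_le h1 h2 one_pos (one_le_sq_cast hα)

theorem isSelfAdjoint_sigmaOp (h1 : AssumptionH1 U Um Up) (h2 : AssumptionH2 U Um Up) {α : ℤ}
    (hα : α ≠ 0) : IsSelfAdjoint (sigmaOp U α) := by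
  rw [sigmaOp_eq hα]
  exact (IsSelfAdjoint.one _).sub
    (isSelfAdjoint_birman h1 h2 (one_pos.trans_le (one_le_sq_cast hα)))

theorem abs_re_sub_one_le_of_mem_spectrum_sigmaOp (h1 : AssumptionH1 U Um Up)
    (h2 : AssumptionH2 U Um Up) {α : ℤ} (hα : α ≠ 0) {z : ℂ}
    (hz : z ∈ spectrum ℂ (sigmaOp U α)) : |z.re - 1| ≤ ‖birman U 1‖ := by
  rw [sigmaOp_eq hα, sub_eq_add_neg, ← sub_add_cancel z 1,
    ← map_one (algebraMap ℂ (L2 →L[ℂ] L2)), spectrum.add_mem_add_iff] at hz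
  have h := spectrum.norm_le_norm_of_mem hz
  rw [norm_neg] at h
  have h3 := Complex.abs_re_le_norm (z - 1)
  rw [Complex.sub_re, Complex.one_re] at h3
  exact h3.trans (h.trans (norm_birman_le_one h1 h2 hα))

theorem functionOf_sigmaOp_congr (h1 : AssumptionH1 U Um Up) (h2 : AssumptionH2 U Um Up) {α : ℤ}
    (hα : α ≠ 0) {g h : ℝ → ℂ} (hgh : ∀ x : ℝ, |x - 1| ≤ ‖birman U 1‖ → g x = h x) :
    functionOf g (sigmaOp U α) = functionOf h (sigmaOp U α) :=
  cfc_congr fun _ hz => hgh _ (abs_re_sub_one_le_of_mem_spectrum_sigmaOp h1 h2 hα hz)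

theorem continuous_ofReal_sqrt : Continuous fun x : ℝ => (Real.sqrt x : ℂ) := by fun_prop

theorem symmetrizer_mul_self (h1 : AssumptionH1 U Um Up) (h2 : AssumptionH2 U Um Up)
    (h3 : AssumptionH3 U) {α : ℤ} (hα : α ≠ 0) :
    symmetrizer U α * symmetrizer U α = sigmaOp U α := by
  have hq := norm_birman_one_lt h1 h2 h3
  rw [symmetrizer, ← functionOf_mul continuous_ofReal_sqrt continuous_ofReal_sqrt]
  refine Eq.trans (functionOf_sigmaOp_congr h1 h2 hα fun x hx => ?_)
    (functionOf_id (isSelfAdjoint_sigmaOp h1 h2 hα))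
  rw [← Complex.ofReal_mul, Real.mul_self_sqrt]
  linarith [(abs_le.1 hx).1]

theorem isSelfAdjoint_symmetrizer (U : ℝ → ℝ) (α : ℤ) : IsSelfAdjoint (symmetrizer U α) :=
  isSelfAdjoint_functionOf (fun _ => Complex.conj_ofReal _) _

theorem symmetrizer_injective (h1 : AssumptionH1 U Um Up) (h2 : AssumptionH2 U Um Up)
    (h3 : AssumptionH3 U) {α : ℤ} (hα : α ≠ 0) {f : L2} (hf : symmetrizer U α f = 0) : f = 0 := by
  have h : sigmaOp U α f = 0 := by
    rw [← symmetrizer_mul_self h1 h2 h3 hα, mul_apply_eq_comp, hf, map_zero]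
  rw [sigmaOp_eq hα, sub_apply, one_apply_eq_self, sub_eq_zero] at h
  by_contra hne
  have h4 := (birman U ((α : ℝ) ^ 2)).le_opNorm f
  rw [← h] at h4
  have h5 := norm_pos_iff.2 hne
  nlinarith [norm_birman_le_one h1 h2 hα, norm_birman_one_lt h1 h2 h3]

/-- `S - 1` is bounded by `m (α² - ∂_y²)⁻¹ m`: write `√x - 1 = (x - 1) / (1 + √x)`. -/
theorem exists_symmetrizer_eq (h1 : AssumptionH1 U Um Up) (h2 : AssumptionH2 U Um Up)
    (h3 : AssumptionH3 U) : ∃ B : ℤ → L2 →L[ℂ] L2, (∀ α : ℤ, α ≠ 0 → ‖B α‖ ≤ 1) ∧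
      ∀ α : ℤ, α ≠ 0 → symmetrizer U α = 1 + birman U ((α : ℝ) ^ 2) * B α := by
  have hq := norm_birman_one_lt h1 h2 h3
  have hc : Continuous fun x : ℝ => ((-(1 + Real.sqrt x)⁻¹ : ℝ) : ℂ) :=
    Complex.continuous_ofReal.comp ((continuous_const.add Real.continuous_sqrt).inv₀
      fun x => (by positivity : 1 + Real.sqrt x ≠ 0)).neg
  refine ⟨fun α => functionOf (fun x : ℝ => ((-(1 + Real.sqrt x)⁻¹ : ℝ) : ℂ)) (sigmaOp U α),
    fun α hα => norm_functionOf_le zero_le_one fun x _ => ?_, fun α hα => ?_⟩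
  · rw [Complex.norm_real, norm_neg, Real.norm_of_nonneg (by positivity)]
    exact inv_le_one_of_one_le₀ (by linarith [Real.sqrt_nonneg x])
  · have hsa := isSelfAdjoint_sigmaOp h1 h2 hα
    have e1 : birman U ((α : ℝ) ^ 2) = functionOf (fun x : ℝ => 1 + (-1) * (x : ℂ))
        (sigmaOp U α) := by
      rw [functionOf_add continuous_const (by fun_prop), functionOf_const hsa,
        functionOf_smul Complex.continuous_ofReal, functionOf_id hsa, sigmaOp_eq hα]
      module
    have e2 : (1 : L2 →L[ℂ] L2) = functionOf (fun _ => 1) (sigmaOp U α) := by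
      rw [functionOf_const hsa, one_smul]
    rw [e1, ← functionOf_mul (by fun_prop) hc]
    nth_rewrite 1 [e2]
    rw [← functionOf_add (g := fun _ => 1)
      (h := fun x : ℝ => (1 + (-1) * (x : ℂ)) * ((-(1 + Real.sqrt x)⁻¹ : ℝ) : ℂ))
      continuous_const ((by fun_prop : Continuous fun x : ℝ =>
      (1 : ℂ) + (-1) * (x : ℂ)).mul hc)]
    refine functionOf_sigmaOp_congr h1 h2 hα fun x hx => ?_
    have hx0 : 0 ≤ x := by linarith [(abs_le.1 hx).1]
    have h4 : Real.sqrt x = 1 + (1 + (-1) * x) * -(1 + Real.sqrt x)⁻¹ := by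
      have h5 := Real.sq_sqrt hx0
      have h6 : 1 + Real.sqrt x ≠ 0 := by positivity
      field_simp
      linarith
    exact_mod_cast congrArg Complex.ofReal h4

theorem contDiff_of_contDiffAt_tsupport_mul {χ f : ℝ → ℝ} (hχ : ContDiff ℝ ∞ χ)
    (hf : ∀ x ∈ tsupport χ, ContDiffAt ℝ ∞ f x) : ContDiff ℝ ∞ fun x => χ x * f x := by
  refine contDiff_iff_contDiffAt.2 fun x => ?_
  by_cases hx : x ∈ tsupport χ
  · exact hχ.contDiffAt.mul (hf x hx)
  · refine contDiffAt_const (c := (0 : ℝ)) |>.congr_of_eventuallyEq ?_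
    filter_upwards [notMem_tsupport_iff_eventuallyEq.1 hx] with z hz
    rw [hz, Pi.zero_apply, zero_mul]

theorem exists_bd_symmetrizer (h1 : AssumptionH1 U Um Up) (h2 : AssumptionH2 U Um Up)
    (h3 : AssumptionH3 U) (N : ℕ) : ∃ c : ℝ, ∀ α : ℤ, α ≠ 0 → Bd 1 N (symmetrizer U α) c := by
  have hq := norm_birman_one_lt h1 h2 h3
  set q := ‖birman U 1‖
  have hq0 : 0 ≤ q := norm_nonneg _
  obtain ⟨w, hw⟩ : ∃ w, Bd 1 N (weightOp U) w := (h1.bddDeriv_weight h2 (N + 1)).bd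
  -- a smooth function which equals the square root on the spectrum
  let χ : ContDiffBump (1 : ℝ) := ⟨(1 + 2 * q) / 3, (2 + q) / 3, by positivity, by linarith⟩
  obtain ⟨C, hC⟩ := exists_bd_functionOf (G := fun x : ℝ => ((χ x * Real.sqrt x : ℝ) : ℂ))
    (Complex.ofRealCLM.contDiff.comp (contDiff_of_contDiffAt_tsupport_mul χ.contDiff fun x hx => by
      rw [χ.tsupport_eq, Metric.mem_closedBall, Real.dist_eq] at hx
      have hx' : |x - 1| ≤ (2 + q) / 3 := hx
      exact Real.contDiffAt_sqrt (by linarith [(abs_le.1 hx').1])))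
    (by
      have : HasCompactSupport fun x : ℝ => χ x * Real.sqrt x := χ.hasCompactSupport.mul_right
      exact this.comp_left (g := Complex.ofReal) Complex.ofReal_zero) N (1 + ‖(-1 : ℂ)‖ * (w * 1 * w))
  refine ⟨C, fun α hα => ?_⟩
  have hα1 := one_le_sq_cast hα
  have e : symmetrizer U α = functionOf (fun x : ℝ => ((χ x * Real.sqrt x : ℝ) : ℂ))
      (sigmaOp U α) := by
    refine functionOf_sigmaOp_congr h1 h2 hα fun x hx => ?_
    rw [χ.one_of_mem_closedBall, one_mul]
    rw [Metric.mem_closedBall, Real.dist_eq]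
    change |x - 1| ≤ (1 + 2 * q) / 3
    linarith
  rw [e]
  refine hC _ (isSelfAdjoint_sigmaOp h1 h2 hα) ?_
  have h4 : Bd 1 N (freeRes ((α : ℝ) ^ 2)) 1 := Bd.fnA (bddMeas_freeRes (by linarith))
    zero_le_one fun x => by
      rw [Complex.norm_real, Real.norm_of_nonneg (by positivity)]
      exact inv_le_one_of_one_le₀ (by nlinarith [sq_nonneg x])
  rw [sigmaOp_eq hα, sub_eq_add_neg, ← neg_one_smul ℂ]
  exact Bd.one.1.add (((hw.mul zero_le_one h4).mul zero_le_one hw).smul _)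

/-! ### The Hamiltonian and its commutator with `A` -/

/-- Multiplication by `U`. -/
def profileOp (U : ℝ → ℝ) : L2 →L[ℂ] L2 := mulOp fun y => (U y : ℂ)

theorem hamiltonian_eq (U : ℝ → ℝ) (α : ℤ) :
    hamiltonian U α = symmetrizer U α * profileOp U * symmetrizer U α := rfl

theorem AssumptionH1.isSelfAdjoint_profileOp (h1 : AssumptionH1 U Um Up)
    (h2 : AssumptionH2 U Um Up) : IsSelfAdjoint (profileOp U) :=
  isSelfAdjoint_mulOp (h1.bddDeriv_profile h2 0).1.bddMeas fun _ => Complex.conj_ofReal _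

theorem isSelfAdjoint_hamiltonian (h1 : AssumptionH1 U Um Up) (h2 : AssumptionH2 U Um Up)
    (α : ℤ) : IsSelfAdjoint (hamiltonian U α) := by
  have hS := (isSelfAdjoint_symmetrizer U α).star_eq
  rw [hamiltonian_eq, IsSelfAdjoint, star_mul, star_mul, hS,
    (h1.isSelfAdjoint_profileOp h2).star_eq, mul_assoc]

theorem exists_bd_hamiltonian (h1 : AssumptionH1 U Um Up) (h2 : AssumptionH2 U Um Up)
    (h3 : AssumptionH3 U) (N : ℕ) : ∃ c : ℝ, ∀ α : ℤ, α ≠ 0 → Bd 1 N (hamiltonian U α) c := by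
  obtain ⟨c, hc⟩ := exists_bd_symmetrizer h1 h2 h3 N
  obtain ⟨u, hu⟩ : ∃ u, Bd 1 N (profileOp U) u := (h1.bddDeriv_profile h2 (N + 1)).1.bd
  exact ⟨_, fun α hα => ((hc α hα).mul zero_le_one hu).mul zero_le_one (hc α hα)⟩

theorem negligible_mulOp_mul_freeRes {a : ℝ → ℂ} (ha : BddMeas a) (ha2 : MemLp a 2 volume) :
    Negligible fun α => mulOp a * freeRes ((α : ℝ) ^ 2) := by
  refine ⟨‖mulOp a‖, fun α hα => ⟨completelyCont_mulOp_mul_freeRes ha ha2 (one_le_sq_cast hα), ?_⟩⟩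
  have := one_le_sq_cast hα
  rw [div_eq_mul_inv]
  exact (norm_mul_le _ _).trans
    (mul_le_mul_of_nonneg_left (norm_freeRes_le (by linarith)) (norm_nonneg _))

theorem negligible_birman (h1 : AssumptionH1 U Um Up) (h2 : AssumptionH2 U Um Up) :
    Negligible fun α => birman U ((α : ℝ) ^ 2) :=
  (negligible_mulOp_mul_freeRes (h1.bddMeas_weight h2) h2.memLp_two.ofReal).mul_right
    (b := ‖weightOp U‖) fun _ _ => le_rfl

theorem exists_sigmaOp_deriv (h1 : AssumptionH1 U Um Up) (h2 : AssumptionH2 U Um Up) :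
    ∃ X' : ℤ → L2 →L[ℂ] L2, (∀ α : ℤ, α ≠ 0 → IsAd (sigmaOp U α) (X' α)) ∧ Negligible X' := by
  have hd : ∀ y, HasDerivAt (weight U) (deriv (weight U) y) y := fun y =>
    (h1.contDiff_weight.differentiable (by simp) y).hasDerivAt
  have hW := (h1.bddDeriv_weight h2 2).isAd hd
  have hw' : BddMeas fun y => ((deriv (weight U) y : ℝ) : ℂ) := by
    obtain ⟨-, g, hg, h⟩ := h1.bddDeriv_weight h2 1
    obtain rfl : deriv (weight U) = g := funext fun y => (hd y).unique (hg y)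
    exact h.bddMeas
  have hw2 : MemLp (fun y => ((deriv (weight U) y : ℝ) : ℂ)) 2 volume := by
    obtain ⟨C, hC, hle⟩ := h2.iteratedDeriv_le 1
    refine h2.memLp_two.of_le_mul (c := C) hw'.meas.aestronglyMeasurable (ae_of_all _ fun y => ?_)
    rw [Complex.norm_real, Real.norm_eq_abs, Real.norm_of_nonneg (h1.weight_pos y).le]
    simpa using hle y
  set W := weightOp U
  set W' : L2 →L[ℂ] L2 := Complex.I • mulOp fun y => ((deriv (weight U) y : ℝ) : ℂ)
  refine ⟨fun α => (-1 : ℂ) • (W' * freeRes ((α : ℝ) ^ 2) * W + W * freeRes ((α : ℝ) ^ 2) * W'),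
    fun α hα => ?_, ?_⟩
  · have hα1 := one_le_sq_cast hα
    have hR : IsAd (freeRes ((α : ℝ) ^ 2)) 0 := IsAd.fnA (bddMeas_freeRes (by linarith))
    have h3 : IsAd (1 - W * freeRes ((α : ℝ) ^ 2) * W) _ :=
      IsAd.one.sub ((IsAd.mul hW hR).mul hW)
    rw [mul_zero, add_zero, zero_sub, ← neg_one_smul ℂ] at h3
    rw [sigmaOp_eq hα]
    exact h3
  · have n1 : Negligible fun α : ℤ => W * freeRes ((α : ℝ) ^ 2) :=
      negligible_mulOp_mul_freeRes (h1.bddMeas_weight h2) h2.memLp_two.ofReal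
    have n2 : Negligible fun α : ℤ => W' * freeRes ((α : ℝ) ^ 2) := by
      refine ((negligible_mulOp_mul_freeRes hw' hw2).smul Complex.I).congr fun α _ => ?_
      rw [smul_mul_assoc]
    exact ((n2.mul_right (B := fun _ => W) (b := ‖W‖) fun _ _ => le_rfl).add
      (n1.mul_right (B := fun _ => W') (b := ‖W'‖) fun _ _ => le_rfl)).smul _

/-- Up to compact operators of size `O(α⁻²)`, the Hamiltonian is multiplication by `U`, and its
commutator with `A` is multiplication by `i U'`. -/
theorem exists_hamiltonian_deriv (h1 : AssumptionH1 U Um Up) (h2 : AssumptionH2 U Um Up)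
    (h3 : AssumptionH3 U) : ∃ H' : ℤ → L2 →L[ℂ] L2,
      (∀ α : ℤ, α ≠ 0 → IsAd (hamiltonian U α) (H' α)) ∧
      (Negligible fun α => hamiltonian U α - profileOp U) ∧
      Negligible fun α => H' α - Complex.I • mulOp fun y => ((deriv U y : ℝ) : ℂ) := by
  obtain ⟨X', hX', nX'⟩ := exists_sigmaOp_deriv h1 h2
  obtain ⟨c, hc⟩ := exists_bd_symmetrizer h1 h2 h3 1
  obtain ⟨B, hB, hSB⟩ := exists_symmetrizer_eq h1 h2 h3
  have hS' : ∀ α : ℤ, ∃ S' : L2 →L[ℂ] L2, α ≠ 0 → IsAd (symmetrizer U α) S' ∧ ‖S'‖ ≤ c := by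
    intro α
    by_cases hα : α = 0
    · exact ⟨0, fun h => absurd hα h⟩
    · obtain ⟨S', c₀, c₁, hS', b0, b1, hle⟩ := hc α hα
      have b1' : ‖S'‖ ≤ c₁ := b1
      have := b0.nonneg zero_le_one
      exact ⟨S', fun _ => ⟨hS', by linarith⟩⟩
  choose S' hS' using hS'
  have hSc : ∀ α : ℤ, α ≠ 0 → ‖symmetrizer U α‖ ≤ c := fun α hα => (hc α hα).norm_le zero_le_one
  set K : ℤ → L2 →L[ℂ] L2 := fun α => symmetrizer U α - 1 with hK
  have nK : Negligible K :=
    ((negligible_birman h1 h2).mul_right hB).congr fun α hα => by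
      rw [hK]
      simp only
      rw [hSB α hα, add_sub_cancel_left]
  have nS' : Negligible S' := by
    have n1 : Negligible fun α => (2⁻¹ : ℂ) •
        (X' α + (-1 : ℂ) • (S' α * K α + K α * S' α)) :=
      (nX'.add (((nK.mul_left fun α hα => (hS' α hα).2).add
        (nK.mul_right fun α hα => (hS' α hα).2)).smul _)).smul _
    refine n1.congr fun α hα => ?_
    have h4 := (hS' α hα).1.mul (hS' α hα).1
    rw [symmetrizer_mul_self h1 h2 h3 hα] at h4
    rw [(hX' α hα).unique h4, hK]
    simp only [mul_sub, sub_mul, mul_one, one_mul]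
    module
  have hU := (h1.bddDeriv_profile h2 2).1.isAd h1.hasDerivAt
  set V := profileOp U
  set V' : L2 →L[ℂ] L2 := Complex.I • mulOp fun y => ((deriv U y : ℝ) : ℂ)
  have bV : ∀ α : ℤ, α ≠ 0 → ‖V * symmetrizer U α‖ ≤ ‖V‖ * c := fun α hα =>
    (norm_mul_le _ _).trans (mul_le_mul_of_nonneg_left (hSc α hα) (norm_nonneg _))
  have bV' : ∀ α : ℤ, α ≠ 0 → ‖V' * symmetrizer U α‖ ≤ ‖V'‖ * c := fun α hα =>
    (norm_mul_le _ _).trans (mul_le_mul_of_nonneg_left (hSc α hα) (norm_nonneg _))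
  have bV2 : ∀ α : ℤ, α ≠ 0 → ‖symmetrizer U α * V‖ ≤ c * ‖V‖ := fun α hα =>
    (norm_mul_le _ _).trans (mul_le_mul_of_nonneg_right (hSc α hα) (norm_nonneg _))
  refine ⟨fun α => S' α * (V * symmetrizer U α) + symmetrizer U α * (V' * symmetrizer U α) +
    symmetrizer U α * V * S' α, fun α hα => ?_, ?_, ?_⟩
  · have h4 : IsAd (symmetrizer U α * V * symmetrizer U α)
        ((S' α * V + symmetrizer U α * V') * symmetrizer U α + symmetrizer U α * V * S' α) :=
      ((hS' α hα).1.mul hU).mul (hS' α hα).1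
    rw [add_mul, mul_assoc (S' α), mul_assoc (symmetrizer U α) V'] at h4
    exact h4
  · refine ((nK.mul_right bV).add (nK.mul_left (B := fun _ => V) (b := ‖V‖)
      fun _ _ => le_rfl)).congr fun α hα => ?_
    rw [hamiltonian_eq, hK]
    simp only
    noncomm_ring
  · refine (((nS'.mul_right bV).add ((nK.mul_right bV').add
      (nK.mul_left (B := fun _ => V') (b := ‖V'‖) fun _ _ => le_rfl))).add
      (nS'.mul_left bV2)).congr fun α hα => ?_
    rw [hK]
    simp only [sub_mul, mul_sub, one_mul, mul_one]
    abel

/-! ### Absence of embedded eigenvalues -/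

/-- The operator `∂_y (E - ∂_y²)⁻¹`, where `∂_y = -i A`. -/
def derivRes (E : ℝ) : L2 →L[ℂ] L2 := fnA fun x => -Complex.I * (x * ((x ^ 2 + E)⁻¹ : ℝ) : ℂ)

theorem sq_mul_inv_le {E : ℝ} (hE : 1 ≤ E) (x : ℝ) : (x * (x ^ 2 + E)⁻¹) ^ 2 ≤ (x ^ 2 + E)⁻¹ := by
  have h : 0 < x ^ 2 + E := by nlinarith [sq_nonneg x]
  rw [mul_pow, inv_pow, ← div_eq_mul_inv, div_le_iff₀ (by positivity), sq (x ^ 2 + E),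
    inv_mul_cancel_left₀ h.ne']
  linarith

theorem norm_derivSymbol_sq {E : ℝ} (x : ℝ) :
    ‖-Complex.I * (x * ((x ^ 2 + E)⁻¹ : ℝ) : ℂ)‖ ^ 2 = (x * (x ^ 2 + E)⁻¹) ^ 2 := by
  rw [norm_mul, norm_neg, Complex.norm_I, one_mul, ← Complex.ofReal_mul, Complex.norm_real,
    Real.norm_eq_abs, sq_abs]

theorem bddMeas_derivRes {E : ℝ} (hE : 1 ≤ E) :
    BddMeas fun x => -Complex.I * (x * ((x ^ 2 + E)⁻¹ : ℝ) : ℂ) := by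
  refine ⟨?_, 1, fun x => ?_⟩
  · exact measurable_const.mul (Complex.measurable_ofReal.mul
      (bddMeas_freeRes (by linarith : 0 < E)).meas)
  · refine le_of_sq_le_sq ?_ zero_le_one
    rw [norm_derivSymbol_sq, one_pow]
    exact (sq_mul_inv_le hE x).trans (inv_le_one_of_one_le₀ (by nlinarith [sq_nonneg x]))

theorem re_inner_freeRes {E : ℝ} (hE : 1 ≤ E) (h : L2) :
    (⟪h, freeRes E h⟫_ℂ).re = ‖derivRes E h‖ ^ 2 + E * ‖freeRes E h‖ ^ 2 := by
  have b1 := bddMeas_derivRes hE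
  have b2 := bddMeas_freeRes (by linarith : 0 < E)
  have e : freeRes E = star (derivRes E) * derivRes E +
      (E : ℂ) • (star (freeRes E) * freeRes E) := by
    rw [freeRes, derivRes, fnA_star b1, fnA_star b2, ← fnA_mul b1.conj b1, ← fnA_mul b2.conj b2,
      ← fnA_smul _ (b2.conj.mul b2), ← fnA_add (b1.conj.mul b1)
        ((BddMeas.const _).mul (b2.conj.mul b2))]
    congr 1
    funext x
    have h0 : (x ^ 2 + E) ≠ 0 := by nlinarith [sq_nonneg x]
    have h1 : (x ^ 2 + E)⁻¹ = (x * (x ^ 2 + E)⁻¹) * (x * (x ^ 2 + E)⁻¹) +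
        E * ((x ^ 2 + E)⁻¹ * (x ^ 2 + E)⁻¹) := by
      field_simp
    rw [map_mul, map_neg, Complex.conj_I, map_mul, Complex.conj_ofReal, Complex.conj_ofReal]
    have h2 := congrArg Complex.ofReal h1
    push_cast at h2 ⊢
    linear_combination h2 + (x * (x ^ 2 + E : ℂ)⁻¹) ^ 2 * Complex.I_sq
  conv_lhs => rw [e]
  rw [add_apply, inner_add_right, mul_apply_eq_comp, smul_apply, mul_apply_eq_comp,
    inner_smul_right, ContinuousLinearMap.star_eq_adjoint, ContinuousLinearMap.star_eq_adjoint,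
    ContinuousLinearMap.adjoint_inner_right, ContinuousLinearMap.adjoint_inner_right,
    Complex.add_re, Complex.re_ofReal_mul, ← inner_self_eq_norm_sq (𝕜 := ℂ),
    ← inner_self_eq_norm_sq (𝕜 := ℂ)]
  rfl

/-- The resolvent `(E - ∂_y²)⁻¹` maps `L²` to differentiable functions that vanish at infinity. -/
theorem exists_hasDerivAt_freeRes {E : ℝ} (hE : 1 ≤ E) (h : L2) : ∃ Ψ Ψ' : ℝ → ℂ,
    (∀ y, HasDerivAt Ψ (Ψ' y) y) ∧ Tendsto Ψ (cocompact ℝ) (𝓝 0) ∧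
      freeRes E h =ᵐ[volume] Ψ ∧ derivRes E h =ᵐ[volume] Ψ' := by
  have b1 := bddMeas_derivRes hE
  have b2 := bddMeas_freeRes (by linarith : 0 < E)
  set s : ℝ → ℂ := fun ξ => ((((-(2 * Real.pi * ξ)) ^ 2 + E)⁻¹ : ℝ) : ℂ) with hs
  have hs2 : MemLp s 2 volume := by
    rw [hs]
    simpa only [neg_sq] using memLp_resolventSymbol hE
  set d : ℝ → ℂ := fun ξ => -Complex.I * (((-(2 * Real.pi * ξ) : ℝ) : ℂ) *
    ((((-(2 * Real.pi * ξ)) ^ 2 + E)⁻¹ : ℝ) : ℂ)) with hd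
  have hd2 : MemLp d 2 volume := by
    rw [memLp_two_iff_integrable_sq_norm b1.compA.meas.aestronglyMeasurable]
    have hpi := Real.pi_gt_three
    refine integrable_inv_one_add_sq.mono' (b1.compA.meas.norm.pow_const 2).aestronglyMeasurable
      (ae_of_all _ fun ξ => ?_)
    rw [Real.norm_of_nonneg (sq_nonneg _), norm_derivSymbol_sq]
    refine (sq_mul_inv_le hE _).trans (inv_anti₀ (by positivity) ?_)
    have : 1 ≤ (2 * Real.pi) ^ 2 := by nlinarith
    rw [neg_sq, mul_pow]
    nlinarith [sq_nonneg ξ]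
  set u : L2 := mulOp s (fourierL2 h) with hu
  set v : L2 := mulOp d (fourierL2 h) with hv
  have hu1 := coeFn_mulOp b2.compA.memLp (fourierL2 h)
  have hv1 := coeFn_mulOp b1.compA.memLp (fourierL2 h)
  have iu : Integrable u :=
    Integrable.congr (MemLp.integrable_mul hs2 (Lp.memLp (fourierL2 h))) hu1.symm
  have iv : Integrable v :=
    Integrable.congr (MemLp.integrable_mul hd2 (Lp.memLp (fourierL2 h))) hv1.symm
  have huv : (v : ℝ → ℂ) =ᵐ[volume] fun ξ => (2 * Real.pi * Complex.I * ξ) • u ξ := by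
    filter_upwards [hu1, hv1] with ξ h1 h2
    rw [hu, hv, h1, h2, smul_eq_mul]
    push_cast
    ring
  have iu' : Integrable fun ξ : ℝ => ξ • u ξ := by
    refine (iv.const_mul (2 * Real.pi * Complex.I)⁻¹).congr ?_
    filter_upwards [huv] with ξ hξ
    have : (2 * Real.pi * Complex.I : ℂ) ≠ 0 := Complex.two_pi_I_ne_zero
    rw [hξ, smul_eq_mul, Complex.real_smul]
    field_simp
  have hneg : ∀ (f : ℝ → ℂ) (y : ℝ), 𝓕⁻ f y = 𝓕 f (-y) := fun f y =>
    Real.fourierInv_eq_fourier_neg f y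
  refine ⟨𝓕⁻ (u : ℝ → ℂ), 𝓕⁻ (v : ℝ → ℂ), fun y => ?_, ?_, fourierL2_symm_ae_eq iu,
    fourierL2_symm_ae_eq iv⟩
  · have h1 := Real.hasDerivAt_fourier iu iu' (-y)
    have h2 : HasDerivAt (fun y => 𝓕 (u : ℝ → ℂ) (-y)) _ y :=
      HasDerivAt.scomp y h1 (hasDerivAt_neg y)
    have e : 𝓕⁻ (u : ℝ → ℂ) = fun y => 𝓕 (u : ℝ → ℂ) (-y) := funext (hneg _)
    rw [e]
    refine h2.congr_deriv ?_
    rw [hneg, Real.fourier_eq', Real.fourier_eq', neg_one_smul, ← integral_neg]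
    refine integral_congr_ae ?_
    filter_upwards [huv] with ξ hξ
    rw [hξ]
    simp only [smul_eq_mul]
    ring
  · have h1 := (Real.zero_at_infty_fourier (u : ℝ → ℂ)).comp
      (Homeomorph.neg ℝ).isClosedEmbedding.tendsto_cocompact
    exact h1.congr fun y => (hneg _ y).symm

/-- **Rayleigh's inequality**: `∫ |Ψ'|² + U'' / (U - l) |Ψ|² ≥ 0` if `Ψ` vanishes at the point
where `U = l`, because the integrand is at least the derivative of `U' / (U - l) |Ψ|²`. -/
theorem rayleigh_nonneg {U U' U'' : ℝ → ℝ} {Ψ Ψ' : ℝ → ℂ} {l z : ℝ}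
    (hU : ∀ y, HasDerivAt U (U' y) y) (hU' : ∀ y, HasDerivAt U' (U'' y) y) (hz : U z = l)
    (hne : ∀ y, y ≠ z → U y ≠ l) (hz' : U' z ≠ 0) (hΨ : ∀ y, HasDerivAt Ψ (Ψ' y) y)
    (hΨz : Ψ z = 0)
    (hbot : Tendsto (fun y => U' y / (U y - l) * ‖Ψ y‖ ^ 2) atBot (𝓝 0))
    (htop : Tendsto (fun y => U' y / (U y - l) * ‖Ψ y‖ ^ 2) atTop (𝓝 0))
    (hF : Integrable fun y => ‖Ψ' y‖ ^ 2 + U'' y / (U y - l) * ‖Ψ y‖ ^ 2) :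
    0 ≤ ∫ y, (‖Ψ' y‖ ^ 2 + U'' y / (U y - l) * ‖Ψ y‖ ^ 2) := by
  set G : ℝ → ℝ := fun y => U' y / (U y - l) * ‖Ψ y‖ ^ 2 with hG
  set F : ℝ → ℝ := fun y => ‖Ψ' y‖ ^ 2 + U'' y / (U y - l) * ‖Ψ y‖ ^ 2 with hFdef
  have hderiv : ∀ y, y ≠ z → ∃ g, HasDerivAt G g y ∧ g ≤ F y := by
    intro y hy
    have h0 : U y - l ≠ 0 := sub_ne_zero.2 (hne y hy)
    refine ⟨_, ((hU' y).div ((hU y).sub_const l) h0).mul (hΨ y).norm_sq, ?_⟩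
    have h1 := norm_sub_sq_real (Ψ' y) ((U' y / (U y - l)) • Ψ y)
    have h2 := sq_nonneg ‖Ψ' y - (U' y / (U y - l)) • Ψ y‖
    rw [h1, norm_smul, inner_smul_right, mul_pow, real_inner_comm, Real.norm_eq_abs, sq_abs] at h2
    have e : (U'' y * (U y - l) - U' y * U' y) / (U y - l) ^ 2 =
        U'' y / (U y - l) - (U' y / (U y - l)) ^ 2 := by
      field_simp
    rw [e, hFdef]
    simp only [Pi.div_apply]
    linarith
  have hcz : ContinuousAt G z := by
    have hGz : G z = 0 := by simp [hG, hΨz]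
    rw [continuousAt_iff_punctured_nhds, hGz]
    have s1 := hasDerivAt_iff_tendsto_slope.1 (hU z)
    have s2 := (hasDerivAt_iff_tendsto_slope.1 (hΨ z)).norm
    have s3 : Tendsto (fun y => ‖Ψ y‖) (𝓝[≠] z) (𝓝 0) := by
      have := (hΨ z).continuousAt.norm.tendsto.mono_left (nhdsWithin_le_nhds (s := {z}ᶜ))
      simpa [hΨz] using this
    have s4 := (hU' z).continuousAt.tendsto.mono_left (nhdsWithin_le_nhds (s := {z}ᶜ))
    -- near `z` both `U - l` and `Ψ` are comparable with `y - z`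
    have s5 := (s4.abs.mul (s1.abs.inv₀ (abs_ne_zero.2 hz'))).mul (s2.mul s3)
    rw [mul_zero, mul_zero] at s5
    refine tendsto_zero_iff_abs_tendsto_zero _ |>.2 (s5.congr' ?_)
    filter_upwards [self_mem_nhdsWithin] with y hy
    have h1 : |y - z| ≠ 0 := abs_ne_zero.2 (sub_ne_zero.2 hy)
    have h2 : |U y - l| ≠ 0 := abs_ne_zero.2 (sub_ne_zero.2 (hne y hy))
    rw [slope_def_field, slope_def_module, hz, hΨz, sub_zero, norm_smul, norm_inv, abs_div,
      Function.comp_apply, hG, abs_mul, abs_div, abs_pow, abs_norm, Real.norm_eq_abs]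
    field_simp
  have hcont : Continuous G := continuous_iff_continuousAt.2 fun y => by
    rcases eq_or_ne y z with rfl | hy
    · exact hcz
    · obtain ⟨g, hg, -⟩ := hderiv y hy
      exact hg.continuousAt
  choose! g hg hgF using hderiv
  have hle : ∀ a b, a ≤ z → z ≤ b → G b - G a ≤ ∫ y in a..b, F y := by
    intro a b ha hb
    have h1 := intervalIntegral.sub_le_integral_of_hasDeriv_right_of_le ha hcont.continuousOn
      (fun x hx => (hg x hx.2.ne).hasDerivWithinAt) hF.integrableOn fun x hx => hgF x hx.2.ne
    have h2 := intervalIntegral.sub_le_integral_of_hasDeriv_right_of_le hb hcont.continuousOn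
      (fun x hx => (hg x hx.1.ne').hasDerivWithinAt) hF.integrableOn fun x hx => hgF x hx.1.ne'
    rw [← intervalIntegral.integral_add_adjacent_intervals hF.intervalIntegrable
      (hF.intervalIntegrable : IntervalIntegrable F volume z b)]
    linarith
  have h1 := intervalIntegral_tendsto_integral hF tendsto_neg_atTop_atBot
    (tendsto_id : Tendsto id atTop (atTop : Filter ℝ))
  have h2 : Tendsto (fun y => G y - G (-y)) atTop (𝓝 (0 - 0)) :=
    htop.sub (hbot.comp tendsto_neg_atTop_atBot)
  rw [sub_zero] at h2
  refine le_of_tendsto_of_tendsto h2 h1 ?_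
  filter_upwards [eventually_ge_atTop |z|] with y hy
  exact hle _ _ (by linarith [neg_abs_le z]) ((le_abs_self z).trans hy)

variable {U : ℝ → ℝ} {Um Up : ℝ}

/-- A quotient `a / (U - l)` that is square integrable near the point where `U = l` has a
numerator that vanishes there. -/
theorem eq_zero_of_memLp_div {U' z l : ℝ} (hU : HasDerivAt U U' z) (hz : U z = l)
    (hne : ∀ y, y ≠ z → U y ≠ l)
    {a : ℝ → ℂ} (ha : ContinuousAt a z) {φ : L2}
    (hφ : φ =ᵐ[volume] fun y => a y / ((U y - l : ℝ) : ℂ)) : a z = 0 := by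
  by_contra haz
  have hlim : Tendsto (fun y => ‖a y‖) (𝓝[≠] z) (𝓝 ‖a z‖) :=
    ha.norm.tendsto.mono_left nhdsWithin_le_nhds
  have hpos := norm_pos_iff.2 haz
  have s1 := (hasDerivAt_iff_tendsto_slope.1 hU).abs
  have hO : (fun y => (y - z)⁻¹) =O[𝓝[≠] z] fun y => a y / ((U y - l : ℝ) : ℂ) := by
    refine Asymptotics.IsBigO.of_bound ((|U'| + 1) / (‖a z‖ / 2)) ?_
    filter_upwards [hlim.eventually_const_lt (half_lt_self hpos),
      s1.eventually_lt_const (lt_add_one _), self_mem_nhdsWithin] with y h1 h2 h3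
    have h3' : y - z ≠ 0 := sub_ne_zero.2 h3
    rw [slope_def_field, hz, abs_div, div_lt_iff₀ (abs_pos.2 h3')] at h2
    rw [norm_div, Complex.norm_real, norm_inv, Real.norm_eq_abs, Real.norm_eq_abs,
      div_mul_div_comm, inv_eq_one_div]
    have h4 := abs_pos.2 h3'
    have h5 := abs_pos.2 (sub_ne_zero.2 (hne y h3))
    have h6 : 0 ≤ |U'| := abs_nonneg _
    rw [div_le_div_iff₀ h4 (by positivity)]
    nlinarith
  refine not_intervalIntegrable_of_sub_inv_isBigO_punctured hO
    (show z - 1 ≠ z + 1 by linarith) (by rw [uIcc_of_le (by linarith)]; constructor <;> linarith) ?_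
  have hloc : LocallyIntegrable φ volume := (Lp.memLp φ).locallyIntegrable (by norm_num)
  exact ((hloc.integrableOn_isCompact isCompact_uIcc).intervalIntegrable).congr_ae
    (ae_restrict_of_ae hφ)

/-- `H` has no eigenvalue in the range of `U`. If `H ψ = l ψ` then `Ψ = (α² - ∂_y²)⁻¹ m U S ψ`
solves Rayleigh's equation `Ψ'' = α² Ψ + U'' / (U - l) Ψ` and vanishes where `U = l`; Rayleigh's
inequality then gives `α² ‖Ψ‖² ≤ 0`. -/
theorem eq_zero_of_hamiltonian_eigenvector (h1 : AssumptionH1 U Um Up) (h2 : AssumptionH2 U Um Up)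
    (h3 : AssumptionH3 U) {α : ℤ} (hα : α ≠ 0) {l : ℝ} (hl : l ∈ Ioo Um Up) {ψ : L2}
    (hψ : hamiltonian U α ψ = (l : ℂ) • ψ) : ψ = 0 := by
  obtain ⟨z, hz⟩ := h1.exists_eq hl
  have hE := one_le_sq_cast hα
  set E := (α : ℝ) ^ 2
  have hne : ∀ y, y ≠ z → U y ≠ l := fun y hy h => hy (h1.strictMono.injective (h.trans hz.symm))
  have bU := (h1.bddDeriv_profile h2 0).1.bddMeas
  have bW := h1.bddMeas_weight h2
  set φ := symmetrizer U α ψ with hφ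
  set h := weightOp U (profileOp U φ) with hh
  -- the equation `(U - l) φ = m Ψ`
  have heq : profileOp U φ - (l : ℂ) • φ = weightOp U (freeRes E h) := by
    have e1 : sigmaOp U α (profileOp U φ) = (l : ℂ) • φ := by
      rw [← symmetrizer_mul_self h1 h2 h3 hα, hφ, ← map_smul, ← hψ]
      rfl
    rw [sigmaOp_eq hα, sub_apply, one_apply_eq_self] at e1
    rw [← e1, sub_sub_cancel]
    rfl
  obtain ⟨Ψ, Ψ', hd, hinf, hΨ, hΨ'⟩ := exists_hasDerivAt_freeRes hE h
  have hz0 : ∀ᵐ y, y ≠ z := by simp [ae_iff]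
  have hφΨ : φ =ᵐ[volume] fun y => (weight U y * Ψ y) / ((U y - l : ℝ) : ℂ) := by
    have e2 : (profileOp U φ - (l : ℂ) • φ : L2) =ᵐ[volume] weightOp U (freeRes E h) := by
      rw [heq]
    filter_upwards [e2, Lp.coeFn_sub (profileOp U φ) ((l : ℂ) • φ), Lp.coeFn_smul (l : ℂ) φ,
      coeFn_mulOp bU.memLp φ, coeFn_mulOp bW.memLp (freeRes E h), hΨ, hz0]
      with y a0 a1 a2 a3 a4 a5 a6
    rw [a1, Pi.sub_apply, a2, Pi.smul_apply, profileOp, a3, weightOp, a4, a5, smul_eq_mul,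
      ← sub_mul, ← Complex.ofReal_sub] at a0
    rw [← a0, mul_div_cancel_left₀]
    exact Complex.ofReal_ne_zero.2 (sub_ne_zero.2 (hne y a6))
  have hhΨ : ∀ᵐ y, h y = (((weight U y) ^ 2 * U y / (U y - l) : ℝ) : ℂ) * Ψ y := by
    filter_upwards [coeFn_mulOp bW.memLp (profileOp U φ), coeFn_mulOp bU.memLp φ, hφΨ]
      with y a1 a2 a3
    rw [hh, weightOp, a1, profileOp, a2, a3]
    push_cast
    ring
  have hΨz : Ψ z = 0 := by
    have := eq_zero_of_memLp_div (h1.hasDerivAt z) hz hne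
      (a := fun y => (weight U y : ℂ) * Ψ y)
      ((Complex.continuous_ofReal.comp h1.contDiff_weight.continuous).continuousAt.mul
        (hd z).continuousAt) hφΨ
    exact (mul_eq_zero.1 this).resolve_left (Complex.ofReal_ne_zero.2 (h1.weight_pos z).ne')
  -- `∫ |Ψ'|² + U'' / (U - l) |Ψ|² = - α² ‖Ψ‖²`
  have i1 : (fun y => ‖derivRes E h y‖ ^ 2) =ᵐ[volume] fun y => ‖Ψ' y‖ ^ 2 := by
    filter_upwards [hΨ'] with y hy
    rw [hy]
  have i2 : (fun y => (⟪h y, freeRes E h y⟫_ℂ).re) =ᵐ[volume]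
      fun y => -(deriv (deriv U) y / (U y - l) * ‖Ψ y‖ ^ 2) := by
    filter_upwards [hhΨ, hΨ] with y a1 a2
    rw [a1, a2, RCLike.inner_apply, map_mul, Complex.conj_ofReal, mul_left_comm, Complex.mul_conj,
      Complex.normSq_eq_norm_sq, ← Complex.ofReal_mul, Complex.ofReal_re, h1.deriv2_eq]
    ring
  have int1 := (integrable_norm_sq (derivRes E h)).congr i1
  have int0 : Integrable fun y => (⟪h y, freeRes E h y⟫_ℂ).re :=
    (L2.integrable_inner (𝕜 := ℂ) h (freeRes E h)).re
  have int2 : Integrable fun y => deriv (deriv U) y / (U y - l) * ‖Ψ y‖ ^ 2 := by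
    simpa only [Pi.neg_def, neg_neg] using (int0.congr i2).neg
  have hval : ∫ y, (‖Ψ' y‖ ^ 2 + deriv (deriv U) y / (U y - l) * ‖Ψ y‖ ^ 2) =
      -(E * ‖freeRes E h‖ ^ 2) := by
    have e1 : (⟪h, freeRes E h⟫_ℂ).re =
        -∫ y, deriv (deriv U) y / (U y - l) * ‖Ψ y‖ ^ 2 := by
      rw [L2.inner_def, ← integral_neg, ← integral_congr_ae i2]
      exact (integral_re (L2.integrable_inner (𝕜 := ℂ) h (freeRes E h))).symm
    have e2 : ‖derivRes E h‖ ^ 2 = ∫ y, ‖Ψ' y‖ ^ 2 := by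
      rw [norm_sq_eq_integral, integral_congr_ae i1]
    rw [re_inner_freeRes hE, e2] at e1
    rw [integral_add int1 int2]
    linarith
  obtain ⟨M, hM⟩ := (h1.bddDeriv_profile h2 0).2.bdd
  have hlim : ∀ {f : Filter ℝ} {b : ℝ}, f ≤ cocompact ℝ → Tendsto U f (𝓝 b) → b ≠ l →
      Tendsto (fun y => deriv U y / (U y - l) * ‖Ψ y‖ ^ 2) f (𝓝 0) := by
    intro f b hf hb hbl
    have t1 := ((hb.sub_const l).inv₀ (sub_ne_zero.2 hbl)).mul ((hinf.mono_left hf).norm.pow 2)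
    rw [norm_zero, zero_pow two_ne_zero, mul_zero] at t1
    refine (bdd_le_mul_tendsto_zero' M (Eventually.of_forall hM) t1).congr fun y => ?_
    rw [div_eq_mul_inv, mul_assoc]
  have hpos := rayleigh_nonneg h1.hasDerivAt
    (fun y => (h1.contDiff_deriv.differentiable (by simp) y).hasDerivAt) hz hne
    (h1.deriv_pos z).ne' hd hΨz (hlim atBot_le_cocompact h1.tendsto_atBot hl.1.ne)
    (hlim atTop_le_cocompact h1.tendsto_atTop hl.2.ne')
    (int1.add int2)
  rw [hval] at hpos
  have hR : freeRes E h = 0 := by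
    rw [← norm_eq_zero, ← sq_eq_zero_iff]
    nlinarith [sq_nonneg ‖freeRes E h‖]
  rw [hR, map_zero] at heq
  refine symmetrizer_injective h1 h2 h3 hα (f := ψ) ?_
  rw [← hφ]
  refine Lp.ext ?_
  have hΨ0 : (0 : L2) =ᵐ[volume] Ψ := hR ▸ hΨ
  filter_upwards [hφΨ, hΨ0, Lp.coeFn_zero ℂ 2 (volume : Measure ℝ)] with y a1 a2 a3
  rw [a1, ← a2, a3]
  simp

/-! ### The Mourre estimate -/

variable {U : ℝ → ℝ} {Um Up : ℝ}

/-- The Mourre estimate for multiplication operators: `U'` is positive where `U` is close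
to `l`. -/
theorem exists_model_mourre (h1 : AssumptionH1 U Um Up) (h2 : AssumptionH2 U Um Up) {l : ℝ}
    (hl : l ∈ Ioo Um Up) : ∃ θ C : ℝ, 0 < θ ∧ 0 ≤ C ∧ ∀ f : L2, θ * ‖f‖ ^ 2 ≤
      (⟪f, mulOp (fun y => ((deriv U y : ℝ) : ℂ)) f⟫_ℂ).re +
        C * ‖profileOp U f - (l : ℂ) • f‖ ^ 2 := by
  obtain ⟨z, hz⟩ := h1.exists_eq hl
  have hpos := h1.deriv_pos z
  set θ := deriv U z / 2 with hθ
  have hθ0 : 0 < θ := half_pos hpos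
  obtain ⟨δ, hδ, hball⟩ := Metric.eventually_nhds_iff.1
    (h1.contDiff_deriv.continuous.continuousAt.eventually_const_lt (half_lt_self hpos))
  set κ := min (U (z + δ) - l) (l - U (z - δ)) with hκ
  have hκ0 : 0 < κ := lt_min (sub_pos.2 (hz ▸ h1.strictMono (by linarith)))
    (sub_pos.2 (hz ▸ h1.strictMono (by linarith)))
  have hpt : ∀ y, θ ≤ deriv U y + θ / κ ^ 2 * (U y - l) ^ 2 := by
    intro y
    have h0 : 0 ≤ θ / κ ^ 2 * (U y - l) ^ 2 := by positivity
    by_cases hy : dist y z < δ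
    · have := hball hy
      linarith
    · have hk : κ ≤ |U y - l| := by
        rw [Real.dist_eq, not_lt] at hy
        rcases le_abs.1 hy with h | h
        · refine (min_le_left _ _).trans (le_trans ?_ (le_abs_self _))
          linarith [h1.strictMono.monotone (show z + δ ≤ y by linarith)]
        · refine (min_le_right _ _).trans (le_trans ?_ (neg_le_abs _))
          linarith [h1.strictMono.monotone (show y ≤ z - δ by linarith)]
      have h3 : κ ^ 2 ≤ (U y - l) ^ 2 := by
        rw [← sq_abs (U y - l)]
        exact pow_le_pow_left₀ hκ0.le hk 2
      have h4 : θ ≤ θ / κ ^ 2 * (U y - l) ^ 2 := by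
        rw [div_mul_eq_mul_div, le_div_iff₀ (by positivity)]
        exact mul_le_mul_of_nonneg_left h3 hθ0.le
      linarith [h1.deriv_pos y]
  refine ⟨θ, θ / κ ^ 2, hθ0, by positivity, fun f => ?_⟩
  have bU := (h1.bddDeriv_profile h2 0).1.bddMeas
  have bU' := (h1.bddDeriv_profile h2 0).2.bddMeas
  set D := mulOp fun y => ((deriv U y : ℝ) : ℂ)
  have e1 : (⟪f, D f⟫_ℂ).re = ∫ y, (⟪f y, D f y⟫_ℂ).re := by
    rw [L2.inner_def]
    exact (integral_re (L2.integrable_inner (𝕜 := ℂ) f (D f))).symm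
  have i1 : Integrable fun y => (⟪f y, D f y⟫_ℂ).re :=
    (L2.integrable_inner (𝕜 := ℂ) f (D f)).re
  have i2 := (integrable_norm_sq (profileOp U f - (l : ℂ) • f)).const_mul (θ / κ ^ 2)
  rw [e1, norm_sq_eq_integral, norm_sq_eq_integral, ← integral_const_mul, ← integral_const_mul,
    ← integral_add i1 i2]
  refine integral_mono_ae ((integrable_norm_sq f).const_mul θ) (i1.add i2) ?_
  filter_upwards [coeFn_mulOp bU.memLp f, coeFn_mulOp bU'.memLp f,
    Lp.coeFn_sub (profileOp U f) ((l : ℂ) • f), Lp.coeFn_smul (l : ℂ) f] with y a1 a2 a3 a4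
  rw [a3, Pi.sub_apply, profileOp, a1, a4, Pi.smul_apply, smul_eq_mul, ← sub_mul,
    ← Complex.ofReal_sub, norm_mul, Complex.norm_real, mul_pow, Real.norm_eq_abs, sq_abs, a2,
    RCLike.inner_apply, mul_assoc, Complex.mul_conj, Complex.normSq_eq_norm_sq,
    ← Complex.ofReal_mul, Complex.ofReal_re]
  nlinarith [hpt y, sq_nonneg ‖f y‖]

/-- Approximate eigenvectors of a self-adjoint operator without eigenvectors converge weakly
to zero. -/
theorem weakNull_of_tendsto {T : L2 →L[ℂ] L2} (hT : IsSelfAdjoint T)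
    (hker : ∀ f : L2, T f = 0 → f = 0) {f : ℕ → L2} (hf : ∀ n, ‖f n‖ ≤ 1)
    (h : Tendsto (fun n => T (f n)) atTop (𝓝 0)) : WeakNull f := by
  refine ⟨⟨1, hf⟩, fun g => ?_⟩
  have hdense : (T.range).topologicalClosure = ⊤ := by
    rw [Submodule.topologicalClosure_eq_top_iff, ContinuousLinearMap.orthogonal_range,
      hT.adjoint_eq, eq_bot_iff]
    exact fun x hx => hker x hx
  rw [Metric.tendsto_atTop]
  intro ε hε
  have hg : g ∈ closure (T.range : Set L2) := by
    rw [← Submodule.topologicalClosure_coe, hdense]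
    trivial
  obtain ⟨_, ⟨g', rfl⟩, hg'⟩ := Metric.mem_closure_iff.1 hg (ε / 2) (half_pos hε)
  have h3 : Tendsto (fun n => ‖⟪g', T (f n)⟫_ℂ‖) atTop (𝓝 0) := by
    have := ((continuous_const.inner continuous_id :
      Continuous fun x : L2 => ⟪g', x⟫_ℂ).norm.tendsto 0).comp h
    simpa [Function.comp_def] using this
  obtain ⟨N, hN⟩ := eventually_atTop.1 (h3.eventually_lt_const (half_pos hε))
  refine ⟨N, fun n hn => ?_⟩
  have e : ⟪g, f n⟫_ℂ = ⟪g - T g', f n⟫_ℂ + ⟪g', T (f n)⟫_ℂ := by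
    have h4 : ⟪T g', f n⟫_ℂ = ⟪g', T (f n)⟫_ℂ := by
      conv_lhs => rw [← hT.adjoint_eq]
      exact ContinuousLinearMap.adjoint_inner_left _ _ _
    rw [inner_sub_left, h4, sub_add_cancel]
  rw [dist_zero_right, e]
  refine (norm_add_le _ _).trans_lt ?_
  have h5 : ‖⟪g - T g', f n⟫_ℂ‖ ≤ ‖g - T g'‖ * 1 :=
    (norm_inner_le_norm _ _).trans (mul_le_mul_of_nonneg_left (hf n) (norm_nonneg _))
  rw [dist_eq_norm] at hg'
  have h6 : ‖g - T g'‖ < ε / 2 := hg'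
  linarith [hN n hn]

/-- The form of `-i H'` is bounded below in terms of the distance of `H'` to `i U'` and of `H` to
`U`. -/
theorem re_inner_ge_of_model {θ C l : ℝ} {V D H B : L2 →L[ℂ] L2}
    (hmodel : ∀ f : L2, θ * ‖f‖ ^ 2 ≤ (⟪f, D f⟫_ℂ).re + C * ‖V f - (l : ℂ) • f‖ ^ 2) (hC : 0 ≤ C)
    {f : L2} (hf : ‖f‖ = 1) :
    θ - C * (‖H f - (l : ℂ) • f‖ + ‖(H - V) f‖) ^ 2 - ‖(B - D) f‖ ≤ (⟪f, B f⟫_ℂ).re := by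
  have h1 := hmodel f
  rw [hf, one_pow, mul_one] at h1
  have h2 : ‖V f - (l : ℂ) • f‖ ≤ ‖H f - (l : ℂ) • f‖ + ‖(H - V) f‖ := by
    have e : V f - (l : ℂ) • f = (H f - (l : ℂ) • f) - (H - V) f := by
      rw [sub_apply]
      abel
    rw [e]
    exact norm_sub_le _ _
  have h3 : (⟪f, D f⟫_ℂ).re = (⟪f, B f⟫_ℂ).re - (⟪f, (B - D) f⟫_ℂ).re := by
    rw [sub_apply, inner_sub_right, Complex.sub_re]
    ring
  have h4 : -(⟪f, (B - D) f⟫_ℂ).re ≤ ‖(B - D) f‖ := by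
    refine (neg_le_abs _).trans ((Complex.abs_re_le_norm _).trans ((norm_inner_le_norm _ _).trans ?_))
    rw [hf, one_mul]
  have h5 : C * ‖V f - (l : ℂ) • f‖ ^ 2 ≤ C * (‖H f - (l : ℂ) • f‖ + ‖(H - V) f‖) ^ 2 := by
    gcongr
  linarith

/-- **The Mourre estimate**, uniform in the wave number. For a single wave number it holds by
compactness, since there are no eigenvalues; for large wave numbers, `H` and its commutator with
`A` are close in norm to multiplication operators. -/
theorem exists_mourre (h1 : AssumptionH1 U Um Up) (h2 : AssumptionH2 U Um Up)
    (h3 : AssumptionH3 U) {l : ℝ} (hl : l ∈ Ioo Um Up) {H' : ℤ → L2 →L[ℂ] L2}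
    (hHV : Negligible fun α => hamiltonian U α - profileOp U)
    (hH' : Negligible fun α => H' α - Complex.I • mulOp fun y => ((deriv U y : ℝ) : ℂ)) :
    ∃ θ ε : ℝ, 0 < θ ∧ 0 < ε ∧ ∀ α : ℤ, α ≠ 0 → ∀ f : L2,
      ‖hamiltonian U α f - (l : ℂ) • f‖ ≤ ε * ‖f‖ →
        θ * ‖f‖ ^ 2 ≤ (⟪f, (-Complex.I • H' α) f⟫_ℂ).re := by
  obtain ⟨θ, C, hθ, hC, hmodel⟩ := exists_model_mourre h1 h2 hl
  set D := mulOp fun y => ((deriv U y : ℝ) : ℂ)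
  set V := profileOp U
  set B : ℤ → L2 →L[ℂ] L2 := fun α => -Complex.I • H' α with hB
  have hBD : Negligible fun α => B α - D := by
    refine (hH'.smul (-Complex.I)).congr fun α _ => ?_
    rw [hB, smul_sub, smul_smul]
    simp
  have hlow : ∀ α (f : L2), ‖f‖ = 1 → θ - C * (‖hamiltonian U α f - (l : ℂ) • f‖ +
      ‖(hamiltonian U α - V) f‖) ^ 2 - ‖(B α - D) f‖ ≤ (⟪f, B α f⟫_ℂ).re :=
    fun α f hf => re_inner_ge_of_model hmodel hC hf
  let P : ℤ → ℝ → Prop := fun α ε => ∀ f : L2, ‖f‖ = 1 →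
    ‖hamiltonian U α f - (l : ℂ) • f‖ ≤ ε → θ / 2 ≤ (⟪f, B α f⟫_ℂ).re
  have hmono : ∀ {α ε}, 0 < ε → P α ε → ∀ᶠ ε' in 𝓝[>] (0 : ℝ), P α ε' := by
    intro α ε hε h
    filter_upwards [Ioo_mem_nhdsGT hε] with ε' hε' f hf hle
    exact h f hf (hle.trans hε'.2.le)
  obtain ⟨K₁, hK₁⟩ := hHV
  obtain ⟨K₂, hK₂⟩ := hBD
  have hfix : ∀ α : ℤ, α ≠ 0 → ∀ᶠ ε in 𝓝[>] (0 : ℝ), P α ε := by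
    intro α hα
    by_contra hcon
    have hn : ∀ n : ℕ, ∃ f : L2, ‖f‖ = 1 ∧
        ‖hamiltonian U α f - (l : ℂ) • f‖ ≤ 1 / ((n : ℝ) + 1) ∧ (⟪f, B α f⟫_ℂ).re < θ / 2 := by
      intro n
      by_contra! hno
      exact hcon (hmono (by positivity : (0 : ℝ) < 1 / ((n : ℝ) + 1)) fun f hf hle =>
        hno f hf hle)
    choose f hf1 hf2 hf3 using hn
    set T := hamiltonian U α - (l : ℂ) • (1 : L2 →L[ℂ] L2) with hTdef
    have hTf : ∀ g, T g = hamiltonian U α g - (l : ℂ) • g := fun g => rfl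
    have hTsa : IsSelfAdjoint T := by
      refine (isSelfAdjoint_hamiltonian h1 h2 α).sub ?_
      rw [IsSelfAdjoint, star_smul, star_one]
      congr 1
      exact Complex.conj_ofReal l
    have hTker : ∀ g, T g = 0 → g = 0 := fun g hg =>
      eq_zero_of_hamiltonian_eigenvector h1 h2 h3 hα hl (sub_eq_zero.1 ((hTf g).symm.trans hg))
    have hlim : Tendsto (fun n => ‖hamiltonian U α (f n) - (l : ℂ) • f n‖) atTop (𝓝 0) :=
      squeeze_zero (fun n => norm_nonneg _) hf2 tendsto_one_div_add_atTop_nhds_zero_nat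
    have hnull : WeakNull f := weakNull_of_tendsto hTsa hTker (fun n => (hf1 n).le)
      (tendsto_zero_iff_norm_tendsto_zero.2 (by simpa only [hTf] using hlim))
    have t1 := ((hK₁ α hα).1 f hnull).norm
    have t2 := ((hK₂ α hα).1 f hnull).norm
    rw [norm_zero] at t1 t2
    have t3 := (tendsto_const_nhds (x := θ)).sub (((hlim.add t1).pow 2).const_mul C) |>.sub t2
    have t4 : θ - C * (0 + 0) ^ 2 - 0 ≤ θ / 2 :=
      le_of_tendsto t3 (Eventually.of_forall fun n => (hlow α (f n) (hf1 n)).trans (hf3 n).le)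
    norm_num at t4
    linarith
  have hlarge : ∃ M : ℝ, ∃ ε₀ : ℝ, 0 < ε₀ ∧ ∀ α : ℤ, α ≠ 0 → M ≤ (α : ℝ) ^ 2 → P α ε₀ := by
    have hc : Continuous fun ε : ℝ => θ - C * (ε + |K₁| * ε) ^ 2 - |K₂| * ε := by fun_prop
    have hc0 : ∀ᶠ ε in 𝓝[>] (0 : ℝ), θ / 2 < θ - C * (ε + |K₁| * ε) ^ 2 - |K₂| * ε := by
      refine (hc.tendsto 0).mono_left nhdsWithin_le_nhds |>.eventually_const_lt ?_
      norm_num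
      linarith
    obtain ⟨ε, hε, hε0⟩ := (hc0.and self_mem_nhdsWithin).exists
    have hε0' : 0 < ε := hε0
    refine ⟨ε⁻¹, ε, hε0', fun α hα hM f hf hle => hε.le.trans (le_trans ?_ (hlow α f hf))⟩
    have hinv : ∀ K : ℝ, K / (α : ℝ) ^ 2 ≤ |K| * ε := by
      intro K
      have h4 : ((α : ℝ) ^ 2)⁻¹ ≤ ε := by
        rw [inv_le_comm₀ (by positivity) hε0']
        exact hM
      rw [div_eq_mul_inv]
      exact mul_le_mul (le_abs_self K) h4 (by positivity) (abs_nonneg K)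
    have n1 : ‖(hamiltonian U α - V) f‖ ≤ |K₁| * ε := by
      have := (hamiltonian U α - V).le_opNorm f
      rw [hf, mul_one] at this
      exact this.trans ((hK₁ α hα).2.trans (hinv K₁))
    have n2 : ‖(B α - D) f‖ ≤ |K₂| * ε := by
      have := (B α - D).le_opNorm f
      rw [hf, mul_one] at this
      exact this.trans ((hK₂ α hα).2.trans (hinv K₂))
    gcongr
  obtain ⟨M, ε₀, hε₀, hlarge⟩ := hlarge
  have hfin : {α : ℤ | (α : ℝ) ^ 2 < M}.Finite := by
    refine (Set.finite_Icc (-(⌈M⌉)) ⌈M⌉).subset fun α hα => ?_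
    have hα' : α ^ 2 < ⌈M⌉ := by
      have : ((α ^ 2 : ℤ) : ℝ) < M := by exact_mod_cast hα
      exact_mod_cast this.trans_le (Int.le_ceil M)
    constructor <;> nlinarith
  have hall : ∀ᶠ ε in 𝓝[>] (0 : ℝ), ∀ α ∈ {α : ℤ | (α : ℝ) ^ 2 < M}, α ≠ 0 → P α ε := by
    refine (eventually_all_finite hfin).2 fun α _ => ?_
    by_cases hα : α = 0
    · exact Eventually.of_forall fun ε h => absurd hα h
    · exact (hfix α hα).mono fun ε h _ => h
  obtain ⟨ε, hε, hε0, hεε₀⟩ := (hall.and (Ioo_mem_nhdsGT hε₀)).exists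
  refine ⟨θ / 2, ε, half_pos hθ, hε0, fun α hα f hf => ?_⟩
  have hP : P α ε := by
    by_cases hM : (α : ℝ) ^ 2 < M
    · exact hε α hM hα
    · exact fun g hg hle => hlarge α hα (not_lt.1 hM) g hg (hle.trans hεε₀.le)
  rcases eq_or_ne f 0 with rfl | hf0
  · simp
  have hn := norm_pos_iff.2 hf0
  set c : ℂ := ((‖f‖⁻¹ : ℝ) : ℂ) with hc
  have hcn : ‖c‖ = ‖f‖⁻¹ := by
    rw [hc, Complex.norm_real, Real.norm_of_nonneg (by positivity)]
  have h4 := hP (c • f) (by rw [norm_smul, hcn, inv_mul_cancel₀ hn.ne']) (by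
    rw [map_smul, smul_comm, ← smul_sub, norm_smul, hcn, inv_mul_le_iff₀ hn]
    linarith)
  rw [map_smul, inner_smul_left, inner_smul_right, ← mul_assoc, hc, Complex.conj_ofReal,
    ← Complex.ofReal_mul, Complex.re_ofReal_mul, ← sq, inv_pow, le_inv_mul_iff₀ (by positivity)]
    at h4
  linarith

/-- Vectors in the range of `χ(H)` are approximate eigenvectors, if `χ` is supported close
to `l`. -/
theorem norm_sub_smul_functionOf_le {H : L2 →L[ℂ] L2} (hH : IsSelfAdjoint H) {χ : ℝ → ℂ}
    (hχ : Continuous χ) {l ε : ℝ} (hε : 0 ≤ ε) (hs : ∀ x, ε < |x - l| → χ x = 0) (η : L2) :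
    ‖H (functionOf χ H η) - (l : ℂ) • functionOf χ H η‖ ≤ ε * ‖functionOf χ H η‖ := by
  set κ : ℝ → ℂ := fun x => ((max (-ε) (min ε (x - l)) : ℝ) : ℂ) with hκ
  have hκc : Continuous κ := by
    rw [hκ]
    fun_prop
  have e : H * functionOf χ H - (l : ℂ) • functionOf χ H = functionOf κ H * functionOf χ H := by
    rw [← functionOf_smul hχ, ← functionOf_mul hκc hχ]
    nth_rewrite 1 [← functionOf_id hH]
    rw [← functionOf_mul Complex.continuous_ofReal hχ, sub_eq_iff_eq_add,
      ← functionOf_add (g := fun x => κ x * χ x) (h := fun x => (l : ℂ) * χ x) (hκc.mul hχ)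
        (continuous_const.mul hχ)]
    refine functionOf_congr fun x _ => ?_
    by_cases hx : ε < |x - l|
    · simp [hs x hx]
    · have hx' := abs_le.1 (not_lt.1 hx)
      rw [hκ]
      simp only
      rw [min_eq_right hx'.2, max_eq_right hx'.1]
      push_cast
      ring
  have e2 : H (functionOf χ H η) - (l : ℂ) • functionOf χ H η =
      functionOf κ H (functionOf χ H η) :=
    congrArg (fun T : L2 →L[ℂ] L2 => T η) e
  rw [e2]
  refine ((functionOf κ H).le_opNorm _).trans (mul_le_mul_of_nonneg_right ?_ (norm_nonneg _))
  refine norm_functionOf_le hε fun x _ => ?_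
  rw [hκ, Complex.norm_real, Real.norm_eq_abs, abs_le]
  exact ⟨le_max_left _ _, max_le (by linarith) (min_le_left _ _)⟩

/-! ### Localization in energy and conclusion -/

variable {U : ℝ → ℝ} {Um Up : ℝ}

/-- The decay estimate for the part of the solution localized in energy by `g`. -/
def Decays (U : ℝ → ℝ) (k : ℕ) (g : ℝ → ℂ) : Prop :=
  ∃ C : ℝ, 0 < C ∧ ∀ α : ℤ, α ≠ 0 → ∀ (ψ₀ : L2) (hψ₀ : ψ₀ ∈ sobolev k) (ψ : ℝ → L2),
    IsSolution (hamiltonian U α) ψ₀ ψ → ∀ t : ℝ, 0 ≤ t →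
      ‖bracketNegPow k (functionOf g (hamiltonian U α) (ψ t))‖ ≤
        C / (1 + t) ^ k * ‖bracketPow k ⟨ψ₀, hψ₀⟩‖

theorem Decays.sum {ι : Type*} (s : Finset ι) {k : ℕ} {g : ι → ℝ → ℂ}
    (hg : ∀ i ∈ s, Continuous (g i)) (h : ∀ i, Decays U k (g i)) :
    Decays U k fun x => ∑ i ∈ s, g i x := by
  choose C hC hd using h
  refine ⟨∑ i ∈ s, C i + 1, add_pos_of_nonneg_of_pos (Finset.sum_nonneg fun i _ => (hC i).le)
    one_pos, fun α hα ψ₀ hψ₀ ψ hψ t ht => ?_⟩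
  rw [functionOf_sum s hg, sum_apply, map_sum]
  calc ‖∑ i ∈ s, bracketNegPow k (functionOf (g i) (hamiltonian U α) (ψ t))‖
      ≤ ∑ i ∈ s, C i / (1 + t) ^ k * ‖bracketPow k ⟨ψ₀, hψ₀⟩‖ :=
        norm_sum_le_of_le _ fun i _ => hd i α hα ψ₀ hψ₀ ψ hψ t ht
    _ = (∑ i ∈ s, C i) / (1 + t) ^ k * ‖bracketPow k ⟨ψ₀, hψ₀⟩‖ := by
        rw [Finset.sum_div, Finset.sum_mul]
    _ ≤ _ := by
        gcongr
        linarith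

/-- Decay for energies close to a given point of the range of `U`. -/
theorem exists_decays_near (h1 : AssumptionH1 U Um Up) (h2 : AssumptionH2 U Um Up)
    (h3 : AssumptionH3 U) {k : ℕ} (hk : 1 ≤ k) {l : ℝ} (hl : l ∈ Ioo Um Up) : ∃ ε : ℝ, 0 < ε ∧
      ∀ g : ℝ → ℂ, ContDiff ℝ ∞ g → tsupport g ⊆ Metric.ball l ε → Decays U k g := by
  obtain ⟨H', hAd, hHV, hH'⟩ := exists_hamiltonian_deriv h1 h2 h3
  obtain ⟨θ, ε, hθ, hε, hM⟩ := exists_mourre h1 h2 h3 hl hHV hH'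
  refine ⟨ε / 2, half_pos hε, fun g hg hgs => ?_⟩
  have hgc : HasCompactSupport g := (isCompact_closedBall l (ε / 2)).of_isClosed_subset
    (isClosed_tsupport g) (hgs.trans Metric.ball_subset_closedBall)
  -- a cutoff that equals one on the support of `g`
  let χ : ContDiffBump l := ⟨ε / 2, ε, half_pos hε, half_lt_self hε⟩
  have hχ : ContDiff ℝ ∞ fun x => (χ x : ℂ) := Complex.ofRealCLM.contDiff.comp χ.contDiff
  have hχc : HasCompactSupport fun x => (χ x : ℂ) :=
    χ.hasCompactSupport.comp_left (g := Complex.ofReal) Complex.ofReal_zero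
  have hχg : ∀ x, (χ x : ℂ) * g x = g x := by
    intro x
    by_cases hx : x ∈ tsupport g
    · have : χ x = 1 := χ.one_of_mem_closedBall (Metric.ball_subset_closedBall (hgs hx))
      rw [this, Complex.ofReal_one, one_mul]
    · rw [image_eq_zero_of_notMem_tsupport hx, mul_zero]
  obtain ⟨N, hN⟩ := exists_decay hk
  obtain ⟨c₀, hc₀⟩ := exists_bd_hamiltonian h1 h2 h3 (N + 1)
  have hc₁ : ∀ α : ℤ, α ≠ 0 → Bd 1 N (hamiltonian U α) c₀ ∧ Bd 1 N (H' α) c₀ := by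
    intro α hα
    obtain ⟨T', a, b, hT', ha, hb, hab⟩ := hc₀ α hα
    have ha0 := ha.nonneg zero_le_one
    have hb0 := hb.nonneg zero_le_one
    rw [(hAd α hα).unique hT']
    exact ⟨ha.mono (by linarith), hb.mono (by linarith)⟩
  obtain ⟨c₂, hc₂⟩ := exists_bd_functionOf hχ hχc N c₀
  obtain ⟨c₃, hc₃⟩ := exists_bd_functionOf hg hgc N c₀
  obtain ⟨C, hC, hdec⟩ := hN (max c₀ (max c₂ c₃)) θ hθ
  refine ⟨C, hC, fun α hα => ?_⟩
  have hH := isSelfAdjoint_hamiltonian h1 h2 α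
  refine hdec (hamiltonian U α) (H' α) (functionOf (fun x => (χ x : ℂ)) (hamiltonian U α))
    (functionOf g (hamiltonian U α)) hH (hAd α hα) ((hc₀ α hα).mono (le_max_left _ _))
    ((hc₁ α hα).2.mono (le_max_left _ _))
    ((hc₂ _ hH (hc₁ α hα).1).mono ((le_max_left _ _).trans (le_max_right _ _)))
    ((hc₃ _ hH (hc₁ α hα).1).mono ((le_max_right _ _).trans (le_max_right _ _))) ?_
    (functionOf_comm_self hH hg.continuous) fun η => ?_
  · rw [← functionOf_mul hχ.continuous hg.continuous]
    simp only [hχg]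
  · refine hM α hα _ (norm_sub_smul_functionOf_le hH hχ.continuous hε.le (fun x hx => ?_) η)
    rw [χ.zero_of_le_dist (show ε ≤ dist x l from hx.le), Complex.ofReal_zero]

open scoped Manifold in
theorem decays_of_tsupport_subset (h1 : AssumptionH1 U Um Up) (h2 : AssumptionH2 U Um Up)
    (h3 : AssumptionH3 U) {k : ℕ} (hk : 1 ≤ k) {I₀ : Set ℝ} (hI₀ : IsCompact I₀)
    (hI₀U : I₀ ⊆ Ioo Um Up) {g : ℝ → ℂ} (hg : ContDiff ℝ ∞ g) (hgI₀ : tsupport g ⊆ I₀) :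
    Decays U k g := by
  choose ε hε hdec using fun l : I₀ => exists_decays_near h1 h2 h3 hk (hI₀U l.2)
  obtain ⟨s, hs⟩ := hI₀.elim_finite_subcover (fun l : I₀ => Metric.ball (l : ℝ) (ε l))
    (fun _ => Metric.isOpen_ball) fun x hx =>
      mem_iUnion.2 ⟨⟨x, hx⟩, Metric.mem_ball_self (hε ⟨x, hx⟩)⟩
  obtain ⟨f, hf⟩ := SmoothPartitionOfUnity.exists_isSubordinate 𝓘(ℝ, ℝ) hI₀.isClosed
    (fun l : s => Metric.ball ((l : I₀) : ℝ) (ε l)) (fun _ => Metric.isOpen_ball) (by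
      intro x hx
      obtain ⟨l, hl, hxl⟩ := mem_iUnion₂.1 (hs hx)
      exact mem_iUnion.2 ⟨⟨l, hl⟩, hxl⟩)
  have hfc : ∀ l, ContDiff ℝ ∞ fun x => (f l x : ℂ) * g x := fun l =>
    (Complex.ofRealCLM.contDiff.comp (f l).contMDiff.contDiff).mul hg
  have hsum : g = fun x => ∑ l : s, (f l x : ℂ) * g x := by
    funext x
    by_cases hx : x ∈ tsupport g
    · have := f.sum_eq_one (hgI₀ hx)
      rw [finsum_eq_sum_of_fintype] at this
      rw [← Finset.sum_mul, ← Complex.ofReal_sum, this, Complex.ofReal_one, one_mul]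
    · simp [image_eq_zero_of_notMem_tsupport hx]
  rw [hsum]
  refine Decays.sum _ (fun l _ => (hfc l).continuous) fun l => hdec l _ (hfc l) ?_
  refine (closure_mono fun x hx => ?_).trans (hf l)
  intro h0
  exact hx (by simp [h0])

end ShearFlow

end

theorem theorem1 (U : ℝ → ℝ) (Um Up : ℝ)
    (h1 : AssumptionH1 U Um Up) (h2 : AssumptionH2 U Um Up) (h3 : AssumptionH3 U)
    (k : ℕ) (hk : 1 ≤ k)
    (I₀ : Set ℝ) (hI₀ : IsCompact I₀) (hI₀U : I₀ ⊆ Set.Ioo Um Up)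
    (g : ℝ → ℂ) (hg : ContDiff ℝ ∞ g) (hgI₀ : tsupport g ⊆ I₀) :
    ∃ C : ℝ, 0 < C ∧
      ∀ α : ℤ, α ≠ 0 →
        ∀ (ψ₀ : L2) (hψ₀ : ψ₀ ∈ sobolev k) (ψ : ℝ → L2),
          IsSolution (hamiltonian U α) ψ₀ ψ →
            ∀ t : ℝ, 0 ≤ t →
              ‖bracketNegPow k (functionOf g (hamiltonian U α) (ψ t))‖ ≤
                C / (1 + t ^ k) * ‖bracketPow k ⟨ψ₀, hψ₀⟩‖ := by
  obtain ⟨C, hC, h⟩ := decays_of_tsupport_subset h1 h2 h3 hk hI₀ hI₀U hg hgI₀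
  refine ⟨C, hC, fun α hα ψ₀ hψ₀ ψ hψ t ht => (h α hα ψ₀ hψ₀ ψ hψ t ht).trans ?_⟩
  have hpow : 1 + t ^ k ≤ (1 + t) ^ k := by
    simpa using pow_add_pow_le zero_le_one ht (Nat.one_le_iff_ne_zero.1 hk)
  gcongr
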